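/- Let $k\ge 2$. A $k$-graph $H=(V,E)$ consists of a finite nonempty vertex set $V$ and a set $E$ of $k$-element subsets of $V$. Write $v(H)=|V|$, and let $\delta_1(H)$ be the minimum, over all vertices $w\in V$, of the number of edges of $H$ containing $w$. For $p\in[0,1]$ and $\mu>0$, a $k$-graph $H=(V,E)$ with $n$ vertices is called $(p,\mu,\mathrm{cherry})$-dense if for any two sets of ordered $(k-1)$-tuples $P,Q\subseteq V^{k-1}$, $$e(P,Q)\ \ge\ p\,|\mathcal K(P,Q)|-\mu n^k,$$ where $\mathcal K(P,Q)=\{(x_1,\dots,x_k)\in V^k : (x_1,\dots,x_{k-1})\in P \text{ and } (x_2,\dots,x_k)\in Q\}$ and $e(P,Q)$ is the number of $(x_1,\dots,x_k)\in\mathcal K(P,Q)$ with $\{x_1,\dots,x_k\}\in E$. A copy of a $k$-graph $F$ in $H$ is a (not necessarily induced) subhypergraph of $H$ isomorphic to $F$. An $F$-factor in $H$ is a set of pairwise vertex-disjoint copies of $F$ in $H$ that together cover $V(H)$. Let $\mathbf{FACTOR}_k^{\mathrm{cherry},1}$ be the collection of $k$-graphs $F$ such that for all $0<p,\alpha<1$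 there are $n_0\in\mathbb N$ and $\mu>0$ such that every $(p,\mu,\mathrm{cherry})$-dense $k$-graph $H$ on $n\ge n_0$ vertices with $\delta_1(H)\ge\alpha n^{k-1}$ and $v(F)\mid n$ has an $F$-factor. Let $\mathbf{COVER}_k^{\mathrm{cherry},1}$ be the collection of $k$-graphs $F$ such that for all $0<p,\alpha<1$ there are $n_0\in\mathbb N$ and $\mu>0$ such that in every $(p,\mu,\mathrm{cherry})$-dense $k$-graph $H$ on $n\ge n_0$ vertices with $\delta_1(H)\ge\alpha n^{k-1}$, each vertex of $H$ is contained in a copy of $F$. Then, for every $k\ge 2$, $$\mathbf{FACTOR}_k^{\mathrm{cherry},1}=\mathbf{COVER}_k^{\mathrm{cherry},1}.$$ -/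

import Mathlib

/-- A `k`-graph (`k`-uniform hypergraph) on the vertex set `V`: a set of edges, each of which is a
`k`-element subset of `V`. -/
structure KGraph (k : ℕ) (V : Type*) where
  /-- the set of edges -/
  edges : Set (Finset V)
  card_eq : ∀ e ∈ edges, e.card = k

namespace KGraph

/-- `deg_H(S)`: the number of edges of `H` that contain the vertex set `S`. -/
noncomputable def degree {k : ℕ} {W : Type*} (H : KGraph k W) (S : Finset W) : ℕ :=
  {e : Finset W | e ∈ H.edges ∧ S ⊆ e}.ncard

/-- The minimum `s`-degree `δ_s(H)`: the minimum of `deg_H(S)` over all `s`-subsets `S` of the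
vertex set. (The value is only meaningful if `H` has at least `s` vertices.) -/
noncomputable def minDegree {k : ℕ} {W : Type*} (H : KGraph k W) (s : ℕ) : ℕ :=
  sInf {d : ℕ | ∃ S : Finset W, S.card = s ∧ H.degree S = d}

/-- `K(P, Q)`: the tuples `(x₁, …, x_k)` with `(x₁, …, x_{k-1}) ∈ P` and `(x₂, …, x_k) ∈ Q`. -/
def cherrySet (k : ℕ) {W : Type*} (P Q : Set (Fin (k - 1) → W)) : Set (Fin k → W) :=
  {x | (fun i : Fin (k - 1) => x ⟨(i : ℕ), by omega⟩) ∈ P ∧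
       (fun i : Fin (k - 1) => x ⟨(i : ℕ) + 1, by omega⟩) ∈ Q}

/-- The number `e(P, Q)` of tuples `(x₁, …, x_k)` in `K(P, Q)` whose underlying set
`{x₁, …, x_k}` is an edge of `H`. -/
noncomputable def cherryEdgeCount {k : ℕ} {W : Type*} (H : KGraph k W)
    (P Q : Set (Fin (k - 1) → W)) : ℕ :=
  {x : Fin k → W | x ∈ cherrySet k P Q ∧
    ∃ e ∈ H.edges, (e : Set W) = Set.range x}.ncard

/-- `H` is `(p, μ, cherry)`-dense: `e(P, Q) ≥ p |K(P, Q)| - μ n ^ k` for all sets `P`, `Q` of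
ordered `(k - 1)`-tuples of vertices, where `n` is the number of vertices of `H`. -/
def CherryDense {k : ℕ} {W : Type*} [Fintype W] (H : KGraph k W) (p μ : ℝ) : Prop :=
  ∀ P Q : Set (Fin (k - 1) → W),
    p * ((cherrySet k P Q).ncard : ℝ) - μ * (Fintype.card W : ℝ) ^ k
      ≤ (H.cherryEdgeCount P Q : ℝ)

/-- A (labelled) copy of `F` in `H`: an injection of the vertices which maps edges to edges.
The copy need not be induced. -/
structure Copy {k : ℕ} {V W : Type*} (F : KGraph k V) (H : KGraph k W) where
  /-- the injection of the vertices -/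
  toEmbedding : V ↪ W
  map_edge : ∀ e ∈ F.edges, e.map toEmbedding ∈ H.edges

/-- The vertex set of a copy. -/
def Copy.verts {k : ℕ} {V W : Type*} {F : KGraph k V} {H : KGraph k W} (c : Copy F H) : Set W :=
  Set.range c.toEmbedding

/-- `H` has an `F`-factor: a set of pairwise vertex-disjoint copies of `F` that together cover
the vertex set of `H`. -/
def HasFactor {k : ℕ} {V W : Type*} (F : KGraph k V) (H : KGraph k W) : Prop :=
  ∃ T : Set (Copy F H),
    T.PairwiseDisjoint Copy.verts ∧ ⋃ c ∈ T, Copy.verts c = Set.univ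

/-- `H` has an `F`-cover: every vertex of `H` is contained in a copy of `F`. -/
def HasCover {k : ℕ} {V W : Type*} (F : KGraph k V) (H : KGraph k W) : Prop :=
  ∀ w : W, ∃ c : Copy F H, w ∈ c.verts

/-- The members with vertex set `V` of the collection `FACTOR_k^{cherry,s}`. -/
def cherryFACTOR (k s : ℕ) (V : Type*) [Fintype V] : Set (KGraph k V) :=
  {F | ∀ p α : ℝ, 0 < p → p < 1 → 0 < α → α < 1 →
    ∃ (n₀ : ℕ) (μ : ℝ), 0 < μ ∧
      ∀ (W : Type) [Fintype W] (H : KGraph k W),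
        H.CherryDense p μ →
        α * (Fintype.card W : ℝ) ^ (k - s) ≤ (H.minDegree s : ℝ) →
        n₀ ≤ Fintype.card W →
        Fintype.card V ∣ Fintype.card W →
        HasFactor F H}

/-- The members with vertex set `V` of the collection `COVER_k^{cherry,s}`. -/
def cherryCOVER (k s : ℕ) (V : Type*) : Set (KGraph k V) :=
  {F | ∀ p α : ℝ, 0 < p → p < 1 → 0 < α → α < 1 →
    ∃ (n₀ : ℕ) (μ : ℝ), 0 < μ ∧
      ∀ (W : Type) [Fintype W] (H : KGraph k W),
        H.CherryDense p μ →
        α * (Fintype.card W : ℝ) ^ (k - s) ≤ (H.minDegree s : ℝ) →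
        n₀ ≤ Fintype.card W →
        HasCover F H}

end KGraph

/-! From factor to cover: delete fewer than v(F) vertices other than the given one, so that v(F)
divides what is left. Density and degrees barely change, and the copy of F through the given vertex
in a factor is what is wanted.

From cover to factor the absorbing method is used. The hypothesis yields one copy through each
vertex; absorption needs positive proportions of copies, rooted at prescribed links. The step
between is `exists_many_rooted`. Given a dense system L of (k-1)-sets, take a random sample of
boundedly many vertices, replace the link of one sampled vertex by the trace of L (`graft`), and
apply the covering property to that vertex. This requires that samples of a cherry-dense k-graph are
again cherry-dense, possibly with a smaller p, which is harmless since covering is assumed for every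
p. Cherry-density is a condition on all pairs P, Q, so it is first traded for a local count: for
each middle (k-2)-tuple y, the tuples x, z such that every entry of z has few partners in x (the
predicate `Sparse`). Density makes such tuples rare (`LinkDense.cnt_sparse_mul_le`), rarity gives
back density (`linkDense_of_cnt_sparse_le`), and a local count passes to samples by averaging
(`exists_linkDense_sample`).

Taking for L the common link of two vertices of large codegree gives many copies of F in which one
vertex can be exchanged for the other (`exists_many_exchange`). Density makes almost every vertex y
reachable from a given t through many intermediate vertices (`cnt_unlinked_le`). As copies of F have
positive density, most copies have their i-th vertex reachable from the i-th entry of any v(F)-tuple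
T, so a positive proportion of bounded configurations absorb T (`exists_many_absorbers`). A greedy
choice gives a disjoint family with linearly many absorbers for each T (`exists_absorbing_family`).
Every linear-size set contains a copy of F, so all but a small remainder outside the family is tiled
greedily; Hall's theorem assigns distinct absorbers to the remainder. -/

open Function

/-! ### Counting in finite types and tuples over a finite set. -/

section Counting

/-- The number of elements of a finite type satisfying a predicate, as a real number. -/
noncomputable def cnt {α : Type*} [Fintype α] (P : α → Prop) : ℝ := by
  classical exact ∑ x, if P x then 1 else 0

open scoped Classical in
theorem cnt_eq_sum {α : Type*} [Fintype α] (P : α → Prop) :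
    cnt P = ∑ x, if P x then (1 : ℝ) else 0 := by
  unfold cnt; congr!

open scoped Classical in
theorem cnt_eq_card {α : Type*} [Fintype α] (P : α → Prop) :
    cnt P = ((Finset.univ.filter P).card : ℝ) := by
  rw [cnt_eq_sum, Finset.sum_boole]

theorem cnt_eq_ncard {α : Type*} [Fintype α] (P : α → Prop) :
    cnt P = (({x | P x} : Set α).ncard : ℝ) := by
  classical
  rw [cnt_eq_card, ← Set.ncard_coe_finset]
  simp

theorem cnt_nonneg {α : Type*} [Fintype α] (P : α → Prop) : 0 ≤ cnt P := by
  rw [cnt_eq_ncard]; positivity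

theorem cnt_mono {α : Type*} [Fintype α] {P Q : α → Prop} (h : ∀ x, P x → Q x) :
    cnt P ≤ cnt Q := by
  rw [cnt_eq_ncard, cnt_eq_ncard]
  exact_mod_cast Set.ncard_le_ncard h

theorem cnt_congr {α : Type*} [Fintype α] {P Q : α → Prop} (h : ∀ x, P x ↔ Q x) :
    cnt P = cnt Q :=
  le_antisymm (cnt_mono fun x => (h x).1) (cnt_mono fun x => (h x).2)

theorem cnt_true {α : Type*} [Fintype α] : cnt (fun _ : α => True) = Fintype.card α := by
  classical
  simp [cnt_eq_sum]

theorem cnt_le_card {α : Type*} [Fintype α] (P : α → Prop) : cnt P ≤ Fintype.card α := by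
  rw [← cnt_true]; exact cnt_mono fun _ _ => trivial

theorem cnt_false {α : Type*} [Fintype α] : cnt (fun _ : α => False) = 0 := by
  classical
  simp [cnt_eq_sum]

theorem exists_of_cnt_pos {α : Type*} [Fintype α] {P : α → Prop} (h : 0 < cnt P) : ∃ x, P x := by
  by_contra! h'
  have : cnt P ≤ cnt (fun _ : α => False) := cnt_mono h'
  rw [cnt_false] at this
  linarith

theorem cnt_or_le {α : Type*} [Fintype α] (P Q : α → Prop) :
    cnt (fun x => P x ∨ Q x) ≤ cnt P + cnt Q := by
  simp only [cnt_eq_ncard]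
  exact_mod_cast Set.ncard_union_le {x | P x} {x | Q x}

theorem cnt_add_cnt_not {α : Type*} [Fintype α] (P : α → Prop) :
    cnt P + cnt (fun x => ¬ P x) = Fintype.card α := by
  classical
  rw [cnt_eq_sum, cnt_eq_sum, ← Finset.sum_add_distrib]
  rw [Finset.sum_congr rfl (g := fun _ => (1 : ℝ)) fun x _ => by by_cases h : P x <;> simp [h]]
  simp

theorem cnt_le_and_add {α : Type*} [Fintype α] (P Q : α → Prop) :
    cnt P ≤ cnt (fun x => P x ∧ Q x) + cnt (fun x => ¬ Q x) :=
  le_trans (cnt_mono fun x hx => by by_cases h : Q x <;> simp [h, hx]) (cnt_or_le _ _)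

theorem cnt_equiv {α β : Type*} [Fintype α] [Fintype β] (e : α ≃ β) (P : β → Prop) :
    cnt (fun x => P (e x)) = cnt P := by
  classical
  rw [cnt_eq_sum, cnt_eq_sum]
  exact Equiv.sum_comp e (fun x => if P x then (1 : ℝ) else 0)

theorem cnt_prod {α β : Type*} [Fintype α] [Fintype β] (P : α → β → Prop) :
    cnt (fun x : α × β => P x.1 x.2) = ∑ a, cnt (fun b => P a b) := by
  classical
  simp only [cnt_eq_sum]
  rw [Fintype.sum_prod_type]

theorem sum_cnt_comm {α β : Type*} [Fintype α] [Fintype β] (P : α → β → Prop) :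
    ∑ a, cnt (fun b => P a b) = ∑ b, cnt (fun a => P a b) := by
  classical
  simp only [cnt_eq_sum]
  rw [Finset.sum_comm]

theorem cnt_and_prod {α β : Type*} [Fintype α] [Fintype β] (P : α → Prop) (Q : β → Prop) :
    cnt (fun x : α × β => P x.1 ∧ Q x.2) = cnt P * cnt Q := by
  classical
  rw [cnt_prod (fun a b => P a ∧ Q b)]
  simp only [cnt_eq_sum, Finset.sum_mul_sum]
  refine Finset.sum_congr rfl fun a _ => Finset.sum_congr rfl fun b _ => ?_
  by_cases h : P a <;> by_cases h' : Q b <;> simp [h, h']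

theorem cnt_exists_le {ι α : Type*} [Fintype ι] [Fintype α] (P : ι → α → Prop) :
    cnt (fun x => ∃ i, P i x) ≤ ∑ i, cnt (P i) := by
  classical
  rw [sum_cnt_comm, cnt_eq_sum]
  refine Finset.sum_le_sum fun x _ => ?_
  split_ifs with h
  · obtain ⟨i, hi⟩ := h
    rw [cnt_eq_card]
    exact_mod_cast Finset.card_pos.2 ⟨i, by simpa using hi⟩
  · exact cnt_nonneg _

theorem exists_large_cnt {ι α : Type*} [Fintype ι] [Fintype α] (P : ι → α → Prop) {K C : ℝ}
    (hC : 0 < C) (hK : Fintype.card ι ≤ K) (h : C ≤ cnt (fun x => ∃ i, P i x)) :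
    ∃ i, C ≤ K * cnt (P i) := by
  by_contra! hlt
  have hne : Nonempty ι := by
    obtain ⟨x, i, _⟩ := exists_of_cnt_pos (hC.trans_le h)
    exact ⟨i⟩
  have hpos : (0 : ℝ) < Fintype.card ι := by exact_mod_cast Fintype.card_pos
  have h1 : ∀ i, cnt (P i) < C / Fintype.card ι := by
    intro i
    rw [lt_div_iff₀ hpos]
    nlinarith [hlt i, cnt_nonneg (P i)]
  have h2 := cnt_exists_le P
  have h3 : ∑ i, cnt (P i) < ∑ _i : ι, C / Fintype.card ι :=
    Finset.sum_lt_sum_of_nonempty Finset.univ_nonempty fun i _ => h1 i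
  rw [Finset.sum_const, Finset.card_univ, nsmul_eq_mul, mul_div_cancel₀ _ hpos.ne'] at h3
  linarith

theorem cnt_le_mul_of_fiber {α β : Type*} [Fintype α] [Fintype β] {P : α → Prop} {Q : β → Prop}
    {K : ℝ} (f : α → β) (hf : ∀ a, P a → Q (f a))
    (hK : ∀ b, Q b → cnt (fun a => P a ∧ f a = b) ≤ K) : cnt P ≤ K * cnt Q := by
  classical
  have h1 : cnt P = ∑ b, cnt (fun a => P a ∧ f a = b) := by
    rw [sum_cnt_comm, cnt_eq_sum]
    refine Finset.sum_congr rfl fun a _ => ?_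
    rw [cnt_eq_sum]
    by_cases h : P a <;> simp [h]
  rw [h1, cnt_eq_sum, Finset.mul_sum]
  refine Finset.sum_le_sum fun b _ => ?_
  split_ifs with h
  · simpa using hK b h
  · rw [mul_zero, ← cnt_false (α := α)]
    exact cnt_mono fun a ha => h (ha.2 ▸ hf a ha.1)

theorem cnt_le_of_injOn {α β : Type*} [Fintype α] [Fintype β] {P : α → Prop} {Q : β → Prop}
    (f : α → β) (hf : ∀ a, P a → Q (f a)) (hinj : ∀ a b, P a → P b → f a = f b → a = b) :
    cnt P ≤ cnt Q := by
  rw [← one_mul (cnt Q)]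
  refine cnt_le_mul_of_fiber f hf fun b _ => ?_
  rw [cnt_eq_ncard]
  have : ({a | P a ∧ f a = b} : Set α).ncard ≤ 1 := by
    rw [Set.ncard_le_one_iff]
    intro x y hx hy
    exact hinj _ _ hx.1 hy.1 (hx.2.trans hy.2.symm)
  exact_mod_cast this

theorem mul_cnt_le_sum {α : Type*} [Fintype α] {f : α → ℝ} {t : ℝ} (hf : ∀ a, 0 ≤ f a)
    {P : α → Prop} (hP : ∀ a, P a → t ≤ f a) : t * cnt P ≤ ∑ a, f a := by
  classical
  rw [cnt_eq_sum, Finset.mul_sum]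
  refine Finset.sum_le_sum fun a _ => ?_
  split_ifs with h
  · simpa using hP a h
  · simpa using hf a

theorem sum_le_cnt_add {α : Type*} [Fintype α] {f : α → ℝ} {M t : ℝ} (ht : 0 ≤ t)
    {P : α → Prop} (hM : ∀ a, P a → f a ≤ M) (hP : ∀ a, ¬ P a → f a ≤ t) :
    ∑ a, f a ≤ M * cnt P + t * Fintype.card α := by
  classical
  have : ∑ a, f a ≤ ∑ a, (M * (if P a then 1 else 0) + t) := by
    refine Finset.sum_le_sum fun a _ => ?_
    split_ifs with h
    · linarith [hM a h]
    · linarith [hP a h]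
  refine this.trans (le_of_eq ?_)
  rw [Finset.sum_add_distrib, ← Finset.mul_sum, ← cnt_eq_sum]
  simp [mul_comm]

/-- For injective `ι` every tuple on `I` extends in equally many ways to `J`, so a uniform `φ`
restricts to a uniform tuple. The cross-multiplied form avoids division and truncated subtraction.
-/
theorem cnt_comp_mul {I J W : Type*} [Fintype I] [Fintype J] [Fintype W] [DecidableEq I]
    [DecidableEq J] (ι : I → J) (hι : Injective ι) (Q : (I → W) → Prop) :
    cnt (fun φ : J → W => Q (φ ∘ ι)) * (Fintype.card W : ℝ) ^ Fintype.card I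
      = (Fintype.card W : ℝ) ^ Fintype.card J * cnt Q := by
  classical
  let e1 : (J → W) ≃ ({j // j ∈ Set.range ι} → W) × ({j // ¬ j ∈ Set.range ι} → W) :=
    Equiv.piEquivPiSubtypeProd (fun j => j ∈ Set.range ι) (fun _ => W)
  let e2 : (I → W) ≃ ({j // j ∈ Set.range ι} → W) :=
    Equiv.arrowCongr (Equiv.ofInjective ι hι) (Equiv.refl W)
  have h1 : cnt (fun φ : J → W => Q (φ ∘ ι)) =
      cnt (fun x : ({j // j ∈ Set.range ι} → W) × ({j // ¬ j ∈ Set.range ι} → W) =>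
        Q (e2.symm x.1) ∧ True) := by
    rw [← cnt_equiv e1]
    refine cnt_congr fun φ => ?_
    rw [and_true]
    have : e2.symm (e1 φ).1 = φ ∘ ι := by
      ext i; rfl
    rw [this]
  have h2 : (Fintype.card W : ℝ) ^ Fintype.card I *
      (Fintype.card W : ℝ) ^ Fintype.card {j // ¬ j ∈ Set.range ι} =
      (Fintype.card W : ℝ) ^ Fintype.card J := by
    rw [← pow_add]
    congr 1
    rw [Fintype.card_subtype_compl, Fintype.card_congr (Equiv.ofInjective ι hι)]
    have := Fintype.card_subtype_le (fun j => j ∈ Set.range ι)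
    have h3 : Fintype.card (Set.range ι) = Fintype.card {j // j ∈ Set.range ι} := by
      congr!
    omega
  rw [h1, cnt_and_prod (fun x => Q (e2.symm x)) (fun _ => True), cnt_true, cnt_equiv e2.symm, ← h2]
  simp only [Fintype.card_pi, Finset.prod_const, Finset.card_univ]
  push_cast
  ring

theorem cnt_apply_mul {I W : Type*} [Fintype I] [DecidableEq I] [Fintype W] (Z : W → Prop)
    (i : I) : cnt (fun φ : I → W => Z (φ i)) * Fintype.card W =
      (Fintype.card W : ℝ) ^ Fintype.card I * cnt Z := by
  have := cnt_comp_mul (W := W) (fun _ : Unit => i) (fun _ _ _ => rfl) (fun ψ => Z (ψ ()))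
  rw [Fintype.card_unit, pow_one] at this
  rw [show cnt (fun φ : I → W => Z (φ i)) =
    cnt (fun φ : I → W => (fun ψ : Unit → W => Z (ψ ())) (φ ∘ fun _ : Unit => i)) from rfl, this]
  rw [← cnt_equiv (Equiv.funUnique Unit W) Z]
  rfl

theorem cnt_hits_mul_le {I W : Type*} [Fintype I] [DecidableEq I] [Fintype W] (Z : W → Prop) :
    cnt (fun φ : I → W => ∃ i, Z (φ i)) * Fintype.card W
      ≤ Fintype.card I * cnt Z * (Fintype.card W : ℝ) ^ Fintype.card I := by
  have h := cnt_exists_le (fun (i : I) (φ : I → W) => Z (φ i))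
  refine (mul_le_mul_of_nonneg_right h (Nat.cast_nonneg _)).trans ?_
  rw [Finset.sum_mul, Finset.sum_congr rfl fun i _ => cnt_apply_mul Z i]
  simp
  linarith

theorem cnt_not_injective_mul_le {I W : Type*} [Fintype I] [DecidableEq I] [Fintype W] :
    cnt (fun φ : I → W => ¬ Injective φ) * Fintype.card W
      ≤ (Fintype.card I : ℝ) ^ 2 * (Fintype.card W : ℝ) ^ Fintype.card I := by
  classical
  have h0 : cnt (fun φ : I → W => ¬ Injective φ) ≤
      cnt (fun φ : I → W => ∃ q : I × I, q.1 ≠ q.2 ∧ φ q.1 = φ q.2) := by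
    refine cnt_mono fun φ h => ?_
    simp only [Injective, not_forall] at h
    obtain ⟨a, b, h, h'⟩ := h
    exact ⟨(a, b), h', h⟩
  have h := cnt_exists_le (fun (q : I × I) (φ : I → W) => q.1 ≠ q.2 ∧ φ q.1 = φ q.2)
  have h2 : ∀ q : I × I, cnt (fun φ : I → W => q.1 ≠ q.2 ∧ φ q.1 = φ q.2) * Fintype.card W ≤
      (Fintype.card W : ℝ) ^ Fintype.card I := by
    rintro ⟨a, b⟩
    by_cases hab : a = b
    · simp [hab, cnt_false]
    simp only [ne_eq, hab, not_false_eq_true, true_and]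
    have hinj : Injective (fun i : Bool => if i then a else b) := by
      intro x y; cases x <;> cases y <;> simp [hab, Ne.symm hab]
    have := cnt_comp_mul (W := W) (fun i : Bool => if i then a else b) hinj
      (fun ψ => ψ true = ψ false)
    rw [Fintype.card_bool] at this
    have h3 : cnt (fun ψ : Bool → W => ψ true = ψ false) ≤ Fintype.card W := by
      rw [← cnt_true]
      refine cnt_le_of_injOn (fun ψ => ψ true) (fun _ _ => trivial) fun x y hx hy hxy => ?_
      ext i
      cases i
      · rw [← hx, ← hy, hxy]
      · exact hxy
    simp only [comp_apply, if_true, Bool.false_eq_true, if_false] at this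
    rcases (Nat.cast_nonneg (Fintype.card W) : (0 : ℝ) ≤ Fintype.card W).eq_or_lt with h0 | h0
    · rw [← h0, mul_zero]; positivity
    · have : cnt (fun φ : I → W => φ a = φ b) * Fintype.card W * Fintype.card W ≤
        (Fintype.card W : ℝ) ^ Fintype.card I * Fintype.card W := by
        rw [mul_assoc, ← sq, this]
        gcongr
      exact le_of_mul_le_mul_right this h0
  refine (mul_le_mul_of_nonneg_right (h0.trans h) (Nat.cast_nonneg _)).trans ?_
  rw [Finset.sum_mul]
  refine (Finset.sum_le_sum fun q _ => h2 q).trans ?_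
  simp [sq]

end Counting

/-! ### Density makes sparse tuples rare. -/

section LocalStatistic

variable {W : Type*} [Fintype W]

/-- The number of pairs in `P × Q` that are related by `R`. -/
noncomputable def pairCnt (R : W → W → Prop) (P Q : W → Prop) : ℝ :=
  cnt (fun x : W × W => (P x.1 ∧ Q x.2) ∧ R x.1 x.2)

/-- A family of relations `R y` which is dense on average: the sum over `y` of the shortfalls
`p |P y| |Q y| - e(P y, Q y)` never exceeds `D`. -/
def LinkDense {Y : Type*} [Fintype Y] (R : Y → W → W → Prop) (p D : ℝ) : Prop :=
  ∀ P Q : Y → W → Prop,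
    ∑ y, (p * cnt (P y) * cnt (Q y) - pairCnt (R y) (P y) (Q y)) ≤ D

theorem cnt_cons {r : ℕ} (P : (Fin (r + 1) → W) → Prop) :
    cnt P = ∑ a, cnt (fun b : Fin r → W => P (Fin.cons a b)) := by
  rw [← cnt_equiv (Fin.consEquiv (fun _ : Fin (r + 1) => W)), ← cnt_prod]
  rfl

open scoped Classical in
theorem pairCnt_eq_sum (R : W → W → Prop) (P Q : W → Prop) :
    pairCnt R P Q = ∑ a, if P a then cnt (fun b => Q b ∧ R a b) else 0 := by
  rw [pairCnt, cnt_prod (fun a b => (P a ∧ Q b) ∧ R a b)]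
  refine Finset.sum_congr rfl fun a _ => ?_
  by_cases h : P a <;> simp [h, cnt_false]

open scoped Classical in
theorem pairCnt_eq_sum_right (R : W → W → Prop) (P Q : W → Prop) :
    pairCnt R P Q = ∑ b, if Q b then cnt (fun a => P a ∧ R a b) else 0 := by
  rw [pairCnt, cnt_prod (fun a b => (P a ∧ Q b) ∧ R a b), sum_cnt_comm]
  refine Finset.sum_congr rfl fun a _ => ?_
  by_cases h : Q a <;> simp [h, cnt_false]

theorem pairCnt_nonneg (R : W → W → Prop) (P Q : W → Prop) : 0 ≤ pairCnt R P Q := cnt_nonneg _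

open scoped Classical in
-- The total shortfall of the poor `x` is linear in the weight `w`, with coefficient `c z` at `z`.
-- Over weights in [0,1] it is largest at the indicator of the positive coefficients, where the
-- unweighted hypothesis applies to the poor set and that indicator.
theorem cnt_poor_mul_le (R : W → W → Prop) {p D η : ℝ}
    (hD : ∀ P Q : W → Prop, p * cnt P * cnt Q - pairCnt R P Q ≤ D) (w : W → ℝ)
    (hw0 : ∀ z, 0 ≤ w z) (hw1 : ∀ z, w z ≤ 1) :
    cnt (fun x => ∑ z, (if R x z then w z else 0) < p * ∑ z, w z - η * Fintype.card W)
      * (η * Fintype.card W) ≤ D := by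
  set X : W → Prop :=
    fun x => ∑ z, (if R x z then w z else 0) < p * ∑ z, w z - η * Fintype.card W with hX
  set c : W → ℝ := fun z => ∑ x, if X x then p - (if R x z then 1 else 0) else 0 with hc
  have h1 : cnt X * (η * Fintype.card W) ≤ ∑ z, c z * w z := by
    have : ∑ z, c z * w z =
        ∑ x, if X x then p * ∑ z, w z - ∑ z, (if R x z then w z else 0) else 0 := by
      simp only [hc, Finset.sum_mul]
      rw [Finset.sum_comm]
      refine Finset.sum_congr rfl fun x _ => ?_
      by_cases h : X x
      · simp only [h, if_true]
        rw [Finset.mul_sum, ← Finset.sum_sub_distrib]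
        refine Finset.sum_congr rfl fun z _ => ?_
        by_cases h' : R x z <;> simp [h'] ; ring
      · simp [h]
    rw [this, cnt_eq_sum, Finset.sum_mul]
    refine Finset.sum_le_sum fun x _ => ?_
    split_ifs with h
    · have := h
      simp only [hX] at this
      linarith
    · simp
  have h2 : ∑ z, c z * w z ≤ ∑ z, if 0 < c z then c z else 0 := by
    refine Finset.sum_le_sum fun z _ => ?_
    split_ifs with h
    · nlinarith [hw1 z]
    · nlinarith [hw0 z]
  have h3 : (∑ z, if 0 < c z then c z else 0) =
      p * cnt X * cnt (fun z => 0 < c z) - pairCnt R X (fun z => 0 < c z) := by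
    rw [pairCnt_eq_sum_right, cnt_eq_sum (fun z => 0 < c z), Finset.mul_sum,
      ← Finset.sum_sub_distrib]
    refine Finset.sum_congr rfl fun z _ => ?_
    split_ifs with h
    · rw [cnt_eq_sum, cnt_eq_sum, Finset.mul_sum, mul_one, ← Finset.sum_sub_distrib]
      refine Finset.sum_congr rfl fun x _ => ?_
      by_cases h1 : X x <;> by_cases h2 : R x z <;> simp [h1, h2]
    · simp
  linarith [hD X (fun z => 0 < c z)]

open scoped Classical in
-- Weights are halved at the partners of each successive coordinate. A coordinate that is not poor
-- for the current weights shrinks the total by the factor 1 - p/2 up to an error of order ηn;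
-- tuples whose current coordinate is poor are few and are discarded outright.
theorem cnt_heavy_tuples_mul_le (R : W → W → Prop) {p D η : ℝ} (hp : p ≤ 1) (hp0 : 0 ≤ p)
    (hη : 0 ≤ η)
    (hD : ∀ P Q : W → Prop, p * cnt P * cnt Q - pairCnt R P Q ≤ D) (r : ℕ) :
    ∀ w : W → ℝ, (∀ z, 0 ≤ w z) → (∀ z, w z ≤ 1) →
    cnt (fun x : Fin r → W => (1 - p / 2) ^ r * ∑ z, w z + η * Fintype.card W * r <
        ∑ z, w z * ∏ i, if R (x i) z then (1 / 2 : ℝ) else 1) * (η * (Fintype.card W : ℝ) ^ 2)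
      ≤ r * D * (Fintype.card W : ℝ) ^ r := by
  have hD0 : 0 ≤ D := by
    have := hD (fun _ => False) (fun _ => False)
    simp only [cnt_false, pairCnt, false_and] at this
    linarith
  set n : ℝ := (Fintype.card W : ℝ) with hn
  have hn0 : 0 ≤ n := Nat.cast_nonneg _
  induction r with
  | zero =>
    intro w hw0 hw1
    simp [cnt_false]
  | succ r ih =>
    intro w hw0 hw1
    have hX := cnt_poor_mul_le (η := η) R hD w hw0 hw1
    set X : W → Prop :=
      fun x => ∑ z, (if R x z then w z else 0) < p * ∑ z, w z - η * Fintype.card W with hXd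
    rw [cnt_cons, Finset.sum_mul]
    have key : ∀ a : W, cnt (fun b : Fin r → W => (1 - p / 2) ^ (r + 1) * ∑ z, w z
      + η * n * ((r + 1 : ℕ) : ℝ) <
      ∑ z, w z * ∏ i : Fin (r + 1), if R ((Fin.cons a b : Fin (r + 1) → W) i) z
        then (1 / 2 : ℝ) else 1) * (η * n ^ 2) ≤
        (if X a then n ^ r * (η * n ^ 2) else 0) + r * D * n ^ r := by
      intro a
      by_cases ha : X a
      · rw [if_pos ha]
        have h1 : ∀ P : (Fin r → W) → Prop, cnt P ≤ n ^ r := by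
          intro P
          refine (cnt_le_card _).trans (le_of_eq ?_)
          simp [hn]
        have : 0 ≤ r * D * n ^ r := by positivity
        linarith [mul_le_mul_of_nonneg_right (h1 (fun b : Fin r → W =>
          (1 - p / 2) ^ (r + 1) * ∑ z, w z + η * n * ((r + 1 : ℕ) : ℝ) <
          ∑ z, w z * ∏ i : Fin (r + 1), if R ((Fin.cons a b : Fin (r + 1) → W) i) z
          then (1 / 2 : ℝ) else 1)) (by positivity : 0 ≤ η * n ^ 2)]
      · rw [if_neg ha, zero_add]
        have hw' := ih (fun z => w z * if R a z then (1 / 2 : ℝ) else 1)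
          (fun z => by have := hw0 z; split_ifs <;> positivity)
          (fun z => by
            have := hw0 z; have := hw1 z
            split_ifs <;> linarith)
        refine le_trans (mul_le_mul_of_nonneg_right (cnt_mono fun b hb => ?_) (by positivity)) hw'
        have hsum : ∑ z, (w z * if R a z then (1 / 2 : ℝ) else 1) =
            ∑ z, w z - 1 / 2 * ∑ z, (if R a z then w z else 0) := by
          rw [Finset.mul_sum, ← Finset.sum_sub_distrib]
          refine Finset.sum_congr rfl fun z _ => ?_
          split_ifs <;> ring
        have h4 : ∑ z, (w z * if R a z then (1 / 2 : ℝ) else 1) ≤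
            (1 - p / 2) * ∑ z, w z + η * n / 2 := by
          simp only [hXd, not_lt] at ha
          rw [hsum]
          linarith
        have h5 : (1 - p / 2) ^ r * ∑ z, (w z * if R a z then (1 / 2 : ℝ) else 1) ≤
            (1 - p / 2) ^ (r + 1) * ∑ z, w z + η * n / 2 := by
          have h6 : (0 : ℝ) ≤ (1 - p / 2) ^ r := pow_nonneg (by linarith) _
          have h7 : (1 - p / 2) ^ r ≤ 1 := pow_le_one₀ (by linarith) (by linarith)
          have h8 : 0 ≤ η * n / 2 := by positivity
          calc _ ≤ (1 - p / 2) ^ r * ((1 - p / 2) * ∑ z, w z + η * n / 2) :=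
                mul_le_mul_of_nonneg_left h4 h6
            _ = (1 - p / 2) ^ (r + 1) * ∑ z, w z + (1 - p / 2) ^ r * (η * n / 2) := by ring
            _ ≤ _ := by nlinarith
        have h9 : 0 ≤ η * n := by positivity
        simp only [Fin.prod_univ_succ, Fin.cons_zero, Fin.cons_succ, ← mul_assoc] at hb
        push_cast at hb
        refine lt_of_le_of_lt ?_ hb
        linarith
    refine (Finset.sum_le_sum fun a _ => key a).trans ?_
    rw [Finset.sum_add_distrib]
    have h10 : (∑ a, if X a then n ^ r * (η * n ^ 2) else 0) = cnt X * (η * n) * (n ^ r * n) := by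
      rw [cnt_eq_sum, Finset.sum_mul, Finset.sum_mul]
      refine Finset.sum_congr rfl fun a _ => ?_
      split_ifs <;> ring
    rw [h10]
    simp only [Finset.sum_const, Finset.card_univ, nsmul_eq_mul, ← hn]
    have := mul_le_mul_of_nonneg_right hX (by positivity : 0 ≤ n ^ r * n)
    push_cast
    rw [pow_succ]
    linarith

end LocalStatistic

section LocalStatistic

variable {W : Type*} [Fintype W]

/-- The tuples `x`, `z` such that every coordinate of `z` is related to fewer than `a` of the
coordinates of `x`. -/
def Sparse (R : W → W → Prop) (a : ℕ) {I J : Type*} [Fintype I] (x : I → W) (z : J → W) : Prop :=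
  ∀ b, cnt (fun i => R (x i) (z b)) < a

theorem cnt_forall_prod {J : Type*} [Fintype J] [DecidableEq J] (Q : J → W → Prop) :
    cnt (fun z : J → W => ∀ b, Q b (z b)) = ∏ b, cnt (Q b) := by
  classical
  rw [cnt_eq_card]
  simp only [cnt_eq_card]
  trans ((Fintype.piFinset fun b : J => Finset.univ.filter (Q b)).card : ℝ)
  · congr 2
    ext z
    simp
  · rw [Fintype.card_piFinset]
    simp

theorem cnt_forall {J : Type*} [Fintype J] [DecidableEq J] (Q : W → Prop) :
    cnt (fun z : J → W => ∀ b, Q (z b)) = cnt Q ^ Fintype.card J := by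
  rw [cnt_forall_prod fun _ => Q]
  simp

open scoped Classical in
theorem prod_half_eq {I : Type*} [Fintype I] (P : I → Prop) :
    (∏ i, if P i then (1 / 2 : ℝ) else 1) = (1 / 2) ^ (Finset.univ.filter P).card := by
  rw [Finset.prod_ite]
  simp

/-- If `x` is not heavy, the sum over z of 2^(-number of partners of z in `x`) is at most
δ·2^(-a)·n. Each z with fewer than `a` partners contributes at least 2^(-a), so at most δn vertices
are such z, and all `s` entries of a tuple are such with proportion at most δ^s. -/
theorem cnt_sparse_mul_le (R : W → W → Prop) {p D η δ : ℝ} (hp : p ≤ 1) (hp0 : 0 ≤ p)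
    (hη : 0 ≤ η) {r s a : ℕ} (hδ : (1 - p / 2) ^ r + η * r ≤ δ * (1 / 2) ^ a)
    (hD : ∀ P Q : W → Prop, p * cnt P * cnt Q - pairCnt R P Q ≤ D) :
    cnt (fun q : (Fin r → W) × (Fin s → W) => Sparse R a q.1 q.2)
        * (η * (Fintype.card W : ℝ) ^ 2)
      ≤ r * D * (Fintype.card W : ℝ) ^ (r + s)
        + η * (Fintype.card W : ℝ) ^ 2 * (Fintype.card W : ℝ) ^ (r + s) * δ ^ s := by
  classical
  have hheavy := cnt_heavy_tuples_mul_le R hp hp0 hη hD r (fun _ => 1) (fun _ => zero_le_one)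
    (fun _ => le_rfl)
  set n : ℝ := (Fintype.card W : ℝ) with hn
  have hn0 : 0 ≤ n := Nat.cast_nonneg _
  simp only [one_mul, Finset.sum_const, Finset.card_univ, nsmul_eq_mul, mul_one, ← hn] at hheavy
  set X : (Fin r → W) → Prop := fun x => (1 - p / 2) ^ r * n + η * n * r <
        ∑ z, ∏ i, if R (x i) z then (1 / 2 : ℝ) else 1 with hX
  have h1 : ∀ x, ¬ X x → cnt (fun z => cnt (fun i => R (x i) z) < a) ≤ δ * n := by
    intro x hx
    simp only [hX, not_lt] at hx
    have h2 := mul_cnt_le_sum (f := fun z => ∏ i, if R (x i) z then (1 / 2 : ℝ) else 1)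
      (t := (1 / 2) ^ a) (P := fun z => cnt (fun i => R (x i) z) < a)
      (fun z => Finset.prod_nonneg fun i _ => by split_ifs <;> norm_num) (by
        intro z hz
        rw [prod_half_eq]
        refine pow_le_pow_of_le_one (by norm_num) (by norm_num) ?_
        rw [cnt_eq_card] at hz
        exact_mod_cast hz.le)
    have h3 : (0 : ℝ) < (1 / 2) ^ a := by positivity
    refine le_of_mul_le_mul_left ?_ h3
    have := mul_le_mul_of_nonneg_right hδ hn0
    linarith
  have h2 : ∀ x, cnt (fun z : Fin s → W => Sparse R a x z) ≤
      (if X x then n ^ s else 0) + n ^ s * δ ^ s := by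
    intro x
    have h3 : cnt (fun z : Fin s → W => Sparse R a x z) =
        cnt (fun z => cnt (fun i => R (x i) z) < a) ^ s := by
      have := cnt_forall (J := Fin s) (fun z => cnt (fun i => R (x i) z) < a)
      rw [Fintype.card_fin] at this
      exact this
    have h4 : cnt (fun z => cnt (fun i => R (x i) z) < a) ≤ n := cnt_le_card _
    rw [h3]
    have hδ0 : 0 ≤ δ := by
      have h5 : 0 ≤ (1 - p / 2) ^ r + η * r :=
        add_nonneg (pow_nonneg (by linarith) _) (by positivity)
      have h6 : (0 : ℝ) < (1 / 2) ^ a := by positivity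
      by_contra hneg
      nlinarith
    split_ifs with hx
    · have := pow_le_pow_left₀ (cnt_nonneg _) h4 s
      have : 0 ≤ n ^ s * δ ^ s := by positivity
      linarith
    · rw [zero_add, ← mul_pow, mul_comm n]
      exact pow_le_pow_left₀ (cnt_nonneg _) (h1 x hx) s
  rw [cnt_prod (fun x z => Sparse R a x z)]
  have h3 := Finset.sum_le_sum fun x (_ : x ∈ Finset.univ) => h2 x
  rw [Finset.sum_add_distrib] at h3
  have h4 : (∑ x, if X x then n ^ s else 0) = cnt X * n ^ s := by
    rw [cnt_eq_sum, Finset.sum_mul]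
    refine Finset.sum_congr rfl fun x _ => ?_
    split_ifs <;> simp
  rw [h4] at h3
  simp only [Finset.sum_const, Finset.card_univ, nsmul_eq_mul, Fintype.card_pi,
    Finset.prod_const, Fintype.card_fin] at h3
  push_cast at h3
  rw [← hn] at h3
  have h5 := mul_le_mul_of_nonneg_right h3 (by positivity : 0 ≤ η * n ^ 2)
  have h6 := mul_le_mul_of_nonneg_right hheavy (by positivity : 0 ≤ n ^ s)
  rw [pow_add]
  linarith

theorem LinkDense.cnt_sparse_mul_le {Y : Type*} [Fintype Y] {R : Y → W → W → Prop} {p D η δ : ℝ}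
    (hR : LinkDense R p D) (hp : p ≤ 1) (hp0 : 0 ≤ p)
    (hη : 0 ≤ η) {r s a : ℕ} (hδ : (1 - p / 2) ^ r + η * r ≤ δ * (1 / 2) ^ a) :
    cnt (fun q : Y × (Fin r → W) × (Fin s → W) => Sparse (R q.1) a q.2.1 q.2.2)
        * (η * (Fintype.card W : ℝ) ^ 2)
      ≤ r * D * (Fintype.card W : ℝ) ^ (r + s) + η * (Fintype.card W : ℝ) ^ 2 *
        (Fintype.card Y * (Fintype.card W : ℝ) ^ (r + s)) * δ ^ s := by
  classical
  -- For each `y` a worst pair of sets is fixed. Its shortfall serves as `D` in the single-relation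
  -- bound, and the sum of these maxima is what `LinkDense` controls.
  have hmax : ∀ y, ∃ PQ : (W → Prop) × (W → Prop), ∀ PQ' : (W → Prop) × (W → Prop),
      p * cnt PQ'.1 * cnt PQ'.2 - pairCnt (R y) PQ'.1 PQ'.2 ≤
        p * cnt PQ.1 * cnt PQ.2 - pairCnt (R y) PQ.1 PQ.2 :=
    fun y => Finite.exists_max _
  choose PQ hPQ using hmax
  have h1 := hR (fun y => (PQ y).1) (fun y => (PQ y).2)
  rw [cnt_prod (fun y (q : (Fin r → W) × (Fin s → W)) => Sparse (R y) a q.1 q.2), Finset.sum_mul]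
  refine (Finset.sum_le_sum fun y _ => _root_.cnt_sparse_mul_le (R y) hp hp0 hη hδ
    (fun P Q => hPQ y (P, Q))).trans ?_
  rw [Finset.sum_add_distrib, ← Finset.sum_mul, ← Finset.mul_sum]
  simp only [Finset.sum_const, Finset.card_univ, nsmul_eq_mul]
  have h2 := mul_le_mul_of_nonneg_left h1
    (by positivity : 0 ≤ (r : ℝ) * (Fintype.card W : ℝ) ^ (r + s))
  linarith

end LocalStatistic

/-! ### Few sparse tuples force density. -/

section LocalStatistic

variable {W : Type*} [Fintype W]

/-- For `x` uniform in P^(aL), an average element of Q has at most a/2 partners in `x`. By Markov,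
on average at least half of Q has fewer than `a`, and convexity of the s-th power passes from single
elements of Q to s-tuples. -/
theorem le_cnt_sparse (R : W → W → Prop) {L a s : ℕ} (hL : 0 < L) (ha : 0 < a) (P Q : W → Prop)
    (hPQ : pairCnt R P Q ≤ 1 / (2 * L) * cnt P * cnt Q) :
    cnt P ^ (a * L) * (cnt Q / 2) ^ s ≤
      cnt (fun q : (Fin (a * L) → W) × (Fin s → W) => Sparse R a q.1 q.2) := by
  classical
  have hL' : (0 : ℝ) < L := by exact_mod_cast hL
  have ha' : (0 : ℝ) < a := by exact_mod_cast ha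
  set S : Finset W := Finset.univ.filter P with hS
  set T : Finset (Fin (a * L) → W) := Fintype.piFinset fun _ => S with hT
  have hPS : cnt P = S.card := by rw [cnt_eq_card]
  have hTc : (T.card : ℝ) = cnt P ^ (a * L) := by
    rw [hT, Fintype.card_piFinset, hPS]
    simp
  set g : (Fin (a * L) → W) → ℝ := fun x => cnt (fun z => Q z ∧ cnt (fun i => R (x i) z) < a)
    with hg
  have h1 : ∑ x ∈ T, g x ^ s ≤
      cnt (fun q : (Fin (a * L) → W) × (Fin s → W) => Sparse R a q.1 q.2) := by
    rw [cnt_prod (fun x z => Sparse R a x z)]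
    refine (Finset.sum_le_sum fun x _ => ?_).trans (Finset.sum_le_sum_of_subset_of_nonneg
      (Finset.subset_univ T) fun x _ _ => cnt_nonneg _)
    have := cnt_forall (J := Fin s) (fun z => cnt (fun i => R (x i) z) < a)
    rw [Fintype.card_fin] at this
    have h2 : cnt (fun z : Fin s → W => Sparse R a x z) = _ := this
    rw [h2]
    exact pow_le_pow_left₀ (cnt_nonneg _) (cnt_mono fun z hz => hz.2) s
  have hsum : ∑ x ∈ T, ∑ z, (if Q z then cnt (fun i => R (x i) z) else 0) =
      (a * L : ℕ) * (S.card ^ (a * L - 1) * pairCnt R P Q) := by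
    have : ∀ x ∈ T, ∑ z, (if Q z then cnt (fun i => R (x i) z) else 0) =
        ∑ i, cnt (fun z => Q z ∧ R (x i) z) := by
      intro x _
      rw [sum_cnt_comm]
      refine Finset.sum_congr rfl fun z _ => ?_
      by_cases h : Q z <;> simp [h, cnt_false]
    rw [Finset.sum_congr rfl this, Finset.sum_comm]
    have h3 : ∀ i : Fin (a * L), ∑ x ∈ T, cnt (fun z => Q z ∧ R (x i) z) =
        S.card ^ (a * L - 1) * pairCnt R P Q := by
      intro i
      have := Fintype.sum_piFinset_apply (ι := Fin (a * L))
        (fun u => cnt (fun z => Q z ∧ R u z)) S i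
      rw [hT, this, pairCnt_eq_sum, hS, Finset.sum_filter, Fintype.card_fin, nsmul_eq_mul]
      push_cast
      congr!
    rw [Finset.sum_congr rfl fun i _ => h3 i]
    simp
  have hg2 : ∀ x, a * (cnt Q - g x) ≤ ∑ z, (if Q z then cnt (fun i => R (x i) z) else 0) := by
    intro x
    have h3 := mul_cnt_le_sum (f := fun z => if Q z then cnt (fun i => R (x i) z) else 0)
      (t := (a : ℝ)) (P := fun z => Q z ∧ ¬ cnt (fun i => R (x i) z) < a)
      (fun z => by split_ifs <;> first | exact cnt_nonneg _ | exact le_rfl)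
      (fun z hz => by rw [if_pos hz.1]; exact not_lt.1 hz.2)
    have h4 : cnt Q ≤ g x + cnt (fun z => Q z ∧ ¬ cnt (fun i => R (x i) z) < a) := by
      refine le_trans (cnt_mono fun z hz => ?_) (cnt_or_le _ _)
      by_cases h : cnt (fun i => R (x i) z) < a
      · exact Or.inl ⟨hz, h⟩
      · exact Or.inr ⟨hz, h⟩
    refine le_trans ?_ h3
    exact mul_le_mul_of_nonneg_left (by linarith) ha'.le
  have hg3 : cnt P ^ (a * L) * (cnt Q / 2) ≤ ∑ x ∈ T, g x := by
    have h4 := Finset.sum_le_sum fun x (_ : x ∈ T) => hg2 x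
    rw [hsum, ← Finset.mul_sum, Finset.sum_sub_distrib, Finset.sum_const, nsmul_eq_mul, hTc] at h4
    have h5 : ((a * L : ℕ) : ℝ) * (S.card ^ (a * L - 1) * pairCnt R P Q) ≤
        a * (cnt P ^ (a * L) * (cnt Q / 2)) := by
      calc _ ≤ ((a * L : ℕ) : ℝ) * (S.card ^ (a * L - 1) * (1 / (2 * L) * cnt P * cnt Q)) := by
            gcongr
        _ = ((a * L : ℕ) : ℝ) * (cnt P ^ (a * L - 1) * (1 / (2 * L) * cnt P * cnt Q)) := by
            rw [hPS]
        _ = a * ((cnt P ^ (a * L - 1) * cnt P) * (cnt Q / 2)) := by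
            push_cast; field_simp
        _ = _ := by
            rw [← pow_succ, Nat.sub_add_cancel (Nat.mul_pos ha hL)]
    have h6 := h4.trans h5
    have h7 := le_of_mul_le_mul_left h6 ha'
    linarith
  have hg0 : ∀ x ∈ T, 0 ≤ g x := fun x _ => cnt_nonneg _
  rcases Nat.eq_zero_or_pos s with rfl | hs
  · refine le_trans ?_ h1
    simp [hTc]
  obtain ⟨s, rfl⟩ : ∃ s', s = s' + 1 := ⟨s - 1, by omega⟩
  rcases (cnt_nonneg P).eq_or_lt with h0 | h0
  · rw [← h0, zero_pow (Nat.mul_pos ha hL).ne', zero_mul]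
    exact cnt_nonneg _
  refine le_trans ?_ h1
  have hA : 0 < cnt P ^ (a * L) := by positivity
  -- The power mean inequality is available for exponents `s + 1`, hence the separate treatment of
  -- exponent zero above.
  have h8 := pow_sum_div_card_le_sum_pow hg0 s
  refine le_trans ?_ h8
  rw [hTc, le_div_iff₀ (by positivity)]
  calc _ = (cnt P ^ (a * L) * (cnt Q / 2)) ^ (s + 1) := by ring
    _ ≤ _ := pow_le_pow_left₀ (mul_nonneg hA.le (by linarith [cnt_nonneg Q])) hg3 _

/-- If the total shortfall is too large, more than a ν/2 proportion of the `y` have shortfall above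
(ν/2)m². Since a shortfall is at most |P|m and at most |Q|m, both sets have size at least (ν/2)m
there. The factors of the bound in `hbad` come from `y`, from the entries of x in P and from the
entries of z in half of Q. -/
theorem linkDense_of_cnt_sparse_le {Y : Type*} [Fintype Y] (R : Y → W → W → Prop) {L a s : ℕ}
    {ν : ℝ} (hL : 0 < L) (ha : 0 < a) (hν : 0 < ν)
    (hbad : cnt (fun q : Y × (Fin (a * L) → W) × (Fin s → W) => Sparse (R q.1) a q.2.1 q.2.2) ≤
      (ν / 2) ^ (1 + a * L + s) * (1 / 2) ^ s *
        (Fintype.card Y * (Fintype.card W : ℝ) ^ (a * L + s))) :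
    LinkDense R (1 / (2 * L)) (ν * (Fintype.card W : ℝ) ^ 2 * Fintype.card Y) := by
  classical
  intro P Q
  by_contra! hcon
  have hL' : (1 : ℝ) ≤ L := by exact_mod_cast hL
  set m : ℝ := (Fintype.card W : ℝ) with hm
  have hm0 : 0 ≤ m := Nat.cast_nonneg _
  set p : ℝ := 1 / (2 * L) with hp
  have hp1 : p ≤ 1 := by
    rw [hp, div_le_one (by linarith)]
    linarith
  have hp0 : 0 < p := by rw [hp]; positivity
  set d : Y → ℝ := fun y => p * cnt (P y) * cnt (Q y) - pairCnt (R y) (P y) (Q y) with hd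
  have hc : ∀ S : W → Prop, cnt S ≤ m := fun S => cnt_le_card _
  have hdle : ∀ y, d y ≤ p * cnt (P y) * cnt (Q y) := fun y => by
    have := pairCnt_nonneg (R y) (P y) (Q y)
    simp only [hd]; linarith
  have hPQm : ∀ y, p * cnt (P y) * cnt (Q y) ≤ cnt (P y) * m := fun y => by
    have h1 : p * cnt (P y) ≤ cnt (P y) := by nlinarith [cnt_nonneg (P y)]
    exact mul_le_mul h1 (hc _) (cnt_nonneg _) (cnt_nonneg _)
  have hPQm' : ∀ y, p * cnt (P y) * cnt (Q y) ≤ cnt (Q y) * m := fun y => by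
    have h1 : p * cnt (P y) ≤ m := by nlinarith [cnt_nonneg (P y), hc (P y)]
    rw [mul_comm (cnt (Q y))]
    exact mul_le_mul_of_nonneg_right h1 (cnt_nonneg _)
  have h1 := sum_le_cnt_add (f := d) (M := m ^ 2) (t := ν / 2 * m ^ 2)
    (P := fun y => ν / 2 * m ^ 2 < d y) (by positivity)
    (fun y _ => by
      have := mul_le_mul_of_nonneg_right (hc (P y)) hm0
      have := hdle y; have := hPQm y
      nlinarith) (fun y hy => not_lt.1 hy)
  set Y1 : Y → Prop := fun y => ν / 2 * m ^ 2 < d y with hY1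
  have hmpos : 0 < m := by
    rcases hm0.eq_or_lt with h | h
    · have hz : ν * m ^ 2 * Fintype.card Y = 0 := by rw [← h]; ring
      have hz' : m ^ 2 * cnt Y1 + ν / 2 * m ^ 2 * Fintype.card Y = 0 := by rw [← h]; ring
      linarith
    · exact h
  have h2 : ν / 2 * Fintype.card Y < cnt Y1 := by
    have : m ^ 2 * (ν / 2 * Fintype.card Y) < m ^ 2 * cnt Y1 := by
      linarith
    exact lt_of_mul_lt_mul_left this (by positivity)
  have h3 : ∀ y, Y1 y → (ν / 2 * m) ^ (a * L) * (ν / 2 * m / 2) ^ s ≤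
      cnt (fun q : (Fin (a * L) → W) × (Fin s → W) => Sparse (R y) a q.1 q.2) := by
    intro y hy
    have h4 : ν / 2 * m ≤ cnt (P y) := by
      refine le_of_mul_le_mul_right ?_ hmpos
      have := hdle y; have := hPQm y
      simp only [hY1] at hy
      nlinarith
    have h5 : ν / 2 * m ≤ cnt (Q y) := by
      refine le_of_mul_le_mul_right ?_ hmpos
      have := hdle y; have := hPQm' y
      simp only [hY1] at hy
      nlinarith
    refine le_trans ?_ (le_cnt_sparse (R y) hL ha (P y) (Q y) ?_)
    · have := cnt_nonneg (P y)
      gcongr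
    · have h6 : 0 ≤ ν / 2 * m ^ 2 := by positivity
      simp only [hY1, hd] at hy
      linarith
  have h4 := mul_cnt_le_sum (f := fun y => cnt (fun q : (Fin (a * L) → W) × (Fin s → W) =>
    Sparse (R y) a q.1 q.2)) (fun y => cnt_nonneg _) h3
  rw [← cnt_prod (fun y (q : (Fin (a * L) → W) × (Fin s → W)) => Sparse (R y) a q.1 q.2)] at h4
  have h5 := mul_lt_mul_of_pos_left h2
    (by positivity : 0 < (ν / 2 * m) ^ (a * L) * (ν / 2 * m / 2) ^ s)
  have h6 : (ν / 2 * m) ^ (a * L) * (ν / 2 * m / 2) ^ s * (ν / 2 * Fintype.card Y) =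
      (ν / 2) ^ (1 + a * L + s) * (1 / 2) ^ s * (Fintype.card Y * m ^ (a * L + s)) := by
    rw [div_pow (ν / 2 * m), mul_pow, mul_pow, pow_add, pow_add, pow_add, div_pow 1]
    ring
  linarith

end LocalStatistic

/-! ### Random samples inherit density. -/

section Sampling

variable {W : Type*} [Fintype W]

/-- Along an injective `ι` the sampled tuple is uniform, so `Q` holds with proportion at most `q`;
the non-injective index tuples are all given up. -/
theorem sum_cnt_comp_le {I J : Type*} [Fintype I] [Fintype J] [DecidableEq I] [DecidableEq J]
    [Nonempty W] (Q : (I → W) → Prop) {q : ℝ} (hq : 0 ≤ q)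
    (hQ : cnt Q ≤ q * (Fintype.card W : ℝ) ^ Fintype.card I) :
    ∑ φ : J → W, cnt (fun ι : I → J => Q (φ ∘ ι)) ≤
      (Fintype.card W : ℝ) ^ Fintype.card J *
        ((Fintype.card J : ℝ) ^ Fintype.card I * q + cnt (fun ι : I → J => ¬ Injective ι)) := by
  classical
  have hn : (0 : ℝ) < Fintype.card W := by exact_mod_cast Fintype.card_pos
  rw [sum_cnt_comm]
  have h : ∀ ι : I → J, cnt (fun φ : J → W => Q (φ ∘ ι)) ≤
      (Fintype.card W : ℝ) ^ Fintype.card J * (q + if ¬ Injective ι then 1 else 0) := by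
    intro ι
    by_cases hι : Injective ι
    · rw [if_neg (not_not.2 hι), add_zero]
      have := cnt_comp_mul (W := W) ι hι Q
      refine le_of_mul_le_mul_right (a := (Fintype.card W : ℝ) ^ Fintype.card I) ?_ (by positivity)
      rw [this, mul_assoc]
      gcongr
    · rw [if_pos hι]
      refine (cnt_le_card _).trans ?_
      rw [Fintype.card_fun]
      push_cast
      nlinarith [pow_pos hn (Fintype.card J)]
  refine (Finset.sum_le_sum fun ι _ => h ι).trans ?_
  rw [← Finset.mul_sum, Finset.sum_add_distrib, cnt_eq_sum]
  refine le_of_eq ?_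
  congr 2
  · simp
  · congr!

theorem le_sum_cnt_comp {I J : Type*} [Fintype I] [Fintype J] [DecidableEq I] [DecidableEq J]
    [Nonempty W] (Q : (I → W) → Prop) {q : ℝ} (G : (I → J) → Prop)
    (hG : ∀ ι, G ι → Injective ι)
    (hQ : q * (Fintype.card W : ℝ) ^ Fintype.card I ≤ cnt Q) :
    (Fintype.card W : ℝ) ^ Fintype.card J * cnt G * q ≤
      ∑ φ : J → W, cnt (fun ι : I → J => G ι ∧ Q (φ ∘ ι)) := by
  classical
  have hn : (0 : ℝ) < Fintype.card W := by exact_mod_cast Fintype.card_pos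
  rw [sum_cnt_comm, cnt_eq_sum G, Finset.mul_sum, Finset.sum_mul]
  refine Finset.sum_le_sum fun ι _ => ?_
  split_ifs with hι
  · simp only [hι, true_and]
    have := cnt_comp_mul (W := W) ι (hG ι hι) Q
    refine le_of_mul_le_mul_right (a := (Fintype.card W : ℝ) ^ Fintype.card I) ?_ (by positivity)
    rw [this, mul_one, mul_assoc]
    gcongr
  · simp only [mul_zero, zero_mul]
    exact cnt_nonneg _

/-- The density `p'` depends on `p` alone, while the failure probability `κ` and the error `ν` are
arbitrary. Sparse tuples are rare in the whole, hence rare on average in a sample, hence by Markov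
rare in most samples. -/
theorem exists_linkDense_sample (j : ℕ) {p : ℝ} (hp0 : 0 < p) (hp1 : p < 1) :
    ∃ p' : ℝ, 0 < p' ∧ p' < 1 ∧ ∀ κ ν : ℝ, 0 < κ → 0 < ν → ∃ (μ : ℝ) (M : ℕ), 0 < μ ∧
      ∀ m : ℕ, M ≤ m → ∀ (W : Type) [Fintype W] [Nonempty W] (R : (Fin j → W) → W → W → Prop),
        LinkDense R p (μ * (Fintype.card W : ℝ) ^ (j + 2)) →
        cnt (fun φ : Fin m → W =>
          ¬ LinkDense (fun (y : Fin j → Fin m) a b => R (φ ∘ y) (φ a) (φ b)) p'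
            (ν * (m : ℝ) ^ (j + 2))) ≤ κ * (Fintype.card W : ℝ) ^ m := by
  obtain ⟨L, hL⟩ := exists_pow_lt_of_lt_one (show (0 : ℝ) < 1 / 4 by norm_num)
    (show 1 - p / 2 < 1 by linarith)
  have hL0 : 0 < L := by
    rcases Nat.eq_zero_or_pos L with rfl | h
    · norm_num at hL
    · exact h
  have hL1 : (1 : ℝ) ≤ L := by exact_mod_cast hL0
  refine ⟨1 / (2 * L), by positivity, ?_, ?_⟩
  · rw [div_lt_one (by linarith)]; linarith
  intro κ ν hκ hν
  -- The aim is δ^r ≤ κε/4. Here ε equals (ν/2)(ν²/8)^r, so ε also decays like an r-th power, and it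
  -- is enough that δ, which is made small by a large `a`, is at most ζν²/8.
  set ζ : ℝ := min 1 (κ * ν / 8) with hζ
  have hζ0 : 0 < ζ := lt_min one_pos (by positivity)
  obtain ⟨a', ha'⟩ := exists_pow_lt_of_lt_one (show (0 : ℝ) < ζ * (ν ^ 2 / 8) / 2 by positivity)
    (show (1 / 2 : ℝ) < 1 by norm_num)
  set a := a' + 1 with ha
  have ha0 : 0 < a := Nat.succ_pos _
  set δ : ℝ := 2 * (1 / 2) ^ a with hδ
  have hδ1 : δ ≤ ζ * (ν ^ 2 / 8) := by
    rw [hδ, ha, pow_succ]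
    have : (0 : ℝ) < ζ * (ν ^ 2 / 8) := by positivity
    linarith
  set r := a * L with hr
  have hr0 : 0 < r := Nat.mul_pos ha0 hL0
  have hr1 : (0 : ℝ) < r := by exact_mod_cast hr0
  set η : ℝ := (1 / 4) ^ a / r with hη
  have hη0 : 0 < η := by positivity
  set ε : ℝ := (ν / 2) ^ (1 + r + r) * (1 / 2) ^ r with hε
  have hε0 : 0 < ε := by positivity
  have hδr : δ ^ r ≤ κ * ε / 4 := by
    have h1 : ζ ^ r ≤ κ * ν / 8 :=
      (pow_le_of_le_one hζ0.le (min_le_left _ _) hr0.ne').trans (min_le_right _ _)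
    calc δ ^ r ≤ (ζ * (ν ^ 2 / 8)) ^ r := pow_le_pow_left₀ (by positivity) hδ1 r
      _ = ζ ^ r * (ν ^ 2 / 8) ^ r := mul_pow _ _ _
      _ ≤ κ * ν / 8 * (ν ^ 2 / 8) ^ r := by gcongr
      _ = _ := by
        have : (ν ^ 2 / 8 : ℝ) ^ r = (ν / 2) ^ r * (ν / 2) ^ r * (1 / 2) ^ r := by
          rw [← mul_pow, ← mul_pow]; congr 1; ring
        rw [hε, this, pow_add, pow_add]
        ring
  have hδη : (1 - p / 2) ^ r + η * r ≤ δ * (1 / 2) ^ a := by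
    have h1 : (1 - p / 2) ^ r ≤ (1 / 4) ^ a := by
      rw [hr, mul_comm, pow_mul]
      exact pow_le_pow_left₀ (pow_nonneg (by linarith) _) hL.le a
    have h2 : η * r = (1 / 4) ^ a := by rw [hη]; field_simp
    have h3 : δ * (1 / 2) ^ a = 2 * (1 / 4) ^ a := by
      rw [hδ, mul_assoc, ← mul_pow]; norm_num
    rw [h2, h3]
    linarith
  set t := j + (r + r) with ht
  obtain ⟨M, hM⟩ := exists_nat_gt (2 * (t : ℝ) ^ 2 / (κ * ε))
  -- This `μ` turns the density error r·D/(ηn²) into a κε/4 proportion of tuples. The choice of `M`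
  -- keeps the non-injective index tuples below a κε/2 proportion.
  refine ⟨κ * ε * η / (4 * r), M + 1, by positivity, ?_⟩
  intro m hm W _ _ R hR
  classical
  set n : ℝ := (Fintype.card W : ℝ) with hn
  have hn0 : 0 < n := by rw [hn]; exact_mod_cast Fintype.card_pos
  have hm0 : (0 : ℝ) < m := by
    have : 0 < m := by omega
    exact_mod_cast this
  have hmM : (M : ℝ) ≤ m := by exact_mod_cast (by omega : M ≤ m)
  set Q : (Fin j ⊕ (Fin r ⊕ Fin r) → W) → Prop := fun ψ =>
    Sparse (R (ψ ∘ Sum.inl)) a (ψ ∘ Sum.inr ∘ Sum.inl) (ψ ∘ Sum.inr ∘ Sum.inr) with hQ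
  have hcard : Fintype.card (Fin j ⊕ (Fin r ⊕ Fin r)) = t := by simp [ht]
  have hsplit : ∀ (X : Type) [Fintype X]
      (S : (Fin j → X) → (Fin r → X) → (Fin r → X) → Prop),
      cnt (fun q : (Fin j → X) × (Fin r → X) × (Fin r → X) => S q.1 q.2.1 q.2.2) =
      cnt (fun ψ : Fin j ⊕ (Fin r ⊕ Fin r) → X =>
        S (ψ ∘ Sum.inl) (ψ ∘ Sum.inr ∘ Sum.inl) (ψ ∘ Sum.inr ∘ Sum.inr)) := by
    intro X _ S
    exact (cnt_equiv ((Equiv.sumArrowEquivProdArrow (Fin j) (Fin r ⊕ Fin r) X).trans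
      (Equiv.prodCongr (Equiv.refl _) (Equiv.sumArrowEquivProdArrow (Fin r) (Fin r) X))) _).symm
  have hbad : cnt Q ≤ κ * ε / 2 * n ^ Fintype.card (Fin j ⊕ (Fin r ⊕ Fin r)) := by
    have h1 := hR.cnt_sparse_mul_le (s := r) hp1.le hp0.le hη0.le hδη
    rw [hsplit W (fun y x z => Sparse (R y) a x z)] at h1
    rw [hcard]
    refine le_of_mul_le_mul_right (a := η * n ^ 2) (h1.trans ?_) (by positivity)
    have hY : ((Fintype.card (Fin j → W) : ℕ) : ℝ) = n ^ j := by simp [hn]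
    rw [hY]
    calc _ = κ * ε / 4 * (n ^ t * (η * n ^ 2)) + (n ^ t * (η * n ^ 2)) * δ ^ r := by
          rw [ht, pow_add n j, pow_add n j, ← hn]
          field_simp
      _ ≤ κ * ε / 4 * (n ^ t * (η * n ^ 2)) + (n ^ t * (η * n ^ 2)) * (κ * ε / 4) := by
          gcongr
      _ = _ := by ring
  have h2 := sum_cnt_comp_le (J := Fin m) Q (by positivity) hbad
  have h3 := mul_cnt_le_sum (f := fun φ : Fin m → W => cnt (fun ι => Q (φ ∘ ι)))
    (t := ε * (m : ℝ) ^ t) (P := fun φ : Fin m → W =>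
          ¬ LinkDense (fun (y : Fin j → Fin m) a b => R (φ ∘ y) (φ a) (φ b)) (1 / (2 * L))
            (ν * (m : ℝ) ^ (j + 2))) (fun φ => cnt_nonneg _) (by
      intro φ hφ
      by_contra! hcon
      apply hφ
      have h4 := linkDense_of_cnt_sparse_le (s := r)
        (fun (y : Fin j → Fin m) a b => R (φ ∘ y) (φ a) (φ b)) hL0 ha0 hν (by
          rw [hsplit (Fin m) (fun y x z => Sparse (fun a b => R (φ ∘ y) (φ a) (φ b)) a x z)]
          refine hcon.le.trans (le_of_eq ?_)
          simp only [Fintype.card_fun, Fintype.card_fin]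
          push_cast
          rw [ht, pow_add (m : ℝ) j])
      simp only [Fintype.card_fun, Fintype.card_fin] at h4
      push_cast at h4
      rwa [mul_assoc, ← pow_add, add_comm 2 j] at h4)
  have h5 := cnt_not_injective_mul_le (I := Fin j ⊕ (Fin r ⊕ Fin r)) (W := Fin m)
  rw [hcard, Fintype.card_fin] at h5
  rw [hcard, Fintype.card_fin] at h2
  have h6 : cnt (fun ι : Fin j ⊕ (Fin r ⊕ Fin r) → Fin m => ¬ Injective ι) ≤
      κ * ε / 2 * (m : ℝ) ^ t := by
    refine le_of_mul_le_mul_right (h5.trans ?_) hm0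
    have h7 : 2 * (t : ℝ) ^ 2 ≤ m * (κ * ε) := by
      have := (div_lt_iff₀ (by positivity)).1 hM
      have h8 : (M : ℝ) * (κ * ε) ≤ m * (κ * ε) := by gcongr
      linarith
    have := mul_le_mul_of_nonneg_right h7 (by positivity : 0 ≤ (m : ℝ) ^ t)
    linarith
  have hmt : 0 < ε * (m : ℝ) ^ t := by positivity
  refine le_of_mul_le_mul_left (h3.trans (h2.trans ?_)) hmt
  have h7 : (m : ℝ) ^ t * (κ * ε / 2) + cnt (fun ι : Fin j ⊕ (Fin r ⊕ Fin r) → Fin m =>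
      ¬ Injective ι) ≤ κ * ε * (m : ℝ) ^ t := by linarith
  calc _ ≤ n ^ m * (κ * ε * (m : ℝ) ^ t) := mul_le_mul_of_nonneg_left h7 (by positivity)
    _ = _ := by ring

end Sampling

theorem cnt_image {α β : Type*} [Fintype α] [Fintype β] {f : α → β} (hf : Injective f)
    (P : α → Prop) : cnt (fun b => ∃ a, P a ∧ f a = b) = cnt P := by
  rw [cnt_eq_ncard, cnt_eq_ncard]
  congr 1
  exact Set.ncard_image_of_injective {a | P a} hf

theorem cnt_eq_self {α : Type*} [Fintype α] (a : α) : cnt (fun x => x = a) = 1 := by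
  classical
  rw [cnt_eq_sum]; simp

theorem Fin.range_cons_eq {j : ℕ} {W : Type*} (a : W) (y : Fin j → W) :
    Set.range (Fin.cons a y : Fin (j + 1) → W) = insert a (Set.range y) := by
  ext x
  simp [eq_comm]

theorem Fin.range_snoc_eq {j : ℕ} {W : Type*} (y : Fin j → W) (b : W) :
    Set.range (Fin.snoc y b : Fin (j + 1) → W) = insert b (Set.range y) := by
  ext x
  simp only [Set.mem_range, Set.mem_insert_iff]
  constructor
  · rintro ⟨i, rfl⟩
    refine Fin.lastCases ?_ (fun i => ?_) i
    · simp
    · right; exact ⟨i, by simp⟩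
  · rintro (rfl | ⟨i, rfl⟩)
    · exact ⟨Fin.last j, by simp⟩
    · exact ⟨i.castSucc, by simp⟩

/-! ### Cherry-density as a family of link relations; pullbacks and degrees. -/

namespace KGraph

variable {k j : ℕ} {W X : Type*}

/-- The set `s` is (the underlying set of) an edge of `H`. -/
def IsEdge (H : KGraph k W) (s : Set W) : Prop := ∃ e ∈ H.edges, (e : Set W) = s

theorem IsEdge.ncard_eq {H : KGraph k W} {s : Set W} (h : H.IsEdge s) : s.ncard = k := by
  obtain ⟨e, he, rfl⟩ := h
  rw [Set.ncard_coe_finset, H.card_eq e he]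

/-- The relation "`a` and `b` complete the tuple `y` to an edge". -/
def rel (H : KGraph (j + 2) W) (y : Fin j → W) (a b : W) : Prop :=
  H.IsEdge (insert a (insert b (Set.range y)))

/-- The pullback of a `k`-graph along a map: the `k`-sets which are mapped to edges. -/
def pull (H : KGraph k W) (φ : X → W) : KGraph k X where
  edges := {e | e.card = k ∧ H.IsEdge (φ '' e)}
  card_eq _ he := he.1

/-- An image that is an edge has exactly `k` elements, so the bound on `s` forces `φ` to be
injective on `s` and `s` itself to have `k` elements. -/
theorem isEdge_pull {H : KGraph k W} {φ : X → W} {s : Set X} (hs : s.Finite) (hk : s.ncard ≤ k) :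
    (H.pull φ).IsEdge s ↔ H.IsEdge (φ '' s) := by
  constructor
  · rintro ⟨e, he, rfl⟩
    exact he.2
  · intro h
    have h1 := h.ncard_eq
    have h2 := Set.ncard_image_le (f := φ) hs
    refine ⟨hs.toFinset, ⟨?_, ?_⟩, by simp⟩
    · rw [← Set.ncard_eq_toFinset_card s hs]
      omega
    · simpa using h

theorem ncard_insert_range_le (T : Fin j → W) (a : W) :
    (insert a (Set.range T)).ncard ≤ j + 1 := by
  refine (Set.ncard_insert_le _ _).trans (Nat.add_le_add_right ?_ 1)
  rw [← Set.image_univ]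
  refine (Set.ncard_image_le Set.finite_univ).trans ?_
  simp [Set.ncard_univ]

theorem isEdge_pull_insert {H : KGraph (j + 1) W} {φ : X → W} (T : Fin j → X) (a : X) :
    (H.pull φ).IsEdge (insert a (Set.range T)) ↔
      H.IsEdge (insert (φ a) (Set.range (φ ∘ T))) := by
  rw [isEdge_pull ((Set.finite_range T).insert a) (ncard_insert_range_le T a), Set.image_insert_eq,
    Set.range_comp]

theorem rel_iff_cons {H : KGraph (j + 2) W} (y : Fin j → W) (a b : W) :
    H.rel y a b ↔ H.IsEdge (insert b (Set.range (Fin.cons a y : Fin (j + 1) → W))) := by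
  rw [rel, Fin.range_cons_eq, Set.insert_comm]

theorem rel_pull {H : KGraph (j + 2) W} (φ : X → W) (y : Fin j → X) (a b : X) :
    (H.pull φ).rel y a b ↔ H.rel (φ ∘ y) (φ a) (φ b) := by
  rw [rel_iff_cons, rel_iff_cons, isEdge_pull_insert, Fin.range_cons_eq, Set.range_comp,
    Fin.range_cons_eq, Set.image_insert_eq, Set.range_comp]

/-- Splitting a tuple into its first entry, its last entry and its middle part. -/
def splitEquiv (j : ℕ) (W : Type*) : (Fin j → W) × (W × W) ≃ (Fin (j + 2) → W) where
  toFun q := Fin.cons q.2.1 (Fin.snoc q.1 q.2.2)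
  invFun x := (Fin.init (Fin.tail x), (x 0, Fin.tail x (Fin.last j)))
  left_inv q := by simp
  right_inv x := by simp

theorem mem_cherrySet_splitEquiv (P Q : Set (Fin (j + 1) → W)) (y : Fin j → W) (a b : W) :
    splitEquiv j W (y, (a, b)) ∈ cherrySet (j + 2) P Q ↔
      (Fin.cons a y : Fin (j + 1) → W) ∈ P ∧ (Fin.snoc y b : Fin (j + 1) → W) ∈ Q := by
  have h1 : (fun i : Fin (j + 1) => splitEquiv j W (y, (a, b)) ⟨(i : ℕ), by omega⟩) =
      (Fin.cons a y : Fin (j + 1) → W) := by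
    funext i
    refine Fin.cases ?_ (fun i => ?_) i
    · rfl
    · simp only [splitEquiv, Equiv.coe_fn_mk, Fin.cons_succ]
      have : (⟨((i.succ : Fin (j + 1)) : ℕ), by omega⟩ : Fin (j + 2)) = i.castSucc.succ := rfl
      rw [this, Fin.cons_succ, Fin.snoc_castSucc]
  have h2 : (fun i : Fin (j + 1) => splitEquiv j W (y, (a, b)) ⟨(i : ℕ) + 1, by omega⟩) =
      (Fin.snoc y b : Fin (j + 1) → W) := by
    funext i
    rfl
  change _ ∧ _ ↔ _
  rw [← h1, ← h2]
  rfl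

theorem range_splitEquiv (y : Fin j → W) (a b : W) :
    Set.range (splitEquiv j W (y, (a, b))) = insert a (insert b (Set.range y)) := by
  simp only [splitEquiv, Equiv.coe_fn_mk]
  rw [Fin.range_cons_eq, Fin.range_snoc_eq]

section Fintype

variable [Fintype W] [Fintype X]

theorem ncard_cherrySet (P Q : Set (Fin (j + 1) → W)) :
    ((cherrySet (j + 2) P Q).ncard : ℝ) = ∑ y : Fin j → W,
      cnt (fun a => (Fin.cons a y : Fin (j + 1) → W) ∈ P) *
        cnt (fun b => (Fin.snoc y b : Fin (j + 1) → W) ∈ Q) := by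
  have h := cnt_eq_ncard (fun x => x ∈ cherrySet (j + 2) P Q)
  rw [Set.ofPred_mem_eq] at h
  rw [← h, ← cnt_equiv (splitEquiv j W)]
  rw [cnt_prod (fun y (q : W × W) => splitEquiv j W (y, q) ∈ cherrySet (j + 2) P Q)]
  refine Finset.sum_congr rfl fun y _ => ?_
  rw [← cnt_and_prod]
  exact cnt_congr fun q => mem_cherrySet_splitEquiv P Q y q.1 q.2

theorem cherryEdgeCount_eq (H : KGraph (j + 2) W) (P Q : Set (Fin (j + 1) → W)) :
    (H.cherryEdgeCount P Q : ℝ) = ∑ y : Fin j → W, pairCnt (H.rel y)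
      (fun a => (Fin.cons a y : Fin (j + 1) → W) ∈ P)
      (fun b => (Fin.snoc y b : Fin (j + 1) → W) ∈ Q) := by
  have h := cnt_eq_ncard (fun x => x ∈ cherrySet (j + 2) P Q ∧ H.IsEdge (Set.range x))
  rw [cherryEdgeCount]
  refine h.symm.trans ?_
  rw [← cnt_equiv (splitEquiv j W)]
  rw [cnt_prod (fun y (q : W × W) => splitEquiv j W (y, q) ∈ cherrySet (j + 2) P Q ∧
    H.IsEdge (Set.range (splitEquiv j W (y, q))))]
  refine Finset.sum_congr rfl fun y _ => cnt_congr fun q => ?_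
  rw [mem_cherrySet_splitEquiv P Q y q.1 q.2, range_splitEquiv, rel]

/-- The middle k-2 entries `y` are shared by both (k-1)-tuples of a cherry. Hence P and Q amount to
independent choices, for every `y`, of a set of first entries and a set of last entries. -/
theorem cherryDense_iff {H : KGraph (j + 2) W} {p μ : ℝ} :
    H.CherryDense p μ ↔ LinkDense H.rel p (μ * (Fintype.card W : ℝ) ^ (j + 2)) := by
  have key : ∀ P Q : Set (Fin (j + 1) → W),
      p * ((cherrySet (j + 2) P Q).ncard : ℝ) - H.cherryEdgeCount P Q =
      ∑ y : Fin j → W, (p * cnt (fun a => (Fin.cons a y : Fin (j + 1) → W) ∈ P) *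
        cnt (fun b => (Fin.snoc y b : Fin (j + 1) → W) ∈ Q) - pairCnt (H.rel y)
      (fun a => (Fin.cons a y : Fin (j + 1) → W) ∈ P)
      (fun b => (Fin.snoc y b : Fin (j + 1) → W) ∈ Q)) := by
    intro P Q
    rw [ncard_cherrySet, cherryEdgeCount_eq, Finset.sum_sub_distrib, Finset.mul_sum]
    simp only [mul_assoc]
  constructor
  · intro h P Q
    have h1 := h {t : Fin (j + 1) → W | P (Fin.tail t) (t 0)}
      {t : Fin (j + 1) → W | Q (Fin.init t) (t (Fin.last j))}
    have h2 := key {t : Fin (j + 1) → W | P (Fin.tail t) (t 0)}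
      {t : Fin (j + 1) → W | Q (Fin.init t) (t (Fin.last j))}
    simp only [Set.mem_ofPred_eq, Fin.tail_cons, Fin.cons_zero, Fin.init_snoc, Fin.snoc_last] at h2
    rw [← h2]
    linarith
  · intro h P Q
    have h1 := h (fun y a => (Fin.cons a y : Fin (j + 1) → W) ∈ P)
      (fun y b => (Fin.snoc y b : Fin (j + 1) → W) ∈ Q)
    have h2 := key P Q
    rw [← h2] at h1
    exact sub_le_comm.1 h1

/-- Test sets on `X` are pushed forward along `φ`. Middle tuples outside the image receive empty
sets and contribute nothing, so the two sums of shortfalls agree. -/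
theorem CherryDense.pull {H : KGraph (j + 2) W} {p μ μ' : ℝ} (h : H.CherryDense p μ) {φ : X → W}
    (hφ : Injective φ)
    (hμ : μ * (Fintype.card W : ℝ) ^ (j + 2) ≤ μ' * (Fintype.card X : ℝ) ^ (j + 2)) :
    (H.pull φ).CherryDense p μ' := by
  classical
  rw [cherryDense_iff] at h ⊢
  intro P Q
  refine le_trans (le_of_eq ?_) ((h (fun y' w => ∃ a, (∃ y, P y a ∧ φ ∘ y = y') ∧ φ a = w)
    (fun y' w => ∃ a, (∃ y, Q y a ∧ φ ∘ y = y') ∧ φ a = w)).trans hμ)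
  refine Fintype.sum_of_injective (fun y => φ ∘ y) hφ.comp_left _ _ ?_ ?_
  · intro y' hy'
    have h1 : cnt (fun w => ∃ a, (∃ y, P y a ∧ φ ∘ y = y') ∧ φ a = w) = 0 := by
      rw [← cnt_false (α := W)]
      refine cnt_congr fun w => ⟨?_, False.elim⟩
      rintro ⟨a, ⟨y, -, hy⟩, -⟩
      exact hy' ⟨y, hy⟩
    have h2 : pairCnt (H.rel y') (fun w => ∃ a, (∃ y, P y a ∧ φ ∘ y = y') ∧ φ a = w)
        (fun w => ∃ a, (∃ y, Q y a ∧ φ ∘ y = y') ∧ φ a = w) = 0 := by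
      rw [← cnt_false (α := W × W)]
      refine cnt_congr fun w => ⟨?_, False.elim⟩
      rintro ⟨⟨⟨a, ⟨y, -, hy⟩, -⟩, -⟩, -⟩
      exact hy' ⟨y, hy⟩
    rw [h1, h2]
    simp
  · intro y
    have h0 : ∀ (P : (Fin j → X) → X → Prop) (a : X),
        (∃ y', P y' a ∧ φ ∘ y' = φ ∘ y) ↔ P y a := fun P a =>
      ⟨fun ⟨y', h, e⟩ => hφ.comp_left e ▸ h, fun h => ⟨y, h, rfl⟩⟩
    simp only [h0]
    rw [cnt_image hφ, cnt_image hφ]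
    congr 1
    rw [pairCnt, pairCnt, ← cnt_image (hφ.prodMap hφ)]
    refine cnt_congr fun w => ?_
    constructor
    · rintro ⟨⟨a, b⟩, ⟨⟨ha, hb⟩, hr⟩, rfl⟩
      exact ⟨⟨⟨a, ha, rfl⟩, ⟨b, hb, rfl⟩⟩, (rel_pull φ y a b).1 hr⟩
    · rintro ⟨⟨⟨a, ha, h1⟩, ⟨b, hb, h2⟩⟩, hr⟩
      refine ⟨(a, b), ⟨⟨ha, hb⟩, (rel_pull φ y a b).2 ?_⟩, Prod.ext h1 h2⟩
      rw [h1, h2]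
      exact hr

/-- Density is tested on the poor tuples themselves, with last entries in `S`. -/
theorem cnt_poor_tuples_mul_le {H : KGraph (j + 2) W} {p D : ℝ} (h : LinkDense H.rel p D)
    (S : W → Prop) :
    cnt (fun T : Fin (j + 1) → W =>
        cnt (fun a => S a ∧ H.IsEdge (insert a (Set.range T))) < p / 2 * cnt S)
      * (p / 2 * cnt S) ≤ D := by
  classical
  set B : (Fin (j + 1) → W) → Prop := fun T =>
    cnt (fun a => S a ∧ H.IsEdge (insert a (Set.range T))) < p / 2 * cnt S with hB
  have h1 := h (fun y a => B (Fin.cons a y)) (fun _ => S)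
  refine le_trans ?_ h1
  rw [cnt_cons, sum_cnt_comm, Finset.sum_mul]
  refine Finset.sum_le_sum fun y _ => ?_
  have h2 : pairCnt (H.rel y) (fun a => B (Fin.cons a y)) S ≤
      cnt (fun a => B (Fin.cons a y)) * (p / 2 * cnt S) := by
    rw [pairCnt_eq_sum, cnt_eq_sum (fun a => B (Fin.cons a y)), Finset.sum_mul]
    refine Finset.sum_le_sum fun a _ => ?_
    split_ifs with ha
    · rw [one_mul]
      refine le_trans (le_of_eq (cnt_congr fun b => ?_)) (le_of_lt ha)
      rw [rel_iff_cons]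
    · simp
  linarith

/-- The number of ordered tuples which form an edge together with `w`. -/
noncomputable def tupleDegree (H : KGraph (j + 2) W) (w : W) : ℝ :=
  cnt (fun T : Fin (j + 1) → W => H.IsEdge (insert w (Set.range T)))

/-- Density is tested on the cherries whose first entry has low degree, with no other restriction.
-/
theorem cnt_low_degree_mul_le {H : KGraph (j + 2) W} {p D : ℝ} (h : LinkDense H.rel p D) :
    cnt (fun w => H.tupleDegree w < p / 2 * (Fintype.card W : ℝ) ^ (j + 1))
      * (p / 2 * (Fintype.card W : ℝ) ^ (j + 1)) ≤ D := by
  classical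
  set B : W → Prop := fun w => H.tupleDegree w < p / 2 * (Fintype.card W : ℝ) ^ (j + 1) with hB
  have h1 := h (fun _ => B) (fun _ _ => True)
  refine le_trans ?_ h1
  rw [Finset.sum_sub_distrib]
  have h2 : ∑ y : Fin j → W, pairCnt (H.rel y) B (fun _ => True) ≤
      cnt B * (p / 2 * (Fintype.card W : ℝ) ^ (j + 1)) := by
    simp only [pairCnt_eq_sum, true_and]
    rw [Finset.sum_comm, cnt_eq_sum B, Finset.sum_mul]
    refine Finset.sum_le_sum fun a _ => ?_
    split_ifs with ha
    · rw [one_mul]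
      refine le_trans (le_of_eq ?_) (le_of_lt ha)
      rw [tupleDegree, cnt_cons, sum_cnt_comm]
      refine Finset.sum_congr rfl fun y _ => cnt_congr fun b => ?_
      rw [Fin.range_cons_eq, rel]
    · simp
  simp only [cnt_true, Finset.sum_const, Finset.card_univ, Fintype.card_fun, Fintype.card_fin,
    nsmul_eq_mul]
  push_cast
  rw [pow_succ] at h2 ⊢
  linarith

/-- At most k·n^(k-1) tuples meet `x₀`, so arbitrary changes at one vertex cost only k/n in the
error. -/
theorem CherryDense.of_agree {G H : KGraph k X} {p μ : ℝ} (h : H.CherryDense p μ) (x₀ : X)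
    (hG : ∀ s, x₀ ∉ s → H.IsEdge s → G.IsEdge s) :
    G.CherryDense p (μ + k / Fintype.card X) := by
  classical
  intro P Q
  have h1 := h P Q
  have hX : (0 : ℝ) < Fintype.card X := by
    have : Nonempty X := ⟨x₀⟩
    exact_mod_cast Fintype.card_pos
  have h2 := cnt_hits_mul_le (I := Fin k) (fun x => x = x₀)
  rw [cnt_eq_self, Fintype.card_fin, mul_one] at h2
  have h4 : (H.cherryEdgeCount P Q : ℝ) ≤
      G.cherryEdgeCount P Q + cnt (fun x : Fin k → X => ∃ i, x i = x₀) := by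
    rw [cherryEdgeCount, cherryEdgeCount, ← cnt_eq_ncard, ← cnt_eq_ncard]
    refine le_trans (cnt_mono fun x hx => ?_) (cnt_or_le _ _)
    by_cases hx0 : ∃ i, x i = x₀
    · exact Or.inr hx0
    · exact Or.inl ⟨hx.1, hG _ hx0 hx.2⟩
  have h5 : cnt (fun x : Fin k → X => ∃ i, x i = x₀) ≤
      k / Fintype.card X * (Fintype.card X : ℝ) ^ k := by
    rw [div_mul_eq_mul_div, le_div_iff₀ hX]
    exact h2
  linarith

theorem degree_le_tupleDegree (H : KGraph (j + 2) W) (w : W) :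
    (H.degree {w} : ℝ) ≤ H.tupleDegree w := by
  classical
  have h : ∀ e : Finset W, (e ∈ H.edges ∧ {w} ⊆ e) →
      ∃ T : Fin (j + 1) → W, insert w (Set.range T) = (e : Set W) := by
    rintro e ⟨he, hw⟩
    have hw' : w ∈ e := by simpa using hw
    have hc : (e.erase w).card = j + 1 := by
      rw [Finset.card_erase_of_mem hw', H.card_eq e he]; rfl
    refine ⟨fun i => ((e.erase w).equivFinOfCardEq hc).symm i, ?_⟩
    have : Set.range (fun i => (((e.erase w).equivFinOfCardEq hc).symm i : W)) =
        ((e.erase w : Finset W) : Set W) := by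
      change Set.range (Subtype.val ∘ ((e.erase w).equivFinOfCardEq hc).symm) = _
      rw [Set.range_comp, Equiv.range_eq_univ, Set.image_univ]
      exact Subtype.range_coe
    rw [this, ← Finset.coe_insert, Finset.insert_erase hw']
  have : Nonempty W := ⟨w⟩
  choose! T hT using h
  rw [degree, ← cnt_eq_ncard, tupleDegree]
  refine cnt_le_of_injOn T (fun e he => ⟨e, he.1, (hT e he).symm⟩) fun e e' he he' hee => ?_
  have := (hT e he).symm.trans ((congrArg (fun T => insert w (Set.range T)) hee).trans (hT e' he'))
  exact_mod_cast this

/-- All entries of such a tuple lie in one edge through `w`, which leaves at most k^(k-1) tuples per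
edge. -/
theorem tupleDegree_le (H : KGraph (j + 2) W) (w : W) :
    H.tupleDegree w ≤ ((j : ℝ) + 2) ^ (j + 1) * H.degree {w} := by
  classical
  rw [degree, ← cnt_eq_ncard, tupleDegree]
  refine cnt_le_mul_of_fiber (fun T => insert w (Finset.univ.image T)) ?_ ?_
  · rintro T ⟨e, he, h⟩
    have : e = insert w (Finset.univ.image T) := by
      rw [← Finset.coe_inj, h]; simp
    exact ⟨this ▸ he, by simp⟩
  · rintro e ⟨he, -⟩
    have h1 : (Fintype.piFinset fun _ : Fin (j + 1) => e).card = (j + 2) ^ (j + 1) := by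
      rw [Fintype.card_piFinset]; simp [H.card_eq e he]
    rw [cnt_eq_card]
    have h2 : (Finset.univ.filter fun T : Fin (j + 1) → W =>
        H.IsEdge (insert w (Set.range T)) ∧ insert w (Finset.univ.image T) = e) ⊆
        Fintype.piFinset fun _ : Fin (j + 1) => e := by
      intro T hT
      simp only [Finset.mem_filter, Finset.mem_univ, true_and] at hT
      rw [Fintype.mem_piFinset]
      intro i
      rw [← hT.2]
      simp
    have h3 := Finset.card_le_card h2
    rw [h1] at h3
    refine le_trans (le_of_eq ?_) ((Nat.cast_le (α := ℝ)).2 h3 |>.trans (le_of_eq ?_))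
    · congr!
    · push_cast; ring

end Fintype

end KGraph

/-! ### Copies through a root, and factor implies cover. -/

namespace KGraph

variable {k j : ℕ} {V : Type*} {W X : Type}

/-- The map `g` embeds `F` into `H`. -/
def IsCopy (F : KGraph k V) (H : KGraph k W) (g : V → W) : Prop :=
  Injective g ∧ ∀ e ∈ F.edges, H.IsEdge (g '' e)

theorem Copy.isCopy {F : KGraph k V} {H : KGraph k W} (c : Copy F H) :
    IsCopy F H c.toEmbedding :=
  ⟨c.toEmbedding.injective, fun e he => ⟨_, c.map_edge e he, by simp⟩⟩

/-- The labelled copy given by an embedding. -/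
def IsCopy.toCopy {F : KGraph k V} {H : KGraph k W} {g : V → W} (h : IsCopy F H g) : Copy F H where
  toEmbedding := ⟨g, h.1⟩
  map_edge e he := by
    obtain ⟨e', he', h'⟩ := h.2 e he
    have : e.map ⟨g, h.1⟩ = e' := by
      rw [← Finset.coe_inj, h']; simp
    exact this ▸ he'

theorem IsCopy.of_pull {F : KGraph k V} {H : KGraph k W} {φ : X → W} (hφ : Injective φ) {g : V → X}
    (h : IsCopy F (H.pull φ) g) : IsCopy F H (φ ∘ g) := by
  refine ⟨hφ.comp h.1, fun e he => ?_⟩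
  obtain ⟨e', he', h'⟩ := h.2 e he
  rw [Set.image_comp, ← h']
  exact he'.2

/-- Nonemptiness matters: the infimum of the empty set of naturals is 0 by default. -/
theorem le_minDegree_one [Nonempty W] {H : KGraph k W} {c : ℝ} (h : ∀ w, c ≤ H.degree {w}) :
    c ≤ H.minDegree 1 := by
  obtain ⟨S, hS, hS'⟩ : H.minDegree 1 ∈ {d : ℕ | ∃ S : Finset W, S.card = 1 ∧ H.degree S = d} :=
    Nat.sInf_mem ⟨_, {Classical.arbitrary W}, by simp, rfl⟩
  obtain ⟨w, rfl⟩ := Finset.card_eq_one.1 hS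
  rw [← hS']
  exact h w

theorem minDegree_one_le (H : KGraph k W) (w : W) : H.minDegree 1 ≤ H.degree {w} :=
  Nat.sInf_le ⟨{w}, by simp, rfl⟩

variable [Fintype W]

theorem tupleDegree_le_pull_add [Fintype X] (H : KGraph (j + 2) W) {B : W → Prop} {φ : X → W}
    (hφ : ∀ w, ¬ B w → ∃ x, φ x = w) (v : X) :
    H.tupleDegree (φ v) ≤ (H.pull φ).tupleDegree v +
      cnt (fun T : Fin (j + 1) → W => ∃ i, B (T i)) := by
  classical
  have : Nonempty X := ⟨v⟩
  choose! ψ hψ using hφ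
  refine (cnt_le_and_add _ (fun T : Fin (j + 1) → W => ¬ ∃ i, B (T i))).trans ?_
  simp only [not_not]
  refine add_le_add_left ?_ _
  have hT : ∀ T : Fin (j + 1) → W, (¬ ∃ i, B (T i)) → ∃ T' : Fin (j + 1) → X, φ ∘ T' = T := by
    intro T hT
    push Not at hT
    choose T' hT' using fun i => (⟨ψ (T i), hψ (T i) (hT i)⟩ : ∃ x, φ x = T i)
    exact ⟨T', funext hT'⟩
  choose! f hf using hT
  refine cnt_le_of_injOn f (fun T hT => ?_) fun T T' hT hT' h => ?_
  · rw [isEdge_pull_insert, hf T hT.2]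
    exact hT.1
  · rw [← hf T hT.2, ← hf T' hT'.2, h]

theorem card_subtype_not (B : W → Prop) [Fintype {w // ¬ B w}] :
    (Fintype.card {w // ¬ B w} : ℝ) = Fintype.card W - cnt B := by
  classical
  have h := cnt_add_cnt_not B
  have : (Fintype.card {w // ¬ B w} : ℝ) = cnt (fun w => ¬ B w) := by
    rw [cnt_eq_card, Fintype.card_subtype]
    congr!
  linarith

/-- Deleting at most θn vertices removes at most (j+1)θn^(j+1) tuples from any link. At least half
of the vertices remain, so renormalising costs the factor 2^(j+2) in μ. -/
theorem restrict_properties {H : KGraph (j + 2) W} {p μ θ δ : ℝ} {B : W → Prop}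
    [Fintype {w // ¬ B w}]
    (hH : H.CherryDense p μ) (hμ : 0 ≤ μ) (hθ : θ ≤ 1 / 2) (hB : cnt B ≤ θ * Fintype.card W)
    (hdeg : ∀ w, ¬ B w → δ * (Fintype.card W : ℝ) ^ (j + 1) ≤ H.tupleDegree w)
    (hδ : 0 ≤ δ - (j + 1) * θ) (x₀ : W) :
    (Fintype.card W : ℝ) / 2 ≤ Fintype.card {w // ¬ B w} ∧
    (H.pull (Subtype.val : {w // ¬ B w} → W)).CherryDense p (2 ^ (j + 2) * μ) ∧
    ∀ v, (δ - (j + 1) * θ) * (Fintype.card {w // ¬ B w} : ℝ) ^ (j + 1) ≤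
      (H.pull (Subtype.val : {w // ¬ B w} → W)).tupleDegree v := by
  set n : ℝ := (Fintype.card W : ℝ) with hn
  have hn0 : 0 < n := by
    have : Nonempty W := ⟨x₀⟩
    rw [hn]; exact_mod_cast Fintype.card_pos
  have hc := card_subtype_not B
  have hB0 := cnt_nonneg B
  have h1 : n / 2 ≤ Fintype.card {w // ¬ B w} := by
    rw [hc]; nlinarith
  refine ⟨h1, hH.pull Subtype.val_injective ?_, fun v => ?_⟩
  · have : n ^ (j + 2) ≤ (2 * (Fintype.card {w // ¬ B w} : ℝ)) ^ (j + 2) :=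
      pow_le_pow_left₀ hn0.le (by linarith) _
    rw [mul_pow] at this
    calc μ * n ^ (j + 2) ≤ μ * _ := mul_le_mul_of_nonneg_left this hμ
      _ = _ := by ring
  · have h2 := tupleDegree_le_pull_add H (B := B) (φ := (Subtype.val : {w // ¬ B w} → W))
      (fun w hw => ⟨⟨w, hw⟩, rfl⟩) v
    have h3 := hdeg v v.2
    have h4 := cnt_hits_mul_le (I := Fin (j + 1)) B
    rw [Fintype.card_fin, ← hn] at h4
    have h5 : cnt (fun T : Fin (j + 1) → W => ∃ i, B (T i)) ≤ (j + 1) * θ * n ^ (j + 1) := by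
      refine le_of_mul_le_mul_right (h4.trans ?_) hn0
      push_cast
      have := mul_le_mul_of_nonneg_left hB (by positivity : 0 ≤ ((j : ℝ) + 1) * n ^ (j + 1))
      linarith
    have h6 : (Fintype.card {w // ¬ B w} : ℝ) ^ (j + 1) ≤ n ^ (j + 1) :=
      pow_le_pow_left₀ (Nat.cast_nonneg _) (by rw [hc]; linarith) _
    have := mul_le_mul_of_nonneg_left h6 hδ
    linarith

/-- Only the root needs a degree condition: density leaves few other vertices of low degree, and
these can be deleted before the covering property is applied. -/
theorem exists_copy_at_root {F : KGraph (j + 2) V} (hF : F ∈ cherryCOVER (j + 2) 1 V) {p α : ℝ}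
    (hp0 : 0 < p) (hp1 : p < 1) (hα0 : 0 < α) (hα1 : α < 1) :
    ∃ (n₀ : ℕ) (μ : ℝ), 0 < μ ∧ ∀ (W : Type) [Fintype W] (H : KGraph (j + 2) W),
      H.CherryDense p μ → n₀ ≤ Fintype.card W → ∀ x₀ : W,
      α * (Fintype.card W : ℝ) ^ (j + 1) ≤ H.tupleDegree x₀ →
      ∃ (g : V → W) (v : V), IsCopy F H g ∧ g v = x₀ := by
  classical
  set δ : ℝ := min (p / 2) α with hδ
  have hδ0 : 0 < δ := lt_min (by linarith) hα0
  have hδ1 : δ < 1 := (min_le_right _ _).trans_lt hα1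
  set K : ℝ := ((j : ℝ) + 2) ^ (j + 1) with hK
  have hK1 : 1 ≤ K := one_le_pow₀ (by linarith [(Nat.cast_nonneg j : (0 : ℝ) ≤ j)])
  have hj : (0 : ℝ) ≤ j := Nat.cast_nonneg j
  set θ : ℝ := δ / (2 * (j + 1)) with hθ
  have hθ0 : 0 < θ := by positivity
  have hθj : (j + 1) * θ = δ / 2 := by rw [hθ]; field_simp
  have hθ1 : θ ≤ 1 / 2 := by nlinarith
  -- Deletion loses half of δ; division by `K` passes from ordered tuples to edges.
  obtain ⟨n₀, μ, hμ, h⟩ := hF p (δ / 2 / K) hp0 hp1 (by positivity) (by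
    rw [div_lt_one (by linarith)]; linarith)
  refine ⟨2 * n₀, min (μ / 2 ^ (j + 2)) (p / 2 * θ), by positivity, ?_⟩
  intro W _ H hH hn x₀ hx₀
  set n : ℝ := (Fintype.card W : ℝ) with hn'
  have hn0 : 0 < n := by
    have : Nonempty W := ⟨x₀⟩
    rw [hn']; exact_mod_cast Fintype.card_pos
  set B : W → Prop := fun w => w ≠ x₀ ∧ H.tupleDegree w < p / 2 * n ^ (j + 1) with hB
  have hBc : cnt B ≤ θ * n := by
    have h1 := cnt_low_degree_mul_le (cherryDense_iff.1 hH)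
    have h2 : cnt B * (p / 2 * n ^ (j + 1)) ≤ p / 2 * θ * n ^ (j + 2) := by
      refine (mul_le_mul_of_nonneg_right (cnt_mono fun w hw => hw.2) (by positivity)).trans
        (h1.trans ?_)
      gcongr
      exact min_le_right _ _
    refine le_of_mul_le_mul_right (h2.trans (le_of_eq ?_))
      (by positivity : 0 < p / 2 * n ^ (j + 1))
    ring
  obtain ⟨h1, h2, h3⟩ := restrict_properties (δ := δ) hH (by positivity) hθ1 hBc (by
    intro w hw
    simp only [hB, not_and, not_lt] at hw
    by_cases hwx : w = x₀
    · subst hwx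
      refine le_trans ?_ hx₀
      gcongr
      exact min_le_right _ _
    · refine le_trans ?_ (hw hwx)
      gcongr
      exact min_le_left _ _) (by rw [hθj]; linarith) x₀
  have hx₀B : ¬ B x₀ := by simp [hB]
  have hne : Nonempty {w // ¬ B w} := ⟨⟨x₀, hx₀B⟩⟩
  have hmu : 2 ^ (j + 2) * min (μ / 2 ^ (j + 2)) (p / 2 * θ) ≤ μ := by
    have := mul_le_mul_of_nonneg_left (min_le_left (μ / 2 ^ (j + 2)) (p / 2 * θ))
      (by positivity : (0 : ℝ) ≤ 2 ^ (j + 2))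
    rwa [mul_div_cancel₀ _ (by positivity)] at this
  have h4 := h {w // ¬ B w} (H.pull Subtype.val) (fun P Q => by
      refine le_trans ?_ (h2 P Q)
      gcongr) (by
      refine le_minDegree_one fun w => ?_
      have h5 := h3 w
      have h6 := tupleDegree_le (H.pull (Subtype.val : {w // ¬ B w} → W)) w
      have h7 := h5.trans h6
      rw [hθj] at h7
      rw [div_mul_eq_mul_div, div_le_iff₀ (by linarith), mul_comm _ K]
      refine le_trans (le_of_eq ?_) h7
      change δ / 2 * (Fintype.card {w // ¬ B w} : ℝ) ^ (j + 1) = _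
      ring) (by
      have : (2 * n₀ : ℝ) ≤ n := by rw [hn']; exact_mod_cast hn
      have : (n₀ : ℝ) ≤ Fintype.card {w // ¬ B w} := by linarith
      exact_mod_cast this)
  obtain ⟨c, v, hv⟩ := h4 ⟨x₀, hx₀B⟩
  exact ⟨Subtype.val ∘ c.toEmbedding, v, c.isCopy.of_pull Subtype.val_injective, by simp [hv]⟩

theorem exists_copy {F : KGraph (j + 2) V} (hF : F ∈ cherryCOVER (j + 2) 1 V) {p : ℝ}
    (hp0 : 0 < p) (hp1 : p < 1) :
    ∃ (n₀ : ℕ) (μ : ℝ), 0 < μ ∧ ∀ (W : Type) [Fintype W] (H : KGraph (j + 2) W),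
      H.CherryDense p μ → n₀ ≤ Fintype.card W → ∃ g : V → W, IsCopy F H g := by
  obtain ⟨n₀, μ, hμ, h⟩ := exists_copy_at_root hF hp0 hp1 (α := p / 2) (by linarith) (by linarith)
  refine ⟨n₀ + 1, min μ (p / 4), by positivity, fun W _ H hH hn => ?_⟩
  have hne : Nonempty W := Fintype.card_pos_iff.1 (by omega)
  set n : ℝ := (Fintype.card W : ℝ) with hn'
  have hn0 : 0 < n := by rw [hn']; exact_mod_cast Fintype.card_pos
  have h1 := cnt_low_degree_mul_le (cherryDense_iff.1 hH)
  have h2 : ∃ x, ¬ H.tupleDegree x < p / 2 * n ^ (j + 1) := by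
    by_contra! hall
    have h3 : cnt (fun w => H.tupleDegree w < p / 2 * n ^ (j + 1)) = n := by
      refine (cnt_congr fun w => ⟨fun _ => trivial, fun _ => hall w⟩).trans cnt_true
    rw [h3] at h1
    have h4 : min μ (p / 4) * n ^ (j + 2) ≤ p / 4 * n ^ (j + 2) := by
      gcongr; exact min_le_right _ _
    have h5 : 0 < n ^ (j + 2) := by positivity
    have h6 : n * (p / 2 * n ^ (j + 1)) = p / 2 * n ^ (j + 2) := by ring
    nlinarith
  obtain ⟨x, hx⟩ := h2
  obtain ⟨g, -, hg, -⟩ := h W H (fun P Q => by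
    refine le_trans ?_ (hH P Q)
    gcongr
    exact min_le_left _ _) (by omega) x (not_lt.1 hx)
  exact ⟨g, hg⟩

theorem cherryFACTOR_subset_cherryCOVER [Fintype V] [Nonempty V] :
    cherryFACTOR (j + 2) 1 V ⊆ cherryCOVER (j + 2) 1 V := by
  classical
  intro F hF p α hp0 hp1 hα0 hα1
  have hj : (0 : ℝ) ≤ j := Nat.cast_nonneg j
  set f := Fintype.card V with hf
  have hf0 : 0 < f := Fintype.card_pos
  set K : ℝ := ((j : ℝ) + 2) ^ (j + 1) with hK
  have hK1 : 1 ≤ K := one_le_pow₀ (by linarith)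
  set θ : ℝ := α / (2 * (j + 1)) with hθ
  have hθ0 : 0 < θ := by positivity
  have hθj : (j + 1) * θ = α / 2 := by rw [hθ]; field_simp
  have hθ1 : θ ≤ 1 / 2 := by nlinarith
  obtain ⟨n₀, μ, hμ, h⟩ := hF p (α / 2 / K) hp0 hp1 (by positivity) (by
    rw [div_lt_one (by linarith)]; linarith)
  -- Beyond this size, the fewer than v(F) deleted vertices are at most a θ proportion.
  obtain ⟨N, hN⟩ := exists_nat_gt (f / θ)
  refine ⟨2 * n₀ + N + f + 1, μ / 2 ^ (j + 2), by positivity, ?_⟩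
  intro W _ H hH hdeg hn x₀
  set n : ℝ := (Fintype.card W : ℝ) with hn'
  have hne : Nonempty W := ⟨x₀⟩
  have hn0 : 0 < n := by rw [hn']; exact_mod_cast Fintype.card_pos
  have hmod : Fintype.card W % f < f := Nat.mod_lt _ hf0
  obtain ⟨S, hS, hSc⟩ := Finset.exists_subset_card_eq
    (s := Finset.univ.erase x₀) (n := Fintype.card W % f) (by
      rw [Finset.card_erase_of_mem (Finset.mem_univ _), Finset.card_univ]
      omega)
  set B : W → Prop := fun w => w ∈ S with hB
  have hBS : cnt B = S.card := by
    rw [cnt_eq_card]; congr 1; simp [hB]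
  have hBc : cnt B ≤ θ * n := by
    rw [hBS, hSc]
    have h1 : ((Fintype.card W % f : ℕ) : ℝ) ≤ f := by exact_mod_cast hmod.le
    have h2 : (N : ℝ) ≤ n := by rw [hn']; exact_mod_cast (by omega)
    have h3 := (div_lt_iff₀ hθ0).1 hN
    nlinarith
  have hx₀B : ¬ B x₀ := fun h => by
    have := hS h
    simp at this
  obtain ⟨h1, h2, h3⟩ := restrict_properties (δ := α) hH (by positivity) hθ1 hBc (by
    intro w hw
    refine le_trans ?_ (degree_le_tupleDegree H w)
    refine le_trans hdeg ?_
    exact_mod_cast minDegree_one_le H w) (by rw [hθj]; linarith) x₀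
  have hne : Nonempty {w // ¬ B w} := ⟨⟨x₀, hx₀B⟩⟩
  have hcard : Fintype.card {w // ¬ B w} = Fintype.card W - Fintype.card W % f := by
    rw [Fintype.card_subtype_compl, ← hSc]
    simp [hB]
  obtain ⟨T, -, hT⟩ := h {w // ¬ B w} (H.pull Subtype.val) (fun P Q => by
      have := h2 P Q
      rwa [mul_div_cancel₀ _ (by positivity)] at this) (by
      refine le_minDegree_one fun w => ?_
      have h5 := h3 w
      have h6 := tupleDegree_le (H.pull (Subtype.val : {w // ¬ B w} → W)) w
      have h7 := h5.trans h6
      rw [hθj] at h7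
      rw [div_mul_eq_mul_div, div_le_iff₀ (by linarith), mul_comm _ K]
      refine le_trans (le_of_eq ?_) h7
      change α / 2 * (Fintype.card {w // ¬ B w} : ℝ) ^ (j + 1) = _
      ring) (by omega) (by
      rw [hcard]
      exact Nat.dvd_sub_mod _)
  have hmem : (⟨x₀, hx₀B⟩ : {w // ¬ B w}) ∈ ⋃ c ∈ T, Copy.verts c := by rw [hT]; trivial
  simp only [Set.mem_iUnion] at hmem
  obtain ⟨c, -, v, hv⟩ := hmem
  have hc := c.isCopy.of_pull Subtype.val_injective
  exact ⟨hc.toCopy, v, by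
    change (Subtype.val ∘ c.toEmbedding) v = x₀
    simp [hv]⟩

end KGraph

/-! ### Many rooted copies, by grafting a link onto a sample. -/

namespace KGraph

variable {k j : ℕ} {V : Type*} {W X : Type}

theorem CherryDense.mono [Fintype W] {H : KGraph k W} {p μ μ' : ℝ} (h : H.CherryDense p μ)
    (hμ : μ ≤ μ') : H.CherryDense p μ' := fun P Q =>
  (sub_le_sub_left (mul_le_mul_of_nonneg_right hμ (by positivity)) _).trans (h P Q)

/-- The `k`-graph obtained from `G` by replacing the link of the vertex `x₀` by `L`. -/
def graft (G : KGraph k X) (L : Set X → Prop) (x₀ : X) : KGraph k X where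
  edges := {e | e.card = k ∧ ((x₀ ∉ e ∧ G.IsEdge e) ∨ (x₀ ∈ e ∧ L ((e : Set X) \ {x₀})))}
  card_eq _ he := he.1

theorem IsEdge.graft {G : KGraph k X} {s : Set X} (h : G.IsEdge s) (L : Set X → Prop) {x₀ : X}
    (hx : x₀ ∉ s) : (G.graft L x₀).IsEdge s := by
  obtain ⟨e, he, rfl⟩ := h
  exact ⟨e, ⟨G.card_eq e he, Or.inl ⟨hx, e, he, rfl⟩⟩, rfl⟩

theorem cnt_le_tupleDegree_graft [Fintype X] (G : KGraph (j + 2) X) (L : Set X → Prop) (x₀ : X) :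
    cnt (fun T : Fin (j + 1) → X => (Injective T ∧ ∀ i, T i ≠ x₀) ∧ L (Set.range T)) ≤
      (G.graft L x₀).tupleDegree x₀ := by
  classical
  refine cnt_mono fun T hT => ?_
  obtain ⟨⟨hinj, hx⟩, hL⟩ := hT
  have hx' : x₀ ∉ Finset.univ.image T := by simpa using hx
  refine ⟨insert x₀ (Finset.univ.image T), ⟨?_, Or.inr ⟨by simp, ?_⟩⟩, by simp⟩
  · rw [Finset.card_insert_of_notMem hx', Finset.card_image_of_injective _ hinj]
    simp
  · have : ((insert x₀ (Finset.univ.image T) : Finset X) : Set X) \ {x₀} = Set.range T := by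
      rw [Finset.coe_insert, Set.insert_sdiff_of_mem _ (Set.mem_singleton x₀)]
      rw [Set.sdiff_singleton_eq_self (by simpa using hx)]
      simp
    rwa [this]

/-- Away from the root `v` the map `g` embeds `F` into `H`, and the edges at the root are mapped to
members of `L`. The value of `g` at `v` is irrelevant. -/
def Rooted (F : KGraph k V) (H : KGraph k W) (L : Set W → Prop) (v : V) (g : V → W) : Prop :=
  Set.InjOn g {v}ᶜ ∧ ∀ e ∈ F.edges,
    (v ∉ e → H.IsEdge (g '' e)) ∧ (v ∈ e → L (g '' ((e : Set V) \ {v})))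

theorem IsCopy.rooted_of_graft {F : KGraph k V} {H : KGraph k W} {L : Set W → Prop} {φ : X → W}
    (hφ : Injective φ) {g : V → X} {v : V}
    (h : IsCopy F ((H.pull φ).graft (fun s => L (φ '' s)) (g v)) g) : Rooted F H L v (φ ∘ g) := by
  refine ⟨(hφ.comp h.1).injOn, fun e he => ?_⟩
  obtain ⟨e', ⟨-, he'⟩, h'⟩ := h.2 e he
  have hmem : g v ∈ e' ↔ v ∈ e := by
    rw [← Finset.mem_coe, h', h.1.mem_set_image, Finset.mem_coe]
  rw [h'] at he'
  constructor
  · intro hv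
    rcases he' with ⟨-, e₂, he₂, h₂⟩ | ⟨h1, -⟩
    · rw [Set.image_comp, ← h₂]
      exact he₂.2
    · exact absurd (hmem.1 h1) hv
  · intro hv
    rcases he' with ⟨h1, -⟩ | ⟨-, h1⟩
    · exact absurd (hmem.2 hv) h1
    · rw [Set.image_comp, Set.image_sdiff h.1, Set.image_singleton]
      exact h1

theorem half_le_cnt_injective_avoid {m : ℕ} (hm : 4 * (j + 2) ^ 2 ≤ m) (x₀ : Fin m) :
    (m : ℝ) ^ (j + 1) / 2 ≤
      cnt (fun T : Fin (j + 1) → Fin m => Injective T ∧ ∀ i, T i ≠ x₀) := by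
  have hm0 : (0 : ℝ) < m := by exact_mod_cast x₀.pos
  have hm' : 4 * ((j : ℝ) + 2) ^ 2 ≤ m := by exact_mod_cast hm
  have h1 := cnt_not_injective_mul_le (I := Fin (j + 1)) (W := Fin m)
  have h2 := cnt_hits_mul_le (I := Fin (j + 1)) (fun x : Fin m => x = x₀)
  rw [cnt_eq_self, mul_one] at h2
  have h4 := cnt_add_cnt_not (fun T : Fin (j + 1) → Fin m => Injective T ∧ ∀ i, T i ≠ x₀)
  have h5 : cnt (fun T : Fin (j + 1) → Fin m => ¬ (Injective T ∧ ∀ i, T i ≠ x₀)) ≤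
      cnt (fun T : Fin (j + 1) → Fin m => ¬ Injective T) +
      cnt (fun T : Fin (j + 1) → Fin m => ∃ i, T i = x₀) := by
    refine le_trans (cnt_mono fun T hT => ?_) (cnt_or_le _ _)
    by_cases h : Injective T
    · right
      by_contra! hne
      exact hT ⟨h, hne⟩
    · exact Or.inl h
  simp only [Fintype.card_fin, Fintype.card_fun] at h1 h2 h4
  push_cast at h1 h2 h4
  have h6 : cnt (fun T : Fin (j + 1) → Fin m => ¬ (Injective T ∧ ∀ i, T i ≠ x₀)) ≤
      (m : ℝ) ^ (j + 1) / 2 := by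
    refine le_of_mul_le_mul_right ?_ hm0
    have hj : (0 : ℝ) ≤ j := Nat.cast_nonneg j
    have h7 : ((j : ℝ) + 1) ^ 2 + (j + 1) ≤ m / 2 := by nlinarith
    have h8 := mul_le_mul_of_nonneg_right h7 (by positivity : 0 ≤ (m : ℝ) ^ (j + 1))
    have h9 := mul_le_mul_of_nonneg_right h5 hm0.le
    linarith
  linarith

/-- A positive proportion of samples of bounded size `m` are injective, dense and see a positive
proportion of `L`. In each, the covering property at the grafted vertex gives a copy, hence a rooted
copy in `H`. One of the boundedly many positions (g, v) in the sample serves for a positive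
proportion of samples, and restricting samples to that position gives the count. -/
theorem exists_many_rooted [Fintype V] [DecidableEq V] {F : KGraph (j + 2) V}
    (hF : F ∈ cherryCOVER (j + 2) 1 V) {p β : ℝ}
    (hp0 : 0 < p) (hp1 : p < 1) (hβ0 : 0 < β) (hβ1 : β < 1) :
    ∃ (n₀ : ℕ) (c μ : ℝ), 0 < c ∧ 0 < μ ∧ ∀ (W : Type) [Fintype W] (H : KGraph (j + 2) W),
      H.CherryDense p μ → n₀ ≤ Fintype.card W → ∀ L : Set W → Prop,
      β * (Fintype.card W : ℝ) ^ (j + 1) ≤ cnt (fun T : Fin (j + 1) → W => L (Set.range T)) →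
      ∃ v : V, c * (Fintype.card W : ℝ) ^ Fintype.card V ≤
        cnt (fun g : V → W => Rooted F H L v g) := by
  classical
  obtain ⟨p', hp'0, hp'1, hsample⟩ := exists_linkDense_sample j hp0 hp1
  obtain ⟨m₀, μ', hμ', hroot⟩ := exists_copy_at_root hF hp'0 hp'1 (α := β / 4)
    (by positivity) (by linarith)
  obtain ⟨μ, M, hμ, hM⟩ := hsample (β / 16) (μ' / 2) (by positivity) (by positivity)
  obtain ⟨m₁, hm₁⟩ := exists_nat_gt ((((j + 2 : ℕ) : ℝ)) / (μ' / 2))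
  set m := M + m₀ + m₁ + 4 * (j + 2) ^ 2 with hm
  have hmpos : 0 < m := by positivity
  have hmR : (0 : ℝ) < m := by exact_mod_cast hmpos
  set x₀ : Fin m := ⟨0, hmpos⟩ with hx₀
  obtain ⟨N, hN⟩ := exists_nat_gt (16 * (m : ℝ) ^ 2 / β)
  -- The added 1 keeps `K` positive even when `V` is empty.
  set K : ℝ := Fintype.card ((V → Fin m) × V) + 1 with hK
  have hK0 : 0 < K := by positivity
  refine ⟨N + 1, β / 8 / K, μ, by positivity, hμ, ?_⟩
  intro W _ H hH hn L hL
  have hne : Nonempty W := Fintype.card_pos_iff.1 (by omega)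
  set n : ℝ := (Fintype.card W : ℝ) with hn'
  have hn0 : 0 < n := by rw [hn']; exact_mod_cast Fintype.card_pos
  have hNn : (N : ℝ) ≤ n := by rw [hn']; exact_mod_cast (by omega)
  have hnm : 0 < n ^ m := by positivity
  have hmj : 0 < (m : ℝ) ^ (j + 1) := by positivity
  set G : (Fin (j + 1) → Fin m) → Prop := fun T => Injective T ∧ ∀ i, T i ≠ x₀ with hG
  have hGc : (m : ℝ) ^ (j + 1) / 2 ≤ cnt G := half_le_cnt_injective_avoid (by omega) x₀
  set D : (Fin m → W) → ℝ := fun φ =>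
    cnt (fun T : Fin (j + 1) → Fin m => G T ∧ L (Set.range (φ ∘ T))) with hD
  have h1 := le_sum_cnt_comp (J := Fin m) (fun T : Fin (j + 1) → W => L (Set.range T)) (q := β) G
    (fun T hT => hT.1) (by simpa using hL)
  rw [Fintype.card_fin, ← hn'] at h1
  have h2 := sum_le_cnt_add (f := D) (M := (m : ℝ) ^ (j + 1)) (t := β / 4 * (m : ℝ) ^ (j + 1))
    (P := fun φ => β / 4 * (m : ℝ) ^ (j + 1) < D φ) (by positivity)
    (fun φ _ => (cnt_le_card _).trans (by simp)) (fun φ hφ => not_lt.1 hφ)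
  -- At least half of the index tuples are injective and avoid `x₀`, so the average of `D` is at
  -- least (β/2)m^(j+1), and it exceeds half of this on a β/4 proportion. Discarding the samples
  -- that are not dense or not injective, β/16 each, leaves β/8.
  have h3 : β / 4 * n ^ m ≤ cnt (fun φ => β / 4 * (m : ℝ) ^ (j + 1) < D φ) := by
    rw [Fintype.card_fun, Fintype.card_fin] at h2
    push_cast at h2
    rw [← hn'] at h2
    refine le_of_mul_le_mul_left ?_ hmj
    have h4 : n ^ m * ((m : ℝ) ^ (j + 1) / 2) * β ≤ n ^ m * cnt G * β := by gcongr
    have h5 := h1.trans h2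
    linarith
  have h4 := hM m (by omega) W H.rel (cherryDense_iff.1 hH)
  have h5 : cnt (fun φ : Fin m → W => ¬ Injective φ) ≤ β / 16 * n ^ m := by
    have h6 := cnt_not_injective_mul_le (I := Fin m) (W := W)
    rw [Fintype.card_fin, ← hn'] at h6
    refine le_of_mul_le_mul_right (h6.trans ?_) hn0
    have h7 : (m : ℝ) ^ 2 ≤ β / 16 * n := by
      have := (div_lt_iff₀ hβ0).1 hN
      nlinarith
    calc _ ≤ β / 16 * n * n ^ m := by gcongr
      _ = _ := by ring
  have h6 := cnt_le_and_add (fun φ => β / 4 * (m : ℝ) ^ (j + 1) < D φ)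
    (fun φ : Fin m → W => LinkDense (fun (y : Fin j → Fin m) a b => H.rel (φ ∘ y) (φ a) (φ b)) p'
            (μ' / 2 * (m : ℝ) ^ (j + 2)))
  have h7 := cnt_le_and_add (fun φ => β / 4 * (m : ℝ) ^ (j + 1) < D φ ∧
    LinkDense (fun (y : Fin j → Fin m) a b => H.rel (φ ∘ y) (φ a) (φ b)) p'
            (μ' / 2 * (m : ℝ) ^ (j + 2))) (fun φ => Injective φ)
  have h8 : β / 8 * n ^ m ≤ cnt (fun φ : Fin m → W => ∃ q : (V → Fin m) × V,
      Injective q.1 ∧ Rooted F H L q.2 (φ ∘ q.1)) := by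
    refine le_trans (?_ : β / 8 * n ^ m ≤ _) (cnt_mono (P := fun φ : Fin m → W =>
      (β / 4 * (m : ℝ) ^ (j + 1) < D φ ∧
    LinkDense (fun (y : Fin j → Fin m) a b => H.rel (φ ∘ y) (φ a) (φ b)) p'
            (μ' / 2 * (m : ℝ) ^ (j + 2))) ∧ Injective φ) ?_)
    · rw [← hn'] at h4
      linarith
    · rintro φ ⟨⟨hφ1, hφ2⟩, hφ3⟩
      have hd : (H.pull φ).CherryDense p' (μ' / 2) := by
        rw [cherryDense_iff, Fintype.card_fin]
        have : (H.pull φ).rel = fun (y : Fin j → Fin m) a b => H.rel (φ ∘ y) (φ a) (φ b) := by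
          funext y a b
          exact propext (rel_pull φ y a b)
        rwa [this]
      have hd2 : ((H.pull φ).graft (fun s => L (φ '' s)) x₀).CherryDense p' μ' := by
        refine (hd.of_agree x₀ fun s hs h => h.graft _ hs).mono ?_
        have : ((j + 2 : ℕ) : ℝ) / m ≤ μ' / 2 := by
          rw [div_le_iff₀ hmR]
          have h9 := (div_lt_iff₀ (by positivity)).1 hm₁
          have h10 : (m₁ : ℝ) ≤ m := by exact_mod_cast (by omega)
          nlinarith
        rw [Fintype.card_fin]
        linarith
      obtain ⟨g, v, hg, hgv⟩ := hroot (Fin m) _ hd2 (by rw [Fintype.card_fin]; omega) x₀ (by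
        rw [Fintype.card_fin]
        refine hφ1.le.trans (le_trans (le_of_eq ?_) (cnt_le_tupleDegree_graft _ _ _))
        simp only [hD, hG, Set.range_comp])
      rw [← hgv] at hg
      exact ⟨(g, v), hg.1, hg.rooted_of_graft hφ3⟩
  obtain ⟨⟨g, v⟩, hgv⟩ := exists_large_cnt _ (by positivity) (by rw [hK]; linarith : _ ≤ K) h8
  refine ⟨v, ?_⟩
  have hinj : Injective g := by
    by_contra hcon
    simp only [hcon, false_and, cnt_false, mul_zero] at hgv
    have : 0 < β / 8 * n ^ m := by positivity
    linarith
  have h9 := cnt_comp_mul (W := W) g hinj (fun g => Rooted F H L v g)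
  rw [Fintype.card_fin, ← hn'] at h9
  simp only [hinj, true_and] at hgv
  rw [div_mul_eq_mul_div, div_le_iff₀ hK0]
  have h10 : 0 < n ^ Fintype.card V := by positivity
  have h11 := mul_le_mul_of_nonneg_right hgv h10.le
  rw [mul_assoc K, h9] at h11
  refine le_of_mul_le_mul_left ?_ hnm
  linarith

end KGraph

/-! ### Codegrees and exchangeable vertices. -/

namespace KGraph

variable {k j : ℕ} {V : Type*} {W : Type}

/-- The vertex `x` of the copy `h` can be exchanged for `t`. -/
def Exchange [DecidableEq V] (F : KGraph k V) (H : KGraph k W) (h : V → W) (x t : W) : Prop :=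
  ∃ b, h b = x ∧ IsCopy F H h ∧ IsCopy F H (update h b t)

theorem Rooted.isCopy_update [DecidableEq V] {F : KGraph k V} {H : KGraph k W} {L : Set W → Prop} {v : V}
    {g : V → W} (hg : Rooted F H L v g) {u : W} (hu : ∀ i, g i ≠ u)
    (hL : ∀ s, L s → H.IsEdge (insert u s)) : IsCopy F H (update g v u) := by
  constructor
  · intro a b hab
    by_cases ha : a = v <;> by_cases hb : b = v
    · rw [ha, hb]
    · subst ha
      rw [update_self, update_of_ne hb] at hab
      exact absurd hab.symm (hu b)
    · subst hb
      rw [update_self, update_of_ne ha] at hab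
      exact absurd hab (hu a)
    · rw [update_of_ne ha, update_of_ne hb] at hab
      exact hg.1 ha hb hab
  · intro e he
    by_cases hv : v ∈ e
    · have h1 := hL _ ((hg.2 e he).2 hv)
      have h2 : update g v u '' (e : Set V) = insert u (g '' ((e : Set V) \ {v})) := by
        conv_lhs => rw [← Set.insert_sdiff_self_of_mem (Finset.mem_coe.2 hv)]
        rw [Set.image_insert_eq, update_self]
        congr 1
        refine Set.image_congr fun a ha => ?_
        rw [update_of_ne ha.2]
      rwa [h2]
    · have h1 := (hg.2 e he).1 hv
      have h2 : update g v u '' (e : Set V) = g '' e := by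
        refine Set.image_congr fun a ha => ?_
        rw [update_of_ne]
        rintro rfl
        exact hv ha
      rwa [h2]

variable [Fintype W]

/-- The number of ordered tuples which form an edge with `u` as well as with `v`. -/
noncomputable def codegree (H : KGraph (j + 2) W) (u v : W) : ℝ :=
  cnt (fun T : Fin (j + 1) → W =>
    H.IsEdge (insert u (Set.range T)) ∧ H.IsEdge (insert v (Set.range T)))

theorem codegree_comm (H : KGraph (j + 2) W) (u v : W) : H.codegree u v = H.codegree v u :=
  cnt_congr fun _ => and_comm

theorem codegree_le (H : KGraph (j + 2) W) (u v : W) :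
    H.codegree u v ≤ (Fintype.card W : ℝ) ^ (j + 1) :=
  (cnt_le_card _).trans (by simp)

theorem codegree_self (H : KGraph (j + 2) W) (u : W) : H.codegree u u = H.tupleDegree u :=
  cnt_congr fun _ => and_self_iff

/-- Most tuples in the link of `t` extend to edges in at least pn/2 ways. Summed over u, the
codegrees with `t` are therefore large, so many single codegrees are. -/
theorem le_cnt_neighbors {H : KGraph (j + 2) W} {p α β μ : ℝ} (hH : H.CherryDense p μ)
    (hp0 : 0 < p) (hβ0 : 0 ≤ β) (hβ : β ≤ α * p / 8) (hμ : μ ≤ α * p / 4) {t : W}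
    (ht : α * (Fintype.card W : ℝ) ^ (j + 1) ≤ H.tupleDegree t) :
    α * p / 8 * Fintype.card W ≤
      cnt (fun u => β * (Fintype.card W : ℝ) ^ (j + 1) ≤ H.codegree t u) := by
  have hne : Nonempty W := ⟨t⟩
  set n : ℝ := (Fintype.card W : ℝ) with hn
  have hn0 : 0 < n := by rw [hn]; exact_mod_cast Fintype.card_pos
  have hnj : 0 < n ^ (j + 1) := by positivity
  have h1 := cnt_poor_tuples_mul_le (cherryDense_iff.1 hH) (fun _ => True)
  simp only [cnt_true, true_and, ← hn] at h1
  set Bd : (Fin (j + 1) → W) → Prop := fun T =>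
    cnt (fun a => H.IsEdge (insert a (Set.range T))) < p / 2 * n with hBd
  have h2 : cnt Bd ≤ α / 2 * n ^ (j + 1) := by
    refine le_of_mul_le_mul_right (h1.trans ?_) (by positivity : 0 < p / 2 * n)
    calc μ * n ^ (j + 2) ≤ α * p / 4 * n ^ (j + 2) := by gcongr
      _ = _ := by ring
  have h3 := cnt_le_and_add (fun T : Fin (j + 1) → W => H.IsEdge (insert t (Set.range T)))
    (fun T => ¬ Bd T)
  simp only [not_not] at h3
  have h4 : α / 2 * n ^ (j + 1) ≤
      cnt (fun T : Fin (j + 1) → W => H.IsEdge (insert t (Set.range T)) ∧ ¬ Bd T) := by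
    have : H.tupleDegree t = cnt (fun T : Fin (j + 1) → W => H.IsEdge (insert t (Set.range T))) :=
      rfl
    linarith
  have h5 := mul_cnt_le_sum (f := fun T : Fin (j + 1) → W =>
      cnt (fun u => H.IsEdge (insert t (Set.range T)) ∧ H.IsEdge (insert u (Set.range T))))
    (t := p / 2 * n)
    (P := fun T : Fin (j + 1) → W => H.IsEdge (insert t (Set.range T)) ∧ ¬ Bd T)
    (fun T => cnt_nonneg _) (by
      rintro T ⟨hT, hT'⟩
      simp only [hT, true_and]
      exact not_lt.1 hT')
  rw [sum_cnt_comm] at h5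
  have h6 := sum_le_cnt_add (f := fun u => H.codegree t u) (M := n ^ (j + 1))
    (t := β * n ^ (j + 1)) (P := fun u => β * n ^ (j + 1) ≤ H.codegree t u) (by positivity)
    (fun u _ => H.codegree_le t u) (fun u hu => (not_le.1 hu).le)
  have h7 : p / 2 * n * (α / 2 * n ^ (j + 1)) ≤ p / 2 * n * cnt (fun T : Fin (j + 1) → W =>
    H.IsEdge (insert t (Set.range T)) ∧ ¬ Bd T) := by gcongr
  have h8 : ∑ u, H.codegree t u = ∑ b, cnt (fun T : Fin (j + 1) → W =>
    H.IsEdge (insert t (Set.range T)) ∧ H.IsEdge (insert b (Set.range T))) := rfl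
  have h9 : β * n ^ (j + 1) * n ≤ α * p / 8 * n ^ (j + 1) * n := by gcongr
  refine le_of_mul_le_mul_left ?_ hnj
  rw [← hn] at h6
  linarith

/-- Let Y be the exceptional set and suppose it is large. At least half of all (k-1)-tuples extend
well both into `S` and into Y, so the codegrees between `S` and Y sum to at least
(p²/8)|S||Y|n^(k-1). Each exceptional y contributes at most 2βn^k, which is too little for this β.
-/
theorem cnt_unlinked_le {H : KGraph (j + 2) W} {p γ β θ μ : ℝ} (hH : H.CherryDense p μ)
    (hp0 : 0 < p) (hγ0 : 0 < γ) (hβ0 : 0 ≤ β) (hβ : β ≤ p ^ 2 * γ / 64) (hθ0 : 0 < θ)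
    (hμγ : μ ≤ p * γ / 8) (hμθ : μ ≤ p * θ / 8) (S : W → Prop)
    (hS : γ * Fintype.card W ≤ cnt S) :
    cnt (fun y => ¬ β * Fintype.card W ≤
      cnt (fun u => S u ∧ β * (Fintype.card W : ℝ) ^ (j + 1) ≤ H.codegree u y)) ≤
        θ * Fintype.card W := by
  classical
  by_contra hcon
  rw [not_le] at hcon
  set n : ℝ := (Fintype.card W : ℝ) with hn
  set Y : W → Prop := fun y => ¬ β * n ≤
      cnt (fun u => S u ∧ β * n ^ (j + 1) ≤ H.codegree u y) with hY
  have hYn : cnt Y ≤ n := cnt_le_card _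
  have hn0 : 0 < n := by
    rcases (Nat.cast_nonneg _ : (0 : ℝ) ≤ Fintype.card W).eq_or_lt with h | h
    · rw [← hn] at h
      rw [← h] at hcon hYn
      linarith
    · exact h
  have hnj : 0 < n ^ (j + 1) := by positivity
  have hY0 : 0 < cnt Y := lt_trans (by positivity) hcon
  have hS0 : 0 < cnt S := lt_of_lt_of_le (by positivity) hS
  have key : ∀ (Z : W → Prop) (ζ : ℝ), 0 < ζ → μ ≤ p * ζ / 8 → ζ * n ≤ cnt Z →
      cnt (fun T : Fin (j + 1) → W =>
        cnt (fun a => Z a ∧ H.IsEdge (insert a (Set.range T))) < p / 2 * cnt Z) ≤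
        n ^ (j + 1) / 4 := by
    intro Z ζ hζ hμ hZ
    have h1 := cnt_poor_tuples_mul_le (cherryDense_iff.1 hH) Z
    rw [← hn] at h1
    refine le_of_mul_le_mul_right (a := p / 2 * (ζ * n)) ?_ (by positivity)
    refine (mul_le_mul_of_nonneg_left (by gcongr) (cnt_nonneg _)).trans (h1.trans ?_)
    calc μ * n ^ (j + 2) ≤ p * ζ / 8 * n ^ (j + 2) := by gcongr
      _ = _ := by ring
  have hBS := key S γ hγ0 hμγ hS
  have hBY := key Y θ hθ0 hμθ hcon.le
  set B : (Fin (j + 1) → W) → Prop := fun T =>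
    cnt (fun a => S a ∧ H.IsEdge (insert a (Set.range T))) < p / 2 * cnt S ∨
    cnt (fun a => Y a ∧ H.IsEdge (insert a (Set.range T))) < p / 2 * cnt Y with hB
  have hBc : n ^ (j + 1) / 2 ≤ cnt (fun T => ¬ B T) := by
    have h1 := cnt_add_cnt_not B
    have h2 : cnt B ≤ _ := cnt_or_le _ _
    rw [Fintype.card_fun, Fintype.card_fin] at h1
    push_cast at h1
    rw [← hn] at h1
    linarith
  have h1 := mul_cnt_le_sum (f := fun T : Fin (j + 1) → W => cnt (fun q : W × W =>
      (S q.1 ∧ H.IsEdge (insert q.1 (Set.range T))) ∧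
      (Y q.2 ∧ H.IsEdge (insert q.2 (Set.range T)))))
    (t := p / 2 * cnt S * (p / 2 * cnt Y)) (P := fun T => ¬ B T) (fun T => cnt_nonneg _) (by
      intro T hT
      simp only [hB, not_or, not_lt] at hT
      rw [cnt_and_prod (fun u => S u ∧ H.IsEdge (insert u (Set.range T)))
        (fun y => Y y ∧ H.IsEdge (insert y (Set.range T)))]
      exact mul_le_mul hT.1 hT.2 (by positivity) (cnt_nonneg _))
  rw [sum_cnt_comm, Fintype.sum_prod_type_right] at h1
  have h2 : ∀ y, ∑ u, cnt (fun T : Fin (j + 1) → W =>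
      (S u ∧ H.IsEdge (insert u (Set.range T))) ∧ (Y y ∧ H.IsEdge (insert y (Set.range T)))) ≤
      if Y y then 2 * β * n ^ (j + 1) * n else 0 := by
    intro y
    split_ifs with hy
    · have h3 := sum_le_cnt_add (f := fun u => cnt (fun T : Fin (j + 1) → W =>
          (S u ∧ H.IsEdge (insert u (Set.range T))) ∧ (Y y ∧ H.IsEdge (insert y (Set.range T)))))
        (M := n ^ (j + 1)) (t := β * n ^ (j + 1))
        (P := fun u => S u ∧ β * n ^ (j + 1) ≤ H.codegree u y) (by positivity)
        (fun u _ => (cnt_le_card _).trans (by simp [hn])) (by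
          intro u hu
          by_cases hSu : S u
          · refine le_trans (cnt_mono fun T hT => ⟨hT.1.2, hT.2.2⟩)
              (not_le.1 fun h => hu ⟨hSu, h⟩).le
          · simp only [hSu, false_and, cnt_false]
            positivity)
      have h4 : cnt (fun u => S u ∧ β * n ^ (j + 1) ≤ H.codegree u y) ≤ β * n := (not_le.1 hy).le
      refine h3.trans ?_
      have := mul_le_mul_of_nonneg_left h4 hnj.le
      rw [← hn]
      linarith
    · simp [hy, cnt_false]
  have h3 := h1.trans (Finset.sum_le_sum fun y _ => h2 y)
  have h4 : (∑ y, if Y y then 2 * β * n ^ (j + 1) * n else 0) =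
      2 * β * n ^ (j + 1) * n * cnt Y := by
    rw [cnt_eq_sum, Finset.mul_sum]
    simp
  rw [h4] at h3
  have h5 : p / 2 * (γ * n) * (p / 2 * cnt Y) * (n ^ (j + 1) / 2) ≤
      p / 2 * cnt S * (p / 2 * cnt Y) * cnt (fun T => ¬ B T) := by gcongr
  have h6 : 2 * β * n ^ (j + 1) * n * cnt Y ≤
      2 * (p ^ 2 * γ / 64) * n ^ (j + 1) * n * cnt Y := by gcongr
  have h7 : 0 < p ^ 2 * γ * n * n ^ (j + 1) * cnt Y := by positivity
  linarith

/-- Copies rooted at the common link of `u` and `v` can be completed by either vertex. The factor n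
on the right reflects that one vertex of the copy is fixed to be `u`. -/
theorem exists_many_exchange [Fintype V] [DecidableEq V] {F : KGraph (j + 2) V}
    (hF : F ∈ cherryCOVER (j + 2) 1 V) {p β : ℝ}
    (hp0 : 0 < p) (hp1 : p < 1) (hβ0 : 0 < β) (hβ1 : β < 1) :
    ∃ (n₀ : ℕ) (c μ : ℝ), 0 < c ∧ 0 < μ ∧ ∀ (W : Type) [Fintype W] (H : KGraph (j + 2) W),
      H.CherryDense p μ → n₀ ≤ Fintype.card W → ∀ u v : W,
      β * (Fintype.card W : ℝ) ^ (j + 1) ≤ H.codegree u v →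
      c * (Fintype.card W : ℝ) ^ Fintype.card V ≤
        cnt (fun h : V → W => Exchange F H h u v) * Fintype.card W := by
  classical
  obtain ⟨n₀, c, μ, hc, hμ, h⟩ := exists_many_rooted hF hp0 hp1 hβ0 hβ1
  obtain ⟨N, hN⟩ := exists_nat_gt (4 * Fintype.card V / c)
  refine ⟨n₀ + N, c / 2, μ, by positivity, hμ, ?_⟩
  intro W _ H hH hn u v huv
  have hne : Nonempty W := ⟨u⟩
  obtain ⟨b, hb⟩ := h W H hH (by omega)
    (fun s => H.IsEdge (insert u s) ∧ H.IsEdge (insert v s)) huv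
  set n : ℝ := (Fintype.card W : ℝ) with hn'
  have hn0 : 0 < n := by rw [hn']; exact_mod_cast Fintype.card_pos
  have hNn : (N : ℝ) ≤ n := by rw [hn']; exact_mod_cast (by omega)
  set L : Set W → Prop := fun s => H.IsEdge (insert u s) ∧ H.IsEdge (insert v s) with hL
  have h1 := cnt_le_and_add (fun g : V → W => Rooted F H L b g)
    (fun g => ¬ ∃ i, g i = u ∨ g i = v)
  simp only [not_not] at h1
  have h2 := cnt_hits_mul_le (I := V) (fun w : W => w = u ∨ w = v)
  have h3 : cnt (fun w : W => w = u ∨ w = v) ≤ 2 := by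
    refine (cnt_or_le _ _).trans (le_of_eq ?_)
    rw [cnt_eq_self, cnt_eq_self]; norm_num
  have h4 : cnt (fun g : V → W => ∃ i, g i = u ∨ g i = v) ≤ c / 2 * n ^ Fintype.card V := by
    refine le_of_mul_le_mul_right (h2.trans ?_) hn0
    have h5 := (div_lt_iff₀ hc).1 hN
    have h6 : (Fintype.card V : ℝ) * cnt (fun w : W => w = u ∨ w = v) ≤ c / 2 * n := by
      have : (0 : ℝ) ≤ Fintype.card V := Nat.cast_nonneg _
      nlinarith
    calc _ ≤ c / 2 * n * n ^ Fintype.card V := by gcongr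
      _ = _ := by ring
  have h5 : cnt (fun g : V → W => Rooted F H L b g ∧ ¬ ∃ i, g i = u ∨ g i = v) ≤
      n * cnt (fun h : V → W => Exchange F H h u v) := by
    refine cnt_le_mul_of_fiber (fun g => update g b u) ?_ ?_
    · rintro g ⟨hg, hg'⟩
      push Not at hg'
      refine ⟨b, update_self .., ?_, ?_⟩
      · exact hg.isCopy_update (fun i => (hg' i).1) (fun s hs => hs.1)
      · rw [update_idem]
        exact hg.isCopy_update (fun i => (hg' i).2) (fun s hs => hs.2)
    -- Setting the root to `u` forgets only the value of `g` at `b`, so each fibre has at most n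
    -- members.
    · intro h _
      rw [hn', ← cnt_true (α := W)]
      refine cnt_le_of_injOn (fun g => g b) (fun _ _ => trivial) ?_
      rintro g g' ⟨-, hg⟩ ⟨-, hg'⟩ hgg
      funext i
      by_cases hi : i = b
      · rw [hi]; exact hgg
      · have := congrFun (hg.trans hg'.symm) i
        rwa [update_of_ne hi, update_of_ne hi] at this
  linarith

end KGraph

theorem cnt_le_card_of_surj {α B : Type*} [Fintype α] [Fintype B] {P : α → Prop} (g : B → α)
    (h : ∀ a, P a → ∃ b, g b = a) : cnt P ≤ Fintype.card B := by
  classical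
  rcases isEmpty_or_nonempty B with hB | hB
  · rw [← cnt_true (α := B)]
    have : cnt P ≤ cnt (fun _ : α => False) := cnt_mono fun a ha => hB.elim (h a ha).choose
    rw [cnt_false] at this
    exact this.trans (cnt_nonneg _)
  choose! f hf using h
  rw [← cnt_true (α := B)]
  refine cnt_le_of_injOn f (fun _ _ => trivial) fun a a' ha ha' haa => ?_
  rw [← hf a ha, ← hf a' ha', haa]

/-! ### Counting absorbers. -/

namespace KGraph

variable {k j : ℕ} {V : Type*} [Fintype V] [DecidableEq V] {W : Type} [Fintype W]

/-- The pairs of disjoint copies through which `y` can be exchanged for `t`. -/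
def Link (F : KGraph k V) (H : KGraph k W) (t y : W) (q : (V → W) × (V → W)) : Prop :=
  ∃ u, Exchange F H q.1 u t ∧ Exchange F H q.2 y u

/-- The intermediate vertex `u` lies on the first copy, so a given pair arises from at most v(F)
choices of `u`. -/
theorem sum_exchange_mul_le (F : KGraph k V) (H : KGraph k W) (t y : W) :
    ∑ u, cnt (fun h => Exchange F H h u t) * cnt (fun h => Exchange F H h y u) ≤
      Fintype.card V * cnt (Link F H t y) := by
  classical
  simp only [← cnt_and_prod]
  rw [sum_cnt_comm, cnt_eq_sum (Link F H t y), Finset.mul_sum]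
  refine Finset.sum_le_sum fun q _ => ?_
  split_ifs with hq
  · rw [mul_one]
    exact cnt_le_card_of_surj q.1 fun u hu => by
      obtain ⟨⟨b, hb, -⟩, -⟩ := hu
      exact ⟨b, hb⟩
  · rw [mul_zero, ← cnt_false (α := W)]
    exact cnt_mono fun u hu => hq ⟨u, hu⟩

/-- Each `y i` lies on the second copy of `Q i`, so a given `Q` arises from at most f^f choices of
`y`, where f = v(F). -/
theorem sum_copies_le (F : KGraph k V) (H : KGraph k W) (T : V → W) :
    ∑ y : V → W, cnt (fun Q : V → (V → W) × (V → W) =>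
      IsCopy F H y ∧ ∀ i, Link F H (T i) (y i) (Q i)) ≤
    (Fintype.card V : ℝ) ^ Fintype.card V * cnt (fun Q : V → (V → W) × (V → W) =>
      ∃ y, IsCopy F H y ∧ ∀ i, Link F H (T i) (y i) (Q i)) := by
  classical
  rw [sum_cnt_comm, cnt_eq_sum (fun Q : V → (V → W) × (V → W) =>
      ∃ y, IsCopy F H y ∧ ∀ i, Link F H (T i) (y i) (Q i)), Finset.mul_sum]
  refine Finset.sum_le_sum fun Q _ => ?_
  split_ifs with hq
  · refine (cnt_le_card_of_surj (fun (b : V → V) i => (Q i).2 (b i)) fun y hy => ?_).trans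
      (le_of_eq (by simp))
    choose u _ b hb using fun i => hy.2 i
    exact ⟨b, funext fun i => (hb i).1⟩
  · rw [mul_zero, ← cnt_false (α := V → W)]
    exact cnt_mono fun y hy => hq ⟨y, hy⟩

/-- Exchanging `w` for itself just says that the copy passes through `w`; each copy is counted at
most v(F) times. -/
theorem le_cnt_isCopy {F : KGraph k V} {H : KGraph k W} {c : ℝ} [Nonempty W]
    (h : ∀ w, c ≤ cnt (fun h : V → W => Exchange F H h w w) * Fintype.card W) :
    c ≤ Fintype.card V * cnt (IsCopy F H (V := V)) := by
  classical
  have hn : (0 : ℝ) < Fintype.card W := by exact_mod_cast Fintype.card_pos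
  have h1 : ∑ w, cnt (fun h : V → W => Exchange F H h w w) ≤
      Fintype.card V * cnt (IsCopy F H (V := V)) := by
    rw [sum_cnt_comm, cnt_eq_sum (IsCopy F H (V := V)), Finset.mul_sum]
    refine Finset.sum_le_sum fun h _ => ?_
    split_ifs with hh
    · rw [mul_one]
      exact cnt_le_card_of_surj h fun w ⟨b, hb, _⟩ => ⟨b, hb⟩
    · rw [mul_zero, ← cnt_false (α := W)]
      exact cnt_mono fun w ⟨_, _, hc, _⟩ => hh hc
  have h2 := Finset.sum_le_sum fun w (_ : w ∈ Finset.univ) => h w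
  rw [Finset.sum_const, Finset.card_univ, nsmul_eq_mul, ← Finset.sum_mul, mul_comm] at h2
  exact (le_of_mul_le_mul_right h2 hn).trans h1

/-- The tuple `A`, made of two copies `A (i, inl ·)` and `A (i, inr ·)` of `F` for every vertex `i`
of `F`, can absorb the vertices `T i`. -/
def Absorbs (F : KGraph k V) (H : KGraph k W) (A : V × (V ⊕ V) → W) (T : V → W) : Prop :=
  Injective A ∧ (∀ i b, A i ≠ T b) ∧ ∃ y, IsCopy F H y ∧
    ∀ i, Link F H (T i) (y i) (fun b => A (i, Sum.inl b), fun b => A (i, Sum.inr b))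

theorem exists_many_linked [Nonempty V] {F : KGraph (j + 2) V}
    (hF : F ∈ cherryCOVER (j + 2) 1 V) {p α : ℝ}
    (hp0 : 0 < p) (hp1 : p < 1) (hα0 : 0 < α) (hα1 : α < 1) :
    ∃ (n₀ : ℕ) (c μ : ℝ), 0 < c ∧ 0 < μ ∧ ∀ (W : Type) [Fintype W] (H : KGraph (j + 2) W),
      H.CherryDense p μ → n₀ ≤ Fintype.card W →
      (∀ w, α * (Fintype.card W : ℝ) ^ (j + 1) ≤ H.tupleDegree w) → ∀ T : V → W,
      c * (Fintype.card W : ℝ) ^ (2 * Fintype.card V * Fintype.card V) ≤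
        cnt (fun Q : V → (V → W) × (V → W) =>
          ∃ y, IsCopy F H y ∧ ∀ i, Link F H (T i) (y i) (Q i)) := by
  obtain ⟨n₁, c₁, μ₁, hc₁, hμ₁, h₁⟩ := exists_many_exchange hF hp0 hp1 hα0 hα1
  set f : ℝ := (Fintype.card V : ℝ) with hf
  have hf0 : 0 < f := by rw [hf]; exact_mod_cast Fintype.card_pos
  -- Copies of F have density at least c₁/f. A bad vertex at one of the f positions spoils at most
  -- an fθ proportion of tuples, which is half of that.
  set θ : ℝ := c₁ / f / (2 * f) with hθ
  have hθ0 : 0 < θ := by positivity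
  set γ : ℝ := α * p / 8 with hγ
  have hγ0 : 0 < γ := by positivity
  set β : ℝ := p ^ 2 * γ / 64 with hβ
  have hβ0 : 0 < β := by positivity
  have hp2 : p ^ 2 ≤ 1 := pow_le_one₀ hp0.le hp1.le
  have hβγ : β ≤ γ := by nlinarith
  have hγ1 : γ < 1 := by nlinarith
  obtain ⟨n₂, c₂, μ₂, hc₂, hμ₂, h₂⟩ := exists_many_exchange hF hp0 hp1 hβ0 (hβγ.trans_lt hγ1)
  set m₁ : ℝ := β * c₂ ^ 2 / f with hm₁
  have hm₁0 : 0 < m₁ := by positivity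
  refine ⟨n₁ + n₂ + 1, c₁ / f / 2 * m₁ ^ Fintype.card V / f ^ Fintype.card V,
    min (min μ₁ μ₂) (min (α * p / 4) (min (p * γ / 8) (p * θ / 8))), by positivity, by positivity,
    ?_⟩
  intro W _ H hH hn hdeg T
  have hne : Nonempty W := Fintype.card_pos_iff.1 (by omega)
  set n : ℝ := (Fintype.card W : ℝ) with hn'
  have hn0 : 0 < n := by rw [hn']; exact_mod_cast Fintype.card_pos
  set μ := min (min μ₁ μ₂) (min (α * p / 4) (min (p * γ / 8) (p * θ / 8))) with hμ
  have hμa : μ ≤ μ₁ := (min_le_left _ _).trans (min_le_left _ _)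
  have hμb : μ ≤ μ₂ := (min_le_left _ _).trans (min_le_right _ _)
  have hμc : μ ≤ α * p / 4 := (min_le_right _ _).trans (min_le_left _ _)
  have hμd : μ ≤ p * γ / 8 := (min_le_right _ _).trans ((min_le_right _ _).trans (min_le_left _ _))
  have hμe : μ ≤ p * θ / 8 :=
    (min_le_right _ _).trans ((min_le_right _ _).trans (min_le_right _ _))
  set N : W → W → Prop := fun t u => β * n ^ (j + 1) ≤ H.codegree t u with hN
  set good : W → W → Prop := fun t y => β * n ≤ cnt (fun u => N t u ∧ N u y) with hgood
  have hbad : ∀ t, cnt (fun y => ¬ good t y) ≤ θ * n := fun t =>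
    cnt_unlinked_le hH hp0 hγ0 hβ0.le le_rfl hθ0 hμd hμe (N t)
      (le_cnt_neighbors hH hp0 hβ0.le hβγ hμc (hdeg t))
  have hlink : ∀ t y, good t y → m₁ * n ^ (2 * Fintype.card V) / n ≤ cnt (Link F H t y) := by
    intro t y hty
    have h3 := sum_exchange_mul_le F H t y
    rw [← hf] at h3
    have h4 := mul_cnt_le_sum
      (f := fun u => cnt (fun h => Exchange F H h u t) * cnt (fun h => Exchange F H h y u))
      (t := (c₂ * n ^ Fintype.card V / n) * (c₂ * n ^ Fintype.card V / n))
      (P := fun u => N t u ∧ N u y)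
      (fun u => mul_nonneg (cnt_nonneg _) (cnt_nonneg _)) (by
        rintro u ⟨htu, huy⟩
        have h5 := h₂ W H (hH.mono hμb) (by omega) u t (by rw [codegree_comm]; exact htu)
        have h6 := h₂ W H (hH.mono hμb) (by omega) y u (by rw [codegree_comm]; exact huy)
        rw [← hn', ← div_le_iff₀ hn0] at h5 h6
        exact mul_le_mul h5 h6 (by positivity) (cnt_nonneg _))
    have h5 := mul_le_mul_of_nonneg_left hty
      (by positivity : 0 ≤ (c₂ * n ^ Fintype.card V / n) * (c₂ * n ^ Fintype.card V / n))
    have h6 := h5.trans (h4.trans h3)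
    rw [hm₁]
    refine le_of_mul_le_mul_left ((le_of_eq ?_).trans h6) hf0
    rw [two_mul, pow_add]
    field_simp
  have hcopies : c₁ / f * n ^ Fintype.card V ≤ cnt (IsCopy F H (V := V)) := by
    have h3 := le_cnt_isCopy (F := F) (H := H) (c := c₁ * n ^ Fintype.card V) fun w =>
      h₁ W H (hH.mono hμa) (by omega) w w (by rw [codegree_self]; exact hdeg w)
    rw [div_mul_eq_mul_div, div_le_iff₀ hf0]
    linarith
  have hgoodcopies : c₁ / f / 2 * n ^ Fintype.card V ≤
      cnt (fun y : V → W => IsCopy F H y ∧ ¬ ∃ i, ¬ good (T i) (y i)) := by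
    have h3 := cnt_le_and_add (IsCopy F H (V := V)) (fun y => ¬ ∃ i, ¬ good (T i) (y i))
    simp only [not_not] at h3
    have h4 := cnt_exists_le (fun (i : V) (y : V → W) => ¬ good (T i) (y i))
    have h5 : ∀ i, cnt (fun y : V → W => ¬ good (T i) (y i)) ≤ θ * n ^ Fintype.card V := by
      intro i
      have h6 := cnt_apply_mul (fun w => ¬ good (T i) w) i
      rw [← hn'] at h6
      refine le_of_mul_le_mul_right ?_ hn0
      rw [h6]
      have := mul_le_mul_of_nonneg_left (hbad (T i)) (by positivity : 0 ≤ n ^ Fintype.card V)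
      linarith
    have h6 := h4.trans (Finset.sum_le_sum fun i _ => h5 i)
    rw [Finset.sum_const, Finset.card_univ, nsmul_eq_mul, ← hf] at h6
    have h7 : f * (θ * n ^ Fintype.card V) = c₁ / f / 2 * n ^ Fintype.card V := by
      rw [hθ]; field_simp
    linarith
  have h3 := sum_copies_le F H T
  rw [← hf] at h3
  have h4 := mul_cnt_le_sum (f := fun y : V → W => cnt (fun Q : V → (V → W) × (V → W) =>
      IsCopy F H y ∧ ∀ i, Link F H (T i) (y i) (Q i)))
    (t := (m₁ * n ^ (2 * Fintype.card V) / n) ^ Fintype.card V)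
    (P := fun y : V → W => IsCopy F H y ∧ ¬ ∃ i, ¬ good (T i) (y i))
    (fun y => cnt_nonneg _) (by
      rintro y ⟨hy, hy'⟩
      push Not at hy'
      simp only [hy, true_and]
      rw [cnt_forall_prod (fun i => Link F H (T i) (y i))]
      calc _ = ∏ _i : V, (m₁ * n ^ (2 * Fintype.card V) / n) := by
            rw [Finset.prod_const, Finset.card_univ]
        _ ≤ _ := Finset.prod_le_prod (fun i _ => by positivity) fun i _ => hlink _ _ (hy' i))
  have h5 := mul_le_mul_of_nonneg_left hgoodcopies
    (by positivity : 0 ≤ (m₁ * n ^ (2 * Fintype.card V) / n) ^ Fintype.card V)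
  have h6 := h5.trans (h4.trans h3)
  rw [div_mul_eq_mul_div, div_le_iff₀ (by positivity), mul_comm _ (f ^ _)]
  refine le_trans (le_of_eq ?_) h6
  clear_value m₁ f n
  rw [div_pow, mul_pow, ← pow_mul]
  field_simp

/-- Only an O(1/n) proportion of the linked configurations is lost by requiring distinct vertices
that avoid `T`. -/
theorem exists_many_absorbers [Nonempty V] {F : KGraph (j + 2) V}
    (hF : F ∈ cherryCOVER (j + 2) 1 V) {p α : ℝ}
    (hp0 : 0 < p) (hp1 : p < 1) (hα0 : 0 < α) (hα1 : α < 1) :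
    ∃ (n₀ : ℕ) (c μ : ℝ), 0 < c ∧ 0 < μ ∧ ∀ (W : Type) [Fintype W] (H : KGraph (j + 2) W),
      H.CherryDense p μ → n₀ ≤ Fintype.card W →
      (∀ w, α * (Fintype.card W : ℝ) ^ (j + 1) ≤ H.tupleDegree w) → ∀ T : V → W,
      c * (Fintype.card W : ℝ) ^ Fintype.card (V × (V ⊕ V)) ≤
        cnt (fun A => Absorbs F H A T) := by
  classical
  obtain ⟨n₀, c, μ, hc, hμ, h⟩ := exists_many_linked hF hp0 hp1 hα0 hα1
  set I := V × (V ⊕ V) with hI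
  set i : ℝ := (Fintype.card I : ℝ) with hi
  set f : ℝ := (Fintype.card V : ℝ) with hf
  obtain ⟨N, hN⟩ := exists_nat_gt ((i ^ 2 + i * f) / (c / 2))
  refine ⟨n₀ + N + 1, c / 2, μ, by positivity, hμ, ?_⟩
  intro W _ H hH hn hdeg T
  have h0 := h W H hH (by omega) hdeg T
  have hne : Nonempty W := Fintype.card_pos_iff.1 (by omega)
  set n : ℝ := (Fintype.card W : ℝ) with hn'
  have hn0 : 0 < n := by rw [hn']; exact_mod_cast Fintype.card_pos
  have hNn : (N : ℝ) ≤ n := by rw [hn']; exact_mod_cast (by omega)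
  set E : (I → W) → Prop := fun A => ∃ y, IsCopy F H y ∧
    ∀ i, Link F H (T i) (y i) (fun b => A (i, Sum.inl b), fun b => A (i, Sum.inr b)) with hE
  have h1 : cnt E = cnt (fun Q : V → (V → W) × (V → W) =>
          ∃ y, IsCopy F H y ∧ ∀ i, Link F H (T i) (y i) (Q i)) := by
    rw [← cnt_equiv ((Equiv.curry V (V ⊕ V) W).trans
      (Equiv.piCongrRight fun _ => Equiv.sumArrowEquivProdArrow V V W))]
    rfl
  have hcardI : Fintype.card I = 2 * Fintype.card V * Fintype.card V := by
    simp [hI]; ring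
  rw [← h1, ← hcardI] at h0
  have h2 := cnt_le_and_add E (fun A => Injective A)
  have h3 := cnt_le_and_add (fun A => E A ∧ Injective A) (fun A => ¬ ∃ i, ∃ b, A i = T b)
  simp only [not_not] at h3
  have h4 := cnt_not_injective_mul_le (I := I) (W := W)
  have h5 := cnt_hits_mul_le (I := I) (fun w : W => ∃ b, w = T b)
  have h6 : cnt (fun w : W => ∃ b, w = T b) ≤ f :=
    cnt_le_card_of_surj T fun w ⟨b, hb⟩ => ⟨b, hb.symm⟩
  rw [← hn'] at h4 h5
  have h7 : cnt (fun A : I → W => ¬ Injective A) + cnt (fun A : I → W => ∃ i, ∃ b, A i = T b) ≤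
      c / 2 * n ^ Fintype.card I := by
    refine le_of_mul_le_mul_right ?_ hn0
    have h8 := (div_lt_iff₀ (by positivity)).1 hN
    have h9 : i ^ 2 + i * f ≤ c / 2 * n := by
      have : (N : ℝ) * (c / 2) ≤ n * (c / 2) := by gcongr
      linarith
    have h10 : i * cnt (fun w : W => ∃ b, w = T b) * n ^ Fintype.card I ≤
        i * f * n ^ Fintype.card I := by gcongr
    have h11 := mul_le_mul_of_nonneg_right h9 (by positivity : 0 ≤ n ^ Fintype.card I)
    rw [add_mul]
    linarith
  have h8 : cnt (fun A : I → W => (E A ∧ Injective A) ∧ ¬ ∃ i, ∃ b, A i = T b) ≤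
      cnt (fun A => Absorbs F H A T) := by
    refine cnt_mono fun A hA => ⟨hA.1.2, fun i b hib => hA.2 ⟨i, b, hib⟩, hA.1.1⟩
  linarith

end KGraph

/-! ### A disjoint absorbing family, chosen without randomness. -/

section

open Filter Topology

section Greedy

variable {I τ W : Type*} [Fintype I] [DecidableEq I] [Fintype τ] [Fintype W]

open scoped Classical in
-- The potential is the sum over T of 2^(-number of chosen tuples related to T). Averaged over the
-- tuples disjoint from those already chosen, the next choice multiplies it by at most 1 - c/4, so
-- some choice does.
theorem exists_disjoint_family [Nonempty I] [Nonempty τ] (R : (I → W) → τ → Prop) {c : ℝ}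
    (hc0 : 0 < c) (hc1 : c ≤ 1)
    (hR : ∀ T, c * (Fintype.card W : ℝ) ^ Fintype.card I ≤ cnt (fun A => R A T)) (d : ℕ)
    (hd : d * (Fintype.card I : ℝ) ^ 2 ≤ c / 2 * Fintype.card W) :
    ∃ 𝒜 : Finset (I → W), 𝒜.card ≤ d ∧
      (∀ A ∈ 𝒜, ∀ B ∈ 𝒜, A ≠ B → Disjoint (Set.range A) (Set.range B)) ∧
      ∑ T, (1 / 2 : ℝ) ^ (𝒜.filter (fun A => R A T)).card ≤
        Fintype.card τ * (1 - c / 4) ^ d := by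
  set n : ℝ := (Fintype.card W : ℝ) with hn
  set M : ℝ := (Fintype.card I : ℝ) with hM
  have hM0 : 0 < M := by rw [hM]; exact_mod_cast Fintype.card_pos
  induction d with
  | zero => exact ⟨∅, by simp⟩
  | succ d ih =>
    push_cast at hd
    have hM2 : 0 < M ^ 2 := by positivity
    have hn0 : 0 < n := by
      by_contra! h
      have : (0 : ℝ) ≤ d * M ^ 2 := by positivity
      nlinarith
    obtain ⟨𝒜, hcard, hdisj, hpot⟩ := ih (by nlinarith)
    set w : τ → ℝ := fun T => (1 / 2 : ℝ) ^ (𝒜.filter (fun A => R A T)).card with hw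
    have hw0 : ∀ T, 0 < w T := fun T => by simp only [hw]; positivity
    set U : W → Prop := fun x => ∃ q : 𝒜 × I, q.1.1 q.2 = x with hU
    have hUc : cnt U ≤ d * M := by
      refine (cnt_le_card_of_surj (fun q : 𝒜 × I => q.1.1 q.2) fun x hx => hx).trans ?_
      rw [Fintype.card_prod, Fintype.card_coe]
      push_cast
      gcongr
    -- By `hd` the vertices already in use meet at most half of the guaranteed tuples for any T.
    have hhit : cnt (fun A : I → W => ∃ i, U (A i)) ≤ c / 2 * n ^ Fintype.card I := by
      have h1 := cnt_hits_mul_le (I := I) U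
      refine le_of_mul_le_mul_right (h1.trans ?_) hn0
      rw [← hn, ← hM]
      have h2 : M * cnt U ≤ c / 2 * n := by
        have := mul_le_mul_of_nonneg_left hUc hM0.le
        nlinarith
      have := mul_le_mul_of_nonneg_right h2 (by positivity : 0 ≤ n ^ Fintype.card I)
      linarith
    set D : Finset (I → W) := Finset.univ.filter (fun A => ¬ ∃ i, U (A i)) with hD
    have hDR : ∀ T, c / 2 * n ^ Fintype.card I ≤ ((D.filter (fun A => R A T)).card : ℝ) := by
      intro T
      have h1 := cnt_le_and_add (fun A => R A T) (fun A => ¬ ∃ i, U (A i))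
      simp only [not_not] at h1
      have h2 : cnt (fun A => R A T ∧ ¬ ∃ i, U (A i)) = ((D.filter (fun A => R A T)).card : ℝ) := by
        rw [cnt_eq_card, hD, Finset.filter_filter]
        congr 2
        ext A
        simp only [Finset.mem_filter, and_comm]
      have := hR T
      linarith
    have hDn : (D.card : ℝ) ≤ n ^ Fintype.card I := by
      have h1 : (D.card : ℝ) ≤ Fintype.card (I → W) := by exact_mod_cast Finset.card_le_univ D
      exact h1.trans (by simp [hn])
    have hDne : D.Nonempty := by
      obtain ⟨T⟩ := (inferInstance : Nonempty τ)
      have h1 := hDR T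
      have h2 : 0 < c / 2 * n ^ Fintype.card I := by positivity
      have h3 : 0 < (D.filter (fun A => R A T)).card := by exact_mod_cast h2.trans_le h1
      exact (Finset.card_pos.1 h3).mono (Finset.filter_subset _ _)
    have hsum : ∑ A ∈ D, ∑ T, w T * (if R A T then (1 / 2 : ℝ) else 1) ≤
        ∑ _A ∈ D, (1 - c / 4) * ∑ T, w T := by
      rw [Finset.sum_comm, Finset.sum_const, nsmul_eq_mul, Finset.mul_sum, Finset.mul_sum]
      refine Finset.sum_le_sum fun T _ => ?_
      rw [← Finset.mul_sum]
      have h1 : ∑ A ∈ D, (if R A T then (1 / 2 : ℝ) else 1) =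
          D.card - 1 / 2 * (D.filter (fun A => R A T)).card := by
        have : ∀ A ∈ D, (if R A T then (1 / 2 : ℝ) else 1) =
            1 - 1 / 2 * (if R A T then 1 else 0) := by
          intro A _
          split_ifs <;> norm_num
        rw [Finset.sum_congr rfl this, Finset.sum_sub_distrib, ← Finset.mul_sum,
          Finset.sum_boole]
        simp
      rw [h1]
      have h2 := hDR T
      have h3 : c / 4 * D.card ≤ c / 4 * n ^ Fintype.card I := by gcongr
      have h4 : (D.card : ℝ) - 1 / 2 * (D.filter (fun A => R A T)).card ≤
        D.card * (1 - c / 4) := by linarith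
      calc _ ≤ w T * (D.card * (1 - c / 4)) := mul_le_mul_of_nonneg_left h4 (hw0 T).le
        _ = _ := by ring
    obtain ⟨A, hA, hAle⟩ := Finset.exists_le_of_sum_le hDne hsum
    have hAU : ∀ i, ¬ U (A i) := by
      simp only [hD, Finset.mem_filter, Finset.mem_univ, true_and] at hA
      intro i hi
      exact hA ⟨i, hi⟩
    have hAB : ∀ B ∈ 𝒜, Disjoint (Set.range A) (Set.range B) := by
      intro B hB
      rw [Set.disjoint_left]
      rintro _ ⟨i, rfl⟩ ⟨i', hi'⟩
      exact hAU i ⟨(⟨B, hB⟩, i'), hi'⟩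
    have hA𝒜 : A ∉ 𝒜 := by
      intro h
      obtain ⟨i⟩ := (inferInstance : Nonempty I)
      exact hAU i ⟨(⟨A, h⟩, i), rfl⟩
    refine ⟨insert A 𝒜, ?_, ?_, ?_⟩
    · rw [Finset.card_insert_of_notMem hA𝒜]; omega
    · intro B hB C hC hBC
      rw [Finset.mem_insert] at hB hC
      rcases hB with rfl | hB <;> rcases hC with rfl | hC
      · exact absurd rfl hBC
      · exact hAB C hC
      · exact (hAB B hB).symm
      · exact hdisj B hB C hC hBC
    · have h1 : ∀ T, (1 / 2 : ℝ) ^ ((insert A 𝒜).filter (fun A => R A T)).card =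
          w T * (if R A T then (1 / 2 : ℝ) else 1) := by
        intro T
        rw [Finset.filter_insert]
        split_ifs with h
        · rw [Finset.card_insert_of_notMem (by simp [hA𝒜]), pow_succ]
        · rw [mul_one]
      rw [Finset.sum_congr rfl fun T _ => h1 T]
      refine hAle.trans ?_
      calc _ ≤ (1 - c / 4) * (Fintype.card τ * (1 - c / 4) ^ d) :=
            mul_le_mul_of_nonneg_left hpot (by linarith)
        _ = _ := by ring

theorem eventually_pow_mul_exp_lt (f : ℕ) {b C : ℝ} (hb : 0 < b) (hC : 0 < C) :
    ∀ᶠ n : ℕ in atTop, (n : ℝ) ^ f * C * Real.exp (-(b * n)) < 1 := by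
  have h1 := (Real.tendsto_pow_mul_exp_neg_atTop_nhds_zero f).comp
    ((tendsto_natCast_atTop_atTop (R := ℝ)).const_mul_atTop hb)
  filter_upwards [h1.eventually_lt_const (show (0 : ℝ) < b ^ f / C by positivity)] with n hn
  simp only [comp_apply] at hn
  rw [lt_div_iff₀ hC, mul_pow] at hn
  have hbf : 0 < b ^ f := by positivity
  refine lt_of_mul_lt_mul_left ?_ hbf.le
  linarith

open scoped Classical in
-- There are only polynomially many T, while the potential decays like e^(-2ξn) up to a constant. A
-- T with fewer than ξn chosen tuples would alone contribute at least e^(-ξn), which is impossible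
-- for large n.
theorem exists_absorbing_family (I V : Type*) [Fintype I] [DecidableEq I] [Nonempty I] [Fintype V]
    {c : ℝ} (hc0 : 0 < c) :
    ∃ (ξ : ℝ) (N : ℕ), 0 < ξ ∧ ∀ (W : Type) [Fintype W], N ≤ Fintype.card W →
      ∀ R : (I → W) → (V → W) → Prop,
      (∀ T, c * (Fintype.card W : ℝ) ^ Fintype.card I ≤ cnt (fun A => R A T)) →
      ∃ 𝒜 : Finset (I → W),
        (∀ A ∈ 𝒜, ∀ B ∈ 𝒜, A ≠ B → Disjoint (Set.range A) (Set.range B)) ∧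
        ∀ T, ξ * Fintype.card W ≤ ((𝒜.filter (fun A => R A T)).card : ℝ) := by
  set c' := min c 1 with hc'
  have hc'0 : 0 < c' := lt_min hc0 one_pos
  have hc'1 : c' ≤ 1 := min_le_right _ _
  set M : ℝ := (Fintype.card I : ℝ) with hM
  have hM0 : 0 < M := by rw [hM]; exact_mod_cast Fintype.card_pos
  set ξ : ℝ := c' ^ 2 / (16 * M ^ 2) with hξ
  have hξ0 : 0 < ξ := by positivity
  obtain ⟨N, hN⟩ := eventually_atTop.1
    (eventually_pow_mul_exp_lt (Fintype.card V) hξ0 (Real.exp_pos (c' / 4)))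
  refine ⟨ξ, N + 1, hξ0, ?_⟩
  intro W _ hW R hR
  have hne : Nonempty W := Fintype.card_pos_iff.1 (by omega)
  have hlt := hN (Fintype.card W) (by omega)
  set n : ℝ := (Fintype.card W : ℝ) with hn
  have hn0 : 0 < n := by rw [hn]; exact_mod_cast Fintype.card_pos
  set d : ℕ := ⌊c' * n / (2 * M ^ 2)⌋₊ with hd
  have hd1 : (d : ℝ) ≤ c' * n / (2 * M ^ 2) := Nat.floor_le (by positivity)
  have hd2 : c' * n / (2 * M ^ 2) < d + 1 := Nat.lt_floor_add_one _
  have hne : Nonempty (V → W) := inferInstance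
  obtain ⟨𝒜, -, hdisj, hpot⟩ := exists_disjoint_family R hc'0 hc'1 (fun T =>
    (mul_le_mul_of_nonneg_right (min_le_left _ _) (by positivity)).trans (hR T)) d (by
      rw [le_div_iff₀ (by positivity)] at hd1
      rw [← hM, ← hn]
      linarith)
  refine ⟨𝒜, hdisj, fun T => ?_⟩
  by_contra! hcon
  set X := (𝒜.filter (fun A => R A T)).card with hX
  have h1 : (1 / 2 : ℝ) ^ X ≤ Fintype.card (V → W) * (1 - c' / 4) ^ d :=
    le_trans (Finset.single_le_sum
      (f := fun T => (1 / 2 : ℝ) ^ (𝒜.filter (fun A => R A T)).card)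
      (fun T _ => by positivity) (Finset.mem_univ T)) hpot
  have h2 : Real.exp (-(ξ * n)) ≤ (1 / 2 : ℝ) ^ X := by
    have h3 : Real.exp (-1) ≤ 1 / 2 := by
      rw [Real.exp_neg, one_div]
      refine inv_anti₀ (by norm_num) ?_
      have := Real.add_one_le_exp (1 : ℝ)
      linarith
    have h4 : Real.exp (-(ξ * n)) ≤ Real.exp (-(X : ℝ)) := Real.exp_le_exp.2 (by linarith)
    have h5 : (Real.exp (-1)) ^ X = Real.exp (-(X : ℝ)) := by
      rw [← Real.exp_nat_mul]; congr 1; ring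
    exact h4.trans (h5 ▸ pow_le_pow_left₀ (Real.exp_pos _).le h3 X)
  have h3 : (1 - c' / 4) ^ d ≤ Real.exp (c' / 4) * Real.exp (-(2 * ξ * n)) := by
    have h4 : 1 - c' / 4 ≤ Real.exp (-(c' / 4)) := by
      have := Real.add_one_le_exp (-(c' / 4))
      linarith
    calc (1 - c' / 4) ^ d ≤ Real.exp (-(c' / 4)) ^ d := pow_le_pow_left₀ (by linarith) h4 d
      _ = Real.exp (d * -(c' / 4)) := (Real.exp_nat_mul _ _).symm
      _ ≤ Real.exp (c' / 4 + -(2 * ξ * n)) := by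
        refine Real.exp_le_exp.2 ?_
        have h5 : 2 * ξ * n = c' / 4 * (c' * n / (2 * M ^ 2)) := by
          rw [hξ]; field_simp; ring
        rw [h5]
        nlinarith
      _ = _ := Real.exp_add _ _
  have h4 : (Fintype.card (V → W) : ℝ) = n ^ Fintype.card V := by simp [hn]
  rw [h4] at h1
  have h5 : Real.exp (-(2 * ξ * n)) = Real.exp (-(ξ * n)) * Real.exp (-(ξ * n)) := by
    rw [← Real.exp_add]; congr 1; ring
  have h6 : n ^ Fintype.card V * (1 - c' / 4) ^ d ≤
      (n ^ Fintype.card V * Real.exp (c' / 4) * Real.exp (-(ξ * n))) * Real.exp (-(ξ * n)) := by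
    rw [h5] at h3
    have := mul_le_mul_of_nonneg_left h3 (by positivity : 0 ≤ n ^ Fintype.card V)
    linarith
  have h7 := Real.exp_pos (-(ξ * n))
  have h8 := mul_lt_mul_of_pos_right hlt h7
  linarith

end Greedy

end

/-! ### Tilings: absorption and almost perfect tilings. -/

namespace KGraph

variable {k j : ℕ} {V : Type*} {W : Type}

/-- The set `S` is the disjoint union of the vertex sets of copies of `F`. -/
def Tileable (F : KGraph k V) (H : KGraph k W) (S : Set W) : Prop :=
  ∃ C : Set (V → W), (∀ g ∈ C, IsCopy F H g) ∧ C.PairwiseDisjoint Set.range ∧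
    ⋃ g ∈ C, Set.range g = S

theorem IsCopy.tileable_range {F : KGraph k V} {H : KGraph k W} {g : V → W} (hg : IsCopy F H g) :
    Tileable F H (Set.range g) :=
  ⟨{g}, by simpa using hg, by simp, by simp⟩

theorem tileable_empty (F : KGraph k V) (H : KGraph k W) : Tileable F H ∅ :=
  ⟨∅, by simp, by simp, by simp⟩

theorem tileable_iUnion {ι : Type*} {F : KGraph k V} {H : KGraph k W} {S : ι → Set W}
    (h : ∀ i, Tileable F H (S i)) (hd : Pairwise (Disjoint on S)) : Tileable F H (⋃ i, S i) := by
  choose C hC hCd hCS using h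
  refine ⟨⋃ i, C i, ?_, ?_, ?_⟩
  · intro g hg
    obtain ⟨i, hi⟩ := Set.mem_iUnion.1 hg
    exact hC i g hi
  · intro g hg g' hg' hne
    obtain ⟨i, hi⟩ := Set.mem_iUnion.1 hg
    obtain ⟨i', hi'⟩ := Set.mem_iUnion.1 hg'
    by_cases hii : i = i'
    · subst hii
      exact hCd i hi hi' hne
    · refine (hd hii).mono ?_ ?_
      · rw [← hCS i]; exact Set.subset_biUnion_of_mem (u := fun g => Set.range g) hi
      · rw [← hCS i']; exact Set.subset_biUnion_of_mem (u := fun g => Set.range g) hi'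
  · rw [Set.biUnion_iUnion]
    exact Set.iUnion_congr hCS

theorem Tileable.union {F : KGraph k V} {H : KGraph k W} {S T : Set W} (hS : Tileable F H S)
    (hT : Tileable F H T) (hd : Disjoint S T) : Tileable F H (S ∪ T) := by
  rw [Set.union_eq_iUnion]
  refine tileable_iUnion (fun b => by cases b <;> assumption) ?_
  intro a b hab
  cases a <;> cases b <;> first | exact absurd rfl hab | exact hd | exact hd.symm

theorem Tileable.dvd_ncard [Fintype V] [Fintype W] {F : KGraph k V} {H : KGraph k W} {S : Set W}
    (hS : Tileable F H S) : Fintype.card V ∣ S.ncard := by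
  classical
  obtain ⟨C, hC, hd, rfl⟩ := hS
  have : (⋃ g ∈ C, Set.range g) =
      ((C.toFinset.biUnion fun g => Finset.univ.image g : Finset W) : Set W) := by
    simp
  rw [this, Set.ncard_coe_finset, Finset.card_biUnion]
  · refine Finset.dvd_sum fun g hg => ?_
    rw [Finset.card_image_of_injective _ (hC g (by simpa using hg)).1, Finset.card_univ]
  · intro g hg g' hg' hne
    have := hd (by simpa using hg) (by simpa using hg') hne
    simpa [onFun, ← Finset.disjoint_coe] using this

theorem Tileable.hasFactor {F : KGraph k V} {H : KGraph k W} (h : Tileable F H Set.univ) :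
    HasFactor F H := by
  obtain ⟨C, hC, hd, hu⟩ := h
  refine ⟨{c | ⇑c.toEmbedding ∈ C}, ?_, ?_⟩
  · intro c hc c' hc' hne
    refine hd hc hc' fun heq => hne ?_
    cases c; cases c'
    congr
    exact DFunLike.coe_injective heq
  · rw [Set.eq_univ_iff_forall]
    intro w
    have hw : w ∈ ⋃ g ∈ C, Set.range g := by rw [hu]; trivial
    simp only [Set.mem_iUnion] at hw ⊢
    obtain ⟨g, hg, hgw⟩ := hw
    exact ⟨(hC g hg).toCopy, hg, hgw⟩

section Absorb

variable [DecidableEq V]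

theorem Absorbs.tileable {F : KGraph k V} {H : KGraph k W} {A : V × (V ⊕ V) → W} {T : V → W}
    (h : Absorbs F H A T) : Tileable F H (Set.range A) := by
  obtain ⟨hA, -, y, -, hlink⟩ := h
  have hS : Set.range A = ⋃ i, (Set.range (fun b => A (i, Sum.inl b)) ∪
      Set.range (fun b => A (i, Sum.inr b))) := by
    ext w
    simp
  rw [hS]
  refine tileable_iUnion (fun i => ?_) ?_
  · obtain ⟨u, ⟨_, -, h1, -⟩, ⟨_, -, h2, -⟩⟩ := hlink i
    refine h1.tileable_range.union h2.tileable_range ?_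
    rw [Set.disjoint_left]
    rintro _ ⟨b, rfl⟩ ⟨b', hb'⟩
    simpa using hA hb'
  · intro i i' hii
    rw [onFun, Set.disjoint_left]
    rintro _ (⟨b, rfl⟩ | ⟨b, rfl⟩) (⟨b', hb'⟩ | ⟨b', hb'⟩) <;>
    exact hii (congrArg Prod.fst (hA hb')).symm

theorem range_update_of_injective {g : V → W} (hg : Injective g) (b : V) (t : W) :
    Set.range (update g b t) = insert t (Set.range g \ {g b}) := by
  ext w
  simp only [Set.mem_range, Set.mem_insert_iff, Set.mem_sdiff, Set.mem_singleton_iff]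
  constructor
  · rintro ⟨a, rfl⟩
    by_cases hab : a = b
    · subst hab; left; simp
    · right
      rw [update_of_ne hab]
      exact ⟨⟨a, rfl⟩, fun h => hab (hg h)⟩
  · rintro (rfl | ⟨⟨a, rfl⟩, hne⟩)
    · exact ⟨b, by simp⟩
    · refine ⟨a, update_of_ne ?_ _ _⟩
      rintro rfl
      exact hne rfl

/-- In block i the first copy gives up u_i for `T i`, and the second gives up y_i for u_i. All
vertices except the y_i are then tiled, and these form one further copy of F. -/
theorem Absorbs.tileable_union {F : KGraph k V} {H : KGraph k W} {A : V × (V ⊕ V) → W}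
    {T : V → W} (h : Absorbs F H A T) (hT : Injective T) :
    Tileable F H (Set.range A ∪ Set.range T) := by
  obtain ⟨hA, hAT, y, hy, hlink⟩ := h
  have hlink' : ∀ i, ∃ u b₁ b₂, (A (i, Sum.inl b₁) = u ∧
      IsCopy F H (fun b => A (i, Sum.inl b)) ∧
      IsCopy F H (update (fun b => A (i, Sum.inl b)) b₁ (T i))) ∧
      A (i, Sum.inr b₂) = y i ∧ IsCopy F H (fun b => A (i, Sum.inr b)) ∧
      IsCopy F H (update (fun b => A (i, Sum.inr b)) b₂ u) := by
    intro i
    obtain ⟨u, ⟨b₁, h₁⟩, b₂, h₂⟩ := hlink i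
    exact ⟨u, b₁, b₂, h₁, h₂⟩
  choose u b₁ b₂ h₁ hb₂ hc₂ hd₂ using hlink'
  choose hb₁ hc₁ hd₁ using h₁
  have hr₁ := fun i => range_update_of_injective (hc₁ i).1 (b₁ i) (T i)
  have hr₂ := fun i => range_update_of_injective (hc₂ i).1 (b₂ i) (u i)
  set S : V → Set W := fun i => Set.range (update (fun b => A (i, Sum.inl b)) (b₁ i) (T i)) ∪
    Set.range (update (fun b => A (i, Sum.inr b)) (b₂ i) (u i)) with hS
  have hyA : ∀ i, y i = A (i, Sum.inr (b₂ i)) := fun i => (hb₂ i).symm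
  have huA : ∀ i, u i = A (i, Sum.inl (b₁ i)) := fun i => (hb₁ i).symm
  have hmem : ∀ i w, w ∈ S i ↔ w = T i ∨ (∃ b, A (i, Sum.inl b) = w) ∨
      ∃ b, b ≠ b₂ i ∧ A (i, Sum.inr b) = w := by
    intro i w
    simp only [hS, hr₁, hr₂, Set.mem_union, Set.mem_insert_iff, Set.mem_sdiff, Set.mem_range,
      Set.mem_singleton_iff]
    constructor
    · rintro ((rfl | ⟨⟨b, rfl⟩, -⟩) | (rfl | ⟨⟨b, rfl⟩, hne⟩))
      · exact Or.inl rfl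
      · exact Or.inr (Or.inl ⟨b, rfl⟩)
      · exact Or.inr (Or.inl ⟨b₁ i, hb₁ i⟩)
      · refine Or.inr (Or.inr ⟨b, ?_, rfl⟩)
        rintro rfl
        exact hne rfl
    · rintro (rfl | ⟨b, rfl⟩ | ⟨b, hb, rfl⟩)
      · exact Or.inl (Or.inl rfl)
      · by_cases hbb : b = b₁ i
        · right; left; rw [huA, hbb]
        · left; right
          exact ⟨⟨b, rfl⟩, fun heq => hbb ((hc₁ i).1 heq)⟩
      · right; right
        exact ⟨⟨b, rfl⟩, fun heq => hb ((hc₂ i).1 heq)⟩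
  have hSt : ∀ i, Tileable F H (S i) := by
    intro i
    refine (hd₁ i).tileable_range.union (hd₂ i).tileable_range ?_
    rw [hr₁, hr₂, Set.disjoint_left]
    rintro w (rfl | ⟨⟨b, rfl⟩, hne⟩) (heq | ⟨⟨b', heq'⟩, -⟩)
    · exact hAT _ _ ((huA i).symm.trans heq.symm)
    · exact hAT _ _ heq'
    · exact hne (heq.trans (hb₁ i).symm)
    · simpa using hA heq'
  have hdisj : Pairwise (Disjoint on S) := by
    intro i i' hii
    rw [onFun, Set.disjoint_left]
    intro w hw hw'
    rw [hmem] at hw hw'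
    rcases hw with rfl | ⟨b, rfl⟩ | ⟨b, hb, rfl⟩ <;>
    rcases hw' with h | ⟨b', h⟩ | ⟨b', hb', h⟩ <;>
    first
    | exact hii (hT h)
    | exact hAT _ _ h
    | exact hii (congrArg Prod.fst (hA h)).symm
  have hfinal : Set.range A ∪ Set.range T = (⋃ i, S i) ∪ Set.range y := by
    ext w
    simp only [Set.mem_union, Set.mem_iUnion, hmem, Set.mem_range]
    constructor
    · rintro (⟨⟨i, b | b⟩, rfl⟩ | ⟨i, rfl⟩)
      · exact Or.inl ⟨i, Or.inr (Or.inl ⟨b, rfl⟩)⟩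
      · by_cases hb : b = b₂ i
        · right; exact ⟨i, by rw [hyA, hb]⟩
        · exact Or.inl ⟨i, Or.inr (Or.inr ⟨b, hb, rfl⟩)⟩
      · exact Or.inl ⟨i, Or.inl rfl⟩
    · rintro (⟨i, rfl | ⟨b, rfl⟩ | ⟨b, -, rfl⟩⟩ | ⟨i, rfl⟩)
      · exact Or.inr ⟨i, rfl⟩
      · exact Or.inl ⟨_, rfl⟩
      · exact Or.inl ⟨_, rfl⟩
      · exact Or.inl ⟨_, (hyA i).symm⟩
  rw [hfinal]
  refine (tileable_iUnion hSt hdisj).union hy.tileable_range ?_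
  rw [Set.disjoint_left]
  rintro w hw ⟨i', rfl⟩
  obtain ⟨i, hi⟩ := Set.mem_iUnion.1 hw
  rw [hmem, hyA] at hi
  rcases hi with h | ⟨b, h⟩ | ⟨b, hb, h⟩
  · exact hAT _ _ h
  · simpa using hA h
  · have h' := hA h
    simp only [Prod.mk.injEq, Sum.inr.injEq] at h'
    obtain ⟨rfl, rfl⟩ := h'
    exact hb rfl

end Absorb

/-- The k-graph induced on `U` is still dense once the error is scaled by ε^k. -/
theorem exists_copy_subset {F : KGraph (j + 2) V} (hF : F ∈ cherryCOVER (j + 2) 1 V) {p ε : ℝ}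
    (hp0 : 0 < p) (hp1 : p < 1) (hε : 0 < ε) :
    ∃ (n₀ : ℕ) (μ : ℝ), 0 < μ ∧ ∀ (W : Type) [Fintype W] (H : KGraph (j + 2) W),
      H.CherryDense p μ → n₀ ≤ Fintype.card W → ∀ U : Set W, ε * Fintype.card W ≤ U.ncard →
      ∃ g : V → W, IsCopy F H g ∧ Set.range g ⊆ U := by
  classical
  obtain ⟨n₀, μ, hμ, h⟩ := exists_copy hF hp0 hp1
  obtain ⟨N, hN⟩ := exists_nat_gt (n₀ / ε)
  refine ⟨N, μ * ε ^ (j + 2), by positivity, ?_⟩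
  intro W _ H hH hn U hU
  have hcard : (Fintype.card U : ℝ) = U.ncard := by
    rw [← Nat.card_eq_fintype_card, Nat.card_coe_set_eq]
  obtain ⟨g, hg⟩ := h U (H.pull Subtype.val) (hH.pull Subtype.val_injective (by
      rw [hcard, mul_assoc, ← mul_pow]
      gcongr)) (by
      have h1 := (div_lt_iff₀ hε).1 hN
      have h2 : (N : ℝ) ≤ Fintype.card W := by exact_mod_cast hn
      have h3 : (n₀ : ℝ) ≤ Fintype.card U := by
        rw [hcard]
        nlinarith
      exact_mod_cast h3)
  refine ⟨Subtype.val ∘ g, hg.of_pull Subtype.val_injective, ?_⟩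
  rintro _ ⟨v, rfl⟩
  exact (g v).2

theorem exists_almost_tiling [Fintype W] [Nonempty V] {F : KGraph k V} {H : KGraph k W} {c : ℝ}
    (h : ∀ U : Set W, c ≤ U.ncard → ∃ g : V → W, IsCopy F H g ∧ Set.range g ⊆ U) (U : Set W) :
    ∃ R ⊆ U, (R.ncard : ℝ) ≤ c ∧ Tileable F H (U \ R) := by
  induction hm : U.ncard using Nat.strong_induction_on generalizing U with
  | _ m ih =>
    by_cases hU : c ≤ U.ncard
    · obtain ⟨g, hg, hgU⟩ := h U hU
      have hlt : (U \ Set.range g).ncard < m := by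
        rw [← hm]
        refine Set.ncard_lt_ncard ?_
        obtain ⟨v⟩ := (inferInstance : Nonempty V)
        exact ⟨Set.sdiff_subset, fun hsub => (hsub (hgU ⟨v, rfl⟩)).2 ⟨v, rfl⟩⟩
      obtain ⟨R, hR, hRc, hRt⟩ := ih _ hlt (U \ Set.range g) rfl
      refine ⟨R, hR.trans Set.sdiff_subset, hRc, ?_⟩
      have heq : U \ R = ((U \ Set.range g) \ R) ∪ Set.range g := by
        ext w
        simp only [Set.mem_sdiff, Set.mem_union]
        constructor
        · intro hw
          by_cases hwg : w ∈ Set.range g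
          · exact Or.inr hwg
          · exact Or.inl ⟨⟨hw.1, hwg⟩, hw.2⟩
        · rintro (hw | hw)
          · exact ⟨hw.1.1, hw.2⟩
          · exact ⟨hgU hw, fun hwR => (hR hwR).2 hw⟩
      rw [heq]
      refine hRt.union hg.tileable_range ?_
      rw [Set.disjoint_left]
      exact fun w hw hw' => hw.1.2 hw'
    · exact ⟨U, subset_rfl, (not_le.1 hU).le, by rw [sdiff_self]; exact tileable_empty F H⟩

end KGraph

/-! ### Assembly: cover implies factor. -/

namespace KGraph

variable {k j : ℕ} {V : Type*} {W : Type} [Fintype V] [DecidableEq V] [Fintype W]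

open scoped Classical in
-- The remainder `R` is cut into `q` batches of size v(F), matched to distinct absorbers. Absorbers
-- left unmatched are tiled on their own.
theorem tileable_univ_of_absorbers [Nonempty V] {F : KGraph k V} {H : KGraph k W} {q : ℕ}
    {𝒜 : Finset (V × (V ⊕ V) → W)}
    (hdisj : ∀ A ∈ 𝒜, ∀ B ∈ 𝒜, A ≠ B → Disjoint (Set.range A) (Set.range B))
    (htile : ∀ A ∈ 𝒜, Tileable F H (Set.range A))
    (hcount : ∀ T, q ≤ (𝒜.filter (fun A => Absorbs F H A T)).card) {R : Set W}
    (hRA : ∀ A ∈ 𝒜, Disjoint (Set.range A) R) (hR : R.ncard = q * Fintype.card V)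
    (hrest : Tileable F H ((⋃ A ∈ 𝒜, Set.range A)ᶜ \ R)) : Tileable F H Set.univ := by
  have hcard : Fintype.card R = Fintype.card (Fin q × V) := by
    rw [← Nat.card_eq_fintype_card, Nat.card_coe_set_eq, hR]; simp
  let e : R ≃ Fin q × V := Fintype.equivOfCardEq hcard
  set T : Fin q → V → W := fun i b => (e.symm (i, b)).1 with hT
  have hTinj : ∀ i b i' b', T i b = T i' b' → i = i' ∧ b = b' := by
    intro i b i' b' h
    have := e.symm.injective (Subtype.ext h)
    exact Prod.mk.inj this
  have hTR : ∀ w, w ∈ R ↔ ∃ i b, T i b = w := by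
    intro w
    constructor
    · intro hw
      exact ⟨(e ⟨w, hw⟩).1, (e ⟨w, hw⟩).2, by simp [hT]⟩
    · rintro ⟨i, b, rfl⟩
      exact (e.symm (i, b)).2
  -- Hall's condition is immediate: any nonempty set of batches has at most `q` members, and a
  -- single batch already has `q` candidates.
  obtain ⟨A, hAinj, hA⟩ := (Finset.all_card_le_biUnion_card_iff_exists_injective
    (fun i : Fin q => 𝒜.filter (fun A => Absorbs F H A (T i)))).1 (by
      intro s
      rcases s.eq_empty_or_nonempty with rfl | ⟨i, hi⟩
      · simp
      · calc s.card ≤ q := by simpa using Finset.card_le_univ s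
          _ ≤ _ := hcount (T i)
          _ ≤ _ := Finset.card_le_card
            (Finset.subset_biUnion_of_mem (fun i => 𝒜.filter (fun A => Absorbs F H A (T i))) hi))
  simp only [Finset.mem_filter] at hA
  set S : 𝒜 → Set W := fun B => Set.range B.1 ∪ {w | ∃ i, A i = B.1 ∧ w ∈ Set.range (T i)} with hS
  have hSt : ∀ B, Tileable F H (S B) := by
    intro B
    by_cases hB : ∃ i, A i = B.1
    · obtain ⟨i, hi⟩ := hB
      have h1 : {w | ∃ i, A i = B.1 ∧ w ∈ Set.range (T i)} = Set.range (T i) := by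
        ext w
        constructor
        · rintro ⟨i', hi', hw⟩
          rwa [hAinj (hi.trans hi'.symm)]
        · exact fun hw => ⟨i, hi, hw⟩
      rw [hS]
      simp only [h1]
      rw [← hi]
      exact (hA i).2.tileable_union fun b b' h => (hTinj _ _ _ _ h).2
    · have h1 : {w | ∃ i, A i = B.1 ∧ w ∈ Set.range (T i)} = ∅ := by
        ext w
        simp only [Set.mem_ofPred_eq, Set.mem_empty_iff_false, iff_false]
        exact fun ⟨i, hi, _⟩ => hB ⟨i, hi⟩
      rw [hS]
      simp only [h1, Set.union_empty]
      exact htile B.1 B.2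
  have hSd : Pairwise (Disjoint on S) := by
    intro B B' hBB
    rw [onFun, Set.disjoint_left]
    rintro w (hw | ⟨i, hi, b, rfl⟩) (hw' | ⟨i', hi', b', hb'⟩)
    · exact Set.disjoint_left.1 (hdisj B.1 B.2 B'.1 B'.2 (fun h => hBB (Subtype.ext h))) hw hw'
    · exact Set.disjoint_left.1 (hRA B.1 B.2) hw ((hTR w).2 ⟨i', b', hb'⟩)
    · exact Set.disjoint_left.1 (hRA B'.1 B'.2) hw' ((hTR _).2 ⟨i, b, rfl⟩)
    · refine hBB (Subtype.ext ?_)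
      rw [← hi, ← hi', (hTinj _ _ _ _ hb').1]
  have hU : (Set.univ : Set W) = (⋃ B, S B) ∪ ((⋃ A ∈ 𝒜, Set.range A)ᶜ \ R) := by
    symm
    rw [Set.eq_univ_iff_forall]
    intro w
    by_cases hw : w ∈ ⋃ A ∈ 𝒜, Set.range A
    · left
      simp only [Set.mem_iUnion] at hw ⊢
      obtain ⟨B, hB, hBw⟩ := hw
      exact ⟨⟨B, hB⟩, Or.inl hBw⟩
    · by_cases hwR : w ∈ R
      · left
        obtain ⟨i, b, rfl⟩ := (hTR w).1 hwR
        exact Set.mem_iUnion.2 ⟨⟨A i, (hA i).1⟩, Or.inr ⟨i, rfl, b, rfl⟩⟩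
      · exact Or.inr ⟨hw, hwR⟩
  rw [hU]
  refine (tileable_iUnion hSt hSd).union hrest ?_
  rw [Set.disjoint_left]
  intro w hw hw'
  obtain ⟨B, hB | ⟨i, hi, b, hb⟩⟩ := Set.mem_iUnion.1 hw
  · exact hw'.1 (Set.mem_biUnion B.2 hB)
  · exact hw'.2 ((hTR w).2 ⟨i, b, hb⟩)

theorem cherryCOVER_subset_cherryFACTOR [Nonempty V] :
    cherryCOVER (j + 2) 1 V ⊆ cherryFACTOR (j + 2) 1 V := by
  classical
  intro F hF p α hp0 hp1 hα0 hα1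
  obtain ⟨n₁, c, μ₁, hc, hμ₁, h₁⟩ := exists_many_absorbers hF hp0 hp1 hα0 hα1
  obtain ⟨ξ, N, hξ, hfam⟩ := exists_absorbing_family (V × (V ⊕ V)) V hc
  obtain ⟨n₂, μ₂, hμ₂, h₂⟩ := exists_copy_subset hF hp0 hp1 hξ
  refine ⟨n₁ + N + n₂, min μ₁ μ₂, lt_min hμ₁ hμ₂, ?_⟩
  intro W _ H hH hdeg hn hdvd
  have hdeg' : ∀ w, α * (Fintype.card W : ℝ) ^ (j + 1) ≤ H.tupleDegree w := fun w =>
    le_trans (hdeg.trans (by exact_mod_cast minDegree_one_le H w)) (degree_le_tupleDegree H w)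
  obtain ⟨𝒜, hdisj, hcount⟩ := hfam W (by omega) (fun A T => Absorbs F H A T)
    (h₁ W H (hH.mono (min_le_left _ _)) (by omega) hdeg')
  -- Tuples that absorb nothing need not be tileable. Dropping them does not change the number of
  -- absorbers of any T.
  set ℬ := 𝒜.filter (fun A => ∃ T, Absorbs F H A T) with hℬ
  have hℬ𝒜 : ∀ A ∈ ℬ, A ∈ 𝒜 := fun A hA => (Finset.mem_filter.1 hA).1
  have htile : ∀ A ∈ ℬ, Tileable F H (Set.range A) := fun A hA => by
    obtain ⟨T, hT⟩ := (Finset.mem_filter.1 hA).2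
    exact hT.tileable
  have hdisj' : ∀ A ∈ ℬ, ∀ B ∈ ℬ, A ≠ B → Disjoint (Set.range A) (Set.range B) :=
    fun A hA B hB => hdisj A (hℬ𝒜 A hA) B (hℬ𝒜 B hB)
  obtain ⟨R, hRU, hRc, hRt⟩ := exists_almost_tiling (F := F) (H := H)
    (h₂ W H (hH.mono (min_le_right _ _)) (by omega)) (⋃ A ∈ ℬ, Set.range A)ᶜ
  have hcore : Tileable F H (⋃ A ∈ ℬ, Set.range A) := by
    have : (⋃ A ∈ ℬ, Set.range A) = ⋃ A : ℬ, Set.range A.1 := by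
      ext w
      simp
    rw [this]
    refine tileable_iUnion (fun A => htile A.1 A.2) fun A B hAB => ?_
    exact hdisj' A.1 A.2 B.1 B.2 fun h => hAB (Subtype.ext h)
  -- The complement of `R` is tiled, so its size is a multiple of v(F), and so is n.
  have hRdvd : Fintype.card V ∣ R.ncard := by
    have h1 := (hcore.union hRt (Set.disjoint_left.2 fun w hw hw' => hw'.1 hw)).dvd_ncard
    have h2 : (⋃ A ∈ ℬ, Set.range A) ∪ ((⋃ A ∈ ℬ, Set.range A)ᶜ \ R) = Rᶜ := by
      ext w
      simp only [Set.mem_union, Set.mem_sdiff, Set.mem_compl_iff]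
      constructor
      · rintro (hw | hw)
        · exact fun hwR => hRU hwR hw
        · exact hw.2
      · intro hw
        by_cases hw' : w ∈ ⋃ A ∈ ℬ, Set.range A
        · exact Or.inl hw'
        · exact Or.inr ⟨hw', hw⟩
    rw [h2] at h1
    have h3 := Set.ncard_add_ncard_compl R
    rw [Nat.card_eq_fintype_card] at h3
    exact (Nat.dvd_add_left h1).1 (h3 ▸ hdvd)
  obtain ⟨q, hq⟩ := hRdvd
  refine (tileable_univ_of_absorbers hdisj' htile (q := q) (fun T => ?_) (fun A hA => ?_)
    (by rw [hq, mul_comm]) hRt).hasFactor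
  · have h1 : ℬ.filter (fun A => Absorbs F H A T) = 𝒜.filter (fun A => Absorbs F H A T) := by
      ext A
      simp only [hℬ, Finset.mem_filter]
      exact ⟨fun h => ⟨h.1.1, h.2⟩, fun h => ⟨⟨h.1, T, h.2⟩, h.2⟩⟩
    have h2 := hcount T
    have h3 : (q : ℝ) ≤ R.ncard := by
      rw [hq]
      exact_mod_cast Nat.le_mul_of_pos_left q Fintype.card_pos
    have h4 : (q : ℝ) ≤ ((𝒜.filter (fun A => Absorbs F H A T)).card : ℝ) :=
      h3.trans (hRc.trans h2)
    rw [h1]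
    exact_mod_cast h4
  · rw [Set.disjoint_left]
    exact fun w hw hwR => hRU hwR (Set.mem_biUnion hA hw)

end KGraph

theorem theorem9p2 (k : ℕ) (hk : 2 ≤ k) (V : Type*) [Fintype V] [Nonempty V] :
    KGraph.cherryFACTOR k 1 V = KGraph.cherryCOVER k 1 V := by
  classical
  obtain ⟨j, rfl⟩ : ∃ j, k = j + 2 := ⟨k - 2, by omega⟩
  exact Set.Subset.antisymm KGraph.cherryFACTOR_subset_cherryCOVER
    KGraph.cherryCOVER_subset_cherryFACTOR
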